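/- For an integer $s\ge 3$ let $H^s(\mathbb R)$ be the Sobolev space of (complex-valued, in particular real-valued) functions $f\in L^2(\mathbb R)$ with $\|f\|_s=\bigl(\int_{\mathbb R}(1+k^2)^s|\mathcal F f(k)|^2\,dk\bigr)^{1/2}<\infty$, where $\mathcal F f(k)=\frac1{\sqrt{2\pi}}\int_{\mathbb R}e^{-ikx}f(x)\,dx$ (extended to $L^2(\mathbb R)$), and let $E(t)(k)=e^{ik^3t}$. For $T>0$, $u\in C([0,T];H^s(\mathbb R))$, $\varphi\in H^s(\mathbb R)$ and $t\in[0,T]$ put $$\bar S(u,\varphi)(t)=\mathcal F^{-1}\bigl(E(t)\cdot\mathcal F\varphi\bigr)-\int_0^t\mathcal F^{-1}\Bigl(E(t-\tau)\cdot\mathcal F\bigl(\tfrac{d}{dx}\bigl(\tfrac12u(\tau)^2+\tfrac13u(\tau)^3\bigr)\bigr)\Bigr)\,d\tau ,$$ the integral being an $L^2(\mathbb R)$-valued integral, and let $\alpha_T^s=\sqrt s\cdot 2^s\cdot T^{1/2}+1$. Proposition 2.3. Let $s\ge3$ be an integer, $T>0$, $\varphi,\varphi_n\in H^s(\mathbb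 R)$ with $\|\varphi_n\|_s\le\|\varphi\|_s+1$, and let $v,v_n\in C([0,T];H^s(\mathbb R))$ satisfy $v(t)=\bar S(v,\varphi)(t)$ and $v_n(t)=\bar S(v_n,\varphi_n)(t)$ for all $t\in[0,T]$. If $$\alpha_T^s\,T^{1/2}(3+T)^{3/2}\bigl(12\|\varphi\|_s^2+16\|\varphi\|_s+6\bigr)\le\tfrac12,$$ then for all $t\in[0,T]$ $$\|v(t)-v_n(t)\|_s\le 2(3+T)^{1/2}\|\varphi-\varphi_n\|_s .$$ -/

import Mathlib

open scoped FourierTransform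

namespace CKdV

noncomputable section

open MeasureTheory Set Filter Topology

/-- The space `L²(ℝ; ℂ)`. -/
abbrev L2 : Type := Lp ℂ 2 (volume : Measure ℝ)

/-- The class in `L²(ℝ)` of a square integrable function (and `0` for any other function). -/
def toL2 (f : ℝ → ℂ) : L2 := by
  classical
  exact if h : MemLp f 2 volume then h.toLp f else 0

/-- The angular frequency `k = 2πξ`. Mathlib's Fourier transform is
`𝓕 f ξ = ∫ e^{-2πixξ} f x dx`, so that the unitary transform
`F f k = (2π)^{-1/2} ∫ e^{-ixk} f x dx` is `F f k = (2π)^{-1/2} 𝓕 f (k / 2π)`; a multiplier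
`m(k)` in terms of `F` is the multiplier `m(2πξ)` in terms of `𝓕`, and
`∫ w(k) |F f k|² dk = ∫ w(2πξ) |𝓕 f ξ|² dξ`. -/
def freq (ξ : ℝ) : ℝ := 2 * Real.pi * ξ

/-- The Fourier multiplier operator `F⁻¹ (m · F f)` on `L²(ℝ)`, for a symbol `m` in the angular
frequency (meaningful when `m · F f` is square integrable). -/
def multiplier (m : ℝ → ℂ) (f : L2) : L2 :=
  𝓕⁻ (toL2 fun ξ => m (freq ξ) * (𝓕 f : L2) ξ)

/-- `f ∈ H^s(ℝ)`: the function `(1 + k²)^{s/2} F f k` is square integrable. -/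
def MemHs (s : ℕ) (f : L2) : Prop :=
  Integrable (fun ξ : ℝ => (1 + freq ξ ^ 2) ^ s * ‖(𝓕 f : L2) ξ‖ ^ 2) volume

/-- The norm of `H^s(ℝ)`: `‖f‖_s = (∫ (1 + k²)^s |F f k|² dk)^{1/2}`. -/
def hsNorm (s : ℕ) (f : L2) : ℝ :=
  Real.sqrt (∫ ξ : ℝ, (1 + freq ξ ^ 2) ^ s * ‖(𝓕 f : L2) ξ‖ ^ 2)

/-- `v ∈ C([0, T]; H^s(ℝ))`. -/
def MemCHs (s : ℕ) (T : ℝ) (v : ℝ → L2) : Prop :=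
  (∀ t ∈ Icc 0 T, MemHs s (v t)) ∧
    ∀ t ∈ Icc 0 T, Tendsto (fun t' => hsNorm s (v t' - v t)) (𝓝[Icc 0 T] t) (𝓝 0)

/-- The Airy group `F⁻¹ (E(t) · F f)`, where `E(t)(k) = e^{i k³ t}`. -/
def airy (t : ℝ) (f : L2) : L2 :=
  multiplier (fun k => Complex.exp (Complex.I * (k : ℂ) ^ 3 * (t : ℂ))) f

/-- The derivative `d/dx` of an `L²` function (the Fourier multiplier `ik`). -/
def ddx (f : L2) : L2 :=
  multiplier (fun k => Complex.I * (k : ℂ)) f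

/-- The nonlinearity `u ↦ ½ u² + ⅓ u³`. -/
def nonlin (u : L2) : L2 :=
  toL2 fun x => (1 / 2 : ℂ) * u x ^ 2 + (1 / 3 : ℂ) * u x ^ 3

/-- The Duhamel map `S̄(u, φ)(t) =
F⁻¹ (E(t) · F φ) - ∫₀ᵗ F⁻¹ (E(t - τ) · F (d/dx (½ u(τ)² + ⅓ u(τ)³))) dτ`
(an `L²(ℝ)`-valued Bochner integral). -/
def duhamel (u : ℝ → L2) (φ : L2) (t : ℝ) : L2 :=
  airy t φ - ∫ τ in (0 : ℝ)..t, airy (t - τ) (ddx (nonlin (u τ)))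

/-- The constant `α_T^s = √s · 2^s · T^{1/2} + 1`. -/
def alpha (s : ℕ) (T : ℝ) : ℝ := Real.sqrt s * 2 ^ s * T ^ (1 / 2 : ℝ) + 1

end

end CKdV

open scoped FourierTransform

namespace CKdV

open MeasureTheory Set Filter Topology

noncomputable section

/-! ### Square integrable functions and their classes -/

/-! Both v and v_n solve u_t + u_xxx + ∂ₓ(u²/2 + u³/3) = 0 in Duhamel form. The Airy group is only
an isometry at fixed time, so the derivative in the nonlinearity cannot be recovered there; it is
recovered by Kato's local smoothing. For each x, ∫|∂ₓU(t)ψ(x)|² dt ≤ ‖ψ‖²/3, by Plancherel in time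
after the substitution k ↦ k³ (`lintegral_airy_sq_le`). Integrating against |b(x)|² bounds b·∂ₓU(t)ψ
in L² of space-time by ‖b‖‖ψ‖/√3, for b independent of time. A coefficient that moves in time is
written f(t) = f(0) + ∫₀ᵗ f_t, and every f_t(τ) is treated as a frozen coefficient. This costs only
T·sup‖f_t‖ in L², finite because s ≥ 3 makes u_xxx square integrable (`tnorm_regB_le`); no maximal
function estimate is needed.

Put M = (1+∂ₓ)^s and P = M∂ₓ. The image under M of the x-derivative of the nonlinearity is (u +
u²)Pu, which the smoothing estimate controls, plus terms built from the Leibniz defect P(fg) − fPg −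
gPf. That defect is bounded from H^s × H^s to L² (`norm_regR_le`), by a mean value estimate for its
symbol and the bilinear Fourier bound `bilinear_bound`. Since Pu need not be in L² for u in H^s, all
symbols carry a factor e^{−εk²}; the final bounds do not depend on ε, which is removed by
`hsNorm_le_of_regM`.

For two solutions with data at distance δ let W be the supremum of the H^s distance, and let G be √T
times the space-time L² norm of M applied to the difference of the differentiated nonlinearities
(`gain`). Duhamel's formula gives ‖M(v−u)(t)‖ ≤ δ + G. The estimates above give G ≤ 0.07δ + 0.15W on
a short interval (`gain_le_of_isShort`), hence W ≤ 1.26δ, which is stronger than the claim. The a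
priori bounds used on the way come from comparing a solution with the zero solution, together with a
continuity argument. The hypothesis on T enters only through `isShort_of_alpha_le`, with ρ = ‖φ‖_s +
1 bounding both data. -/

theorem toL2_of_memLp {f : ℝ → ℂ} (h : MemLp f 2 volume) : toL2 f = h.toLp f := by
  simp [toL2, h]

theorem coeFn_toL2 {f : ℝ → ℂ} (h : MemLp f 2 volume) : toL2 f =ᵐ[volume] f := by
  rw [toL2_of_memLp h]; exact h.coeFn_toLp

theorem toL2_congr {f g : ℝ → ℂ} (h : f =ᵐ[volume] g) : toL2 f = toL2 g := by
  by_cases hf : MemLp f 2 volume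
  · have hg : MemLp g 2 volume := (memLp_congr_ae h).1 hf
    rw [toL2_of_memLp hf, toL2_of_memLp hg]
    exact (MemLp.toLp_eq_toLp_iff _ _).2 h
  · have hg : ¬ MemLp g 2 volume := fun hg => hf ((memLp_congr_ae h).2 hg)
    simp [toL2, hf, hg]

theorem toL2_coe (f : L2) : toL2 f = f := by
  rw [toL2_of_memLp (Lp.memLp f), Lp.toLp_coeFn]

theorem L2_ext {f g : L2} (h : ∀ᵐ x, f x = g x) : f = g := Lp.ext h

theorem enorm_sq_eq_lintegral (f : L2) : ‖f‖ₑ ^ 2 = ∫⁻ x, ‖f x‖ₑ ^ 2 := by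
  rw [Lp.enorm_def, eLpNorm_eq_lintegral_rpow_enorm_toReal (by norm_num) (by norm_num)]
  simp only [ENNReal.toReal_ofNat, ENNReal.rpow_ofNat, one_div]
  rw [← ENNReal.rpow_natCast, ← ENNReal.rpow_mul]
  norm_num

theorem norm_sq_eq_integral (f : L2) : ‖f‖ ^ 2 = ∫ x, ‖f x‖ ^ 2 := by
  have h := enorm_sq_eq_lintegral f
  have hm : AEStronglyMeasurable (fun x => ‖f x‖ ^ 2) volume :=
    (Lp.aestronglyMeasurable f).norm.pow 2
  rw [integral_eq_lintegral_of_nonneg_ae (ae_of_all _ fun x => by positivity) hm]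
  have h2 : ∀ x, ENNReal.ofReal (‖f x‖ ^ 2) = ‖f x‖ₑ ^ 2 := fun x => by
    rw [ENNReal.ofReal_pow (norm_nonneg _), ofReal_norm]
  simp_rw [h2, ← h]
  simp

theorem lintegral_enorm_sq_lt_top_iff {f : ℝ → ℂ} (hf : AEStronglyMeasurable f volume) :
    MemLp f 2 volume ↔ ∫⁻ x, ‖f x‖ₑ ^ 2 < ⊤ := by
  rw [MemLp, eLpNorm_lt_top_iff_lintegral_rpow_enorm_lt_top (by norm_num) (by norm_num)]
  simp [hf]

theorem integrable_norm_sq_iff {f : ℝ → ℂ} (hf : AEStronglyMeasurable f volume) :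
    MemLp f 2 volume ↔ Integrable (fun x => ‖f x‖ ^ 2) volume :=
  memLp_two_iff_integrable_sq_norm hf

theorem norm_toL2_sq {f : ℝ → ℂ} (h : MemLp f 2 volume) : ‖toL2 f‖ ^ 2 = ∫ x, ‖f x‖ ^ 2 := by
  rw [norm_sq_eq_integral]
  exact integral_congr_ae ((coeFn_toL2 h).mono fun x hx => by simp only [hx])

theorem enorm_toL2_sq {f : ℝ → ℂ} (h : MemLp f 2 volume) :
    ‖toL2 f‖ₑ ^ 2 = ∫⁻ x, ‖f x‖ₑ ^ 2 := by
  rw [enorm_sq_eq_lintegral]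
  exact lintegral_congr_ae ((coeFn_toL2 h).mono fun x hx => by simp only [hx])

theorem norm_le_of_ae_le {f g : L2} {C : ℝ} (h : ∀ᵐ x, ‖f x‖ ≤ C * ‖g x‖) : ‖f‖ ≤ C * ‖g‖ :=
  Lp.norm_le_mul_norm_of_ae_le_mul h

/-! ### Fourier multipliers -/

theorem continuous_freq : Continuous freq := by unfold freq; fun_prop

theorem measurable_freq : Measurable freq := continuous_freq.measurable

/-- Bounded measurable symbols. -/
def IsBddSymbol (σ : ℝ → ℂ) : Prop := Measurable σ ∧ ∃ C : ℝ, ∀ k, ‖σ k‖ ≤ C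

theorem aesm_symbol_mul {σ : ℝ → ℂ} (hσ : Measurable σ) (f : L2) :
    AEStronglyMeasurable (fun ξ => σ (freq ξ) * f ξ) volume :=
  ((hσ.comp measurable_freq).aestronglyMeasurable).mul (Lp.aestronglyMeasurable f)

theorem IsBddSymbol.memLp {σ : ℝ → ℂ} (hσ : IsBddSymbol σ) (f : L2) :
    MemLp (fun ξ => σ (freq ξ) * f ξ) 2 volume := by
  obtain ⟨hm, C, hC⟩ := hσ
  refine (Lp.memLp f).of_le_mul (c := C) (aesm_symbol_mul hm f) (ae_of_all _ fun ξ => ?_)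
  rw [norm_mul]
  exact mul_le_mul_of_nonneg_right (hC _) (norm_nonneg _)

theorem fourier_multiplier {σ : ℝ → ℂ} {f : L2}
    (h : MemLp (fun ξ => σ (freq ξ) * (𝓕 f : L2) ξ) 2 volume) :
    (𝓕 (multiplier σ f) : L2) =ᵐ[volume] fun ξ => σ (freq ξ) * (𝓕 f : L2) ξ := by
  have : (𝓕 (multiplier σ f) : L2) = toL2 fun ξ => σ (freq ξ) * (𝓕 f : L2) ξ := by
    simp [multiplier]
  rw [this]
  exact coeFn_toL2 h

theorem fourier_add_coe (f g : L2) :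
    (𝓕 (f + g) : L2) =ᵐ[volume] fun ξ => (𝓕 f : L2) ξ + (𝓕 g : L2) ξ := by
  rw [FourierTransform.fourier_add]
  exact Lp.coeFn_add _ _

theorem fourier_sub_coe (f g : L2) :
    (𝓕 (f - g) : L2) =ᵐ[volume] fun ξ => (𝓕 f : L2) ξ - (𝓕 g : L2) ξ := by
  have : (𝓕 (f - g) : L2) = 𝓕 f - 𝓕 g := (Lp.fourierTransformₗᵢ ℝ ℂ).map_sub f g
  rw [this]
  exact Lp.coeFn_sub _ _

theorem fourier_smul_coe (c : ℂ) (f : L2) :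
    (𝓕 (c • f) : L2) =ᵐ[volume] fun ξ => c * (𝓕 f : L2) ξ := by
  rw [FourierTransform.fourier_smul]
  exact Lp.coeFn_smul _ _

theorem fourier_zero_coe : (𝓕 (0 : L2) : L2) =ᵐ[volume] fun _ => (0 : ℂ) := by
  have : (𝓕 (0 : L2) : L2) = 0 := (Lp.fourierTransformₗᵢ ℝ ℂ).map_zero
  rw [this]
  exact Lp.coeFn_zero _ _ _

/-- Elements of `L²` are equal as soon as their Fourier transforms agree almost everywhere. -/
theorem fourier_ext {f g : L2} (h : (𝓕 f : L2) =ᵐ[volume] (𝓕 g : L2)) : f = g :=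
  (Lp.fourierTransformₗᵢ ℝ ℂ).injective (Lp.ext h)

/-- The multiplier operator of a bounded symbol as a bounded operator. -/
def multiplierL (σ : ℝ → ℂ) (hσ : IsBddSymbol σ) : L2 →L[ℂ] L2 :=
  LinearMap.mkContinuous
    { toFun := multiplier σ
      map_add' := fun f g => fourier_ext <| by
        filter_upwards [fourier_multiplier (hσ.memLp (𝓕 (f + g))),
          fourier_multiplier (hσ.memLp (𝓕 f)), fourier_multiplier (hσ.memLp (𝓕 g)),
          fourier_add_coe f g, fourier_add_coe (multiplier σ f) (multiplier σ g)]
          with ξ h1 h2 h3 h4 h5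
        rw [h1, h5, h2, h3, h4]; ring
      map_smul' := fun c f => fourier_ext <| by
        filter_upwards [fourier_multiplier (hσ.memLp (𝓕 (c • f))),
          fourier_multiplier (hσ.memLp (𝓕 f)),
          fourier_smul_coe c f, fourier_smul_coe c (multiplier σ f)] with ξ h1 h2 h3 h4
        simp only [RingHom.id_apply]
        rw [h1, h4, h2, h3]; ring }
    hσ.2.choose fun f => by
      change ‖multiplier σ f‖ ≤ _
      rw [← Lp.norm_fourier_eq (multiplier σ f), ← Lp.norm_fourier_eq f]
      refine norm_le_of_ae_le ?_
      filter_upwards [fourier_multiplier (hσ.memLp (𝓕 f))] with ξ h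
      rw [h, norm_mul]
      exact mul_le_mul_of_nonneg_right (hσ.2.choose_spec _) (norm_nonneg _)

@[simp] theorem multiplierL_apply (σ : ℝ → ℂ) (hσ : IsBddSymbol σ) (f : L2) :
    multiplierL σ hσ f = multiplier σ f := rfl

/-- Dominated convergence for Fourier multipliers. -/
theorem tendsto_multiplier_zero {ι : Type*} {l : Filter ι} [l.IsCountablyGenerated]
    {σ : ι → ℝ → ℂ} {B : ℝ → ℝ} {f : L2} (hσ : ∀ i, Measurable (σ i))
    (hB : Integrable (fun ξ => (B (freq ξ) * ‖(𝓕 f : L2) ξ‖) ^ 2) volume)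
    (hle : ∀ᶠ i in l, ∀ k, ‖σ i k‖ ≤ B k) (hlim : ∀ k, Tendsto (fun i => σ i k) l (𝓝 0)) :
    Tendsto (fun i => ‖multiplier (σ i) f‖) l (𝓝 0) := by
  have key : Tendsto (fun i => ∫ ξ, ‖σ i (freq ξ) * (𝓕 f : L2) ξ‖ ^ 2) l
      (𝓝 (∫ _ξ : ℝ, (0 : ℝ))) := by
    refine tendsto_integral_filter_of_dominated_convergence
      (fun ξ => (B (freq ξ) * ‖(𝓕 f : L2) ξ‖) ^ 2) ?_ ?_ hB ?_
    · exact Eventually.of_forall fun i => (aesm_symbol_mul (hσ i) _).norm.pow 2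
    · filter_upwards [hle] with i hi
      refine ae_of_all _ fun ξ => ?_
      rw [Real.norm_of_nonneg (by positivity), norm_mul]
      gcongr
      exact hi _
    · refine ae_of_all _ fun ξ => ?_
      have := ((hlim (freq ξ)).mul_const ((𝓕 f : L2) ξ)).norm.pow 2
      simpa using this
  rw [integral_zero] at key
  have h2 : Tendsto (fun i => ‖multiplier (σ i) f‖ ^ 2) l (𝓝 0) := by
    refine key.congr' ?_
    filter_upwards [hle] with i hi
    have hm : MemLp (fun ξ => σ i (freq ξ) * (𝓕 f : L2) ξ) 2 volume := by
      rw [integrable_norm_sq_iff (aesm_symbol_mul (hσ i) _)]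
      refine hB.mono' ((aesm_symbol_mul (hσ i) _).norm.pow 2) (ae_of_all _ fun ξ => ?_)
      rw [Real.norm_of_nonneg (by positivity), norm_mul]
      gcongr
      exact hi _
    rw [← Lp.norm_fourier_eq (multiplier (σ i) f), norm_sq_eq_integral]
    exact (integral_congr_ae ((fourier_multiplier hm).mono fun x hx => by simp only [hx])).symm
  have h3 := h2.sqrt
  simpa [Real.sqrt_sq (norm_nonneg _)] using h3

/-- On integrable square integrable functions the inverse Fourier transform of `L²` is the
inverse Fourier integral. -/
theorem fourierInv_toL2 {h : ℝ → ℂ} (h1 : Integrable h volume) (h2 : MemLp h 2 volume) :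
    (𝓕⁻ (toL2 h) : L2) =ᵐ[volume] 𝓕⁻ h := by
  have hcont : Continuous (𝓕⁻ h) := by
    have : (𝓕⁻ h : ℝ → ℂ) = fun x => 𝓕 h (-x) := by
      ext x; exact Real.fourierInv_eq_fourier_neg h x
    rw [this]
    exact (VectorFourier.fourierIntegral_continuous Real.continuous_fourierChar
      (by exact continuous_inner) h1).comp continuous_neg
  -- The L² transform is identified through its action on tempered distributions, so both sides are
  -- tested against smooth compactly supported functions and the transform is moved onto the test
  -- function.
  refine ae_eq_of_integral_contDiff_smul_eq
    ((Lp.memLp _).locallyIntegrable (by norm_num)) hcont.locallyIntegrable ?_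
  intro g hg hgs
  have hg1 : HasCompactSupport (fun x => (g x : ℂ)) := hgs.comp_left (g := ((↑) : ℝ → ℂ)) (by simp)
  have hg2 : ContDiff ℝ (⊤ : ℕ∞) (fun x => (g x : ℂ)) := Complex.ofRealCLM.contDiff.comp hg
  set G : SchwartzMap ℝ ℂ := hg1.toSchwartzMap hg2 with hG
  have e1 := congrArg (fun d => d G) (Lp.fourierInv_toTemperedDistribution_eq (toL2 h))
  simp only [TemperedDistribution.fourierInv_apply, Lp.toTemperedDistribution_apply] at e1
  have hGc : ∀ x, G x = (g x : ℂ) := fun x => rfl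
  simp only [hGc] at e1
  have e2 : ∫ x, g x • (𝓕⁻ (toL2 h) : L2) x = ∫ x, (𝓕⁻ G) x • (toL2 h) x := by
    rw [e1]; rfl
  rw [e2]
  have e3 : ∫ x, (𝓕⁻ G) x • (toL2 h) x = ∫ x, (𝓕⁻ G) x • h x :=
    integral_congr_ae ((coeFn_toL2 h2).mono fun x hx => by simp only [hx])
  rw [e3]
  -- The pairing with the sign reversed turns the general Fubini identity for Fourier integrals into
  -- the one for the inverse transform.
  have e4 := VectorFourier.integral_fourierIntegral_smul_eq_flip (L := -innerₗ ℝ)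
    (μ := (volume : Measure ℝ)) (ν := (volume : Measure ℝ)) Real.continuous_fourierChar
    (by simp only [LinearMap.neg_apply, innerₗ_apply_apply]; fun_prop) G.integrable h1
  have e5 : (-innerₗ ℝ : ℝ →ₗ[ℝ] ℝ →ₗ[ℝ] ℝ).flip = -innerₗ ℝ := by
    ext; simp
  rw [e5] at e4
  have e6 : ∀ (u : ℝ → ℂ) x, VectorFourier.fourierIntegral 𝐞 volume (-innerₗ ℝ) u x = 𝓕⁻ u x :=
    fun u x => by
      simp [VectorFourier.fourierIntegral, Real.fourierInv_eq, Circle.smul_def]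
  simp only [e6] at e4
  refine Eq.trans (integral_congr_ae (ae_of_all _ fun x => ?_)) e4
  exact congrArg (· • h x) (congrFun (SchwartzMap.fourierInv_coe G) x)

end

noncomputable section

/-! ### Sobolev spaces -/

/-- The Japanese bracket `⟨k⟩ = (1 + k²)^{1/2}`. -/
def jb (k : ℝ) : ℝ := Real.sqrt (1 + k ^ 2)

theorem jb_sq (k : ℝ) : jb k ^ 2 = 1 + k ^ 2 := Real.sq_sqrt (by positivity)

theorem one_le_jb (k : ℝ) : 1 ≤ jb k := by
  rw [jb, Real.one_le_sqrt]; nlinarith [sq_nonneg k]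

theorem jb_pos (k : ℝ) : 0 < jb k := lt_of_lt_of_le one_pos (one_le_jb k)

theorem abs_le_jb (k : ℝ) : |k| ≤ jb k := by
  rw [jb, ← Real.sqrt_sq_eq_abs]
  exact Real.sqrt_le_sqrt (by linarith)

theorem continuous_jb : Continuous jb := by unfold jb; fun_prop

/-- The symbol `(1 + ik)^s`, of absolute value `⟨k⟩^s`. -/
def sob (s : ℕ) (k : ℝ) : ℂ := (1 + Complex.I * (k : ℂ)) ^ s

theorem norm_one_add_I_mul (k : ℝ) : ‖(1 : ℂ) + Complex.I * (k : ℂ)‖ = jb k := by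
  rw [jb, Complex.norm_eq_sqrt_sq_add_sq]; simp

theorem norm_sob (s : ℕ) (k : ℝ) : ‖sob s k‖ = jb k ^ s := by
  rw [sob, norm_pow, norm_one_add_I_mul]

theorem continuous_sob (s : ℕ) : Continuous (sob s) := by unfold sob; fun_prop

theorem measurable_sob (s : ℕ) : Measurable (sob s) := (continuous_sob s).measurable

theorem sob_weight (s : ℕ) (f : L2) (ξ : ℝ) :
    ‖sob s (freq ξ) * (𝓕 f : L2) ξ‖ ^ 2 = (1 + freq ξ ^ 2) ^ s * ‖(𝓕 f : L2) ξ‖ ^ 2 := by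
  rw [norm_mul, mul_pow, norm_sob, ← jb_sq, ← pow_mul, ← pow_mul, mul_comm s 2]

theorem memHs_iff {s : ℕ} {f : L2} :
    MemHs s f ↔ MemLp (fun ξ => sob s (freq ξ) * (𝓕 f : L2) ξ) 2 volume := by
  rw [integrable_norm_sq_iff (aesm_symbol_mul (measurable_sob s) _), MemHs]
  simp_rw [sob_weight]

theorem hsNorm_nonneg (s : ℕ) (f : L2) : 0 ≤ hsNorm s f := Real.sqrt_nonneg _

theorem hsNorm_eq_norm {s : ℕ} {f : L2} (h : MemHs s f) :
    hsNorm s f = ‖multiplier (sob s) f‖ := by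
  rw [memHs_iff] at h
  rw [← Lp.norm_fourier_eq, ← Real.sqrt_sq (norm_nonneg (𝓕 (multiplier (sob s) f) : L2)),
    norm_sq_eq_integral, hsNorm]
  congr 1
  refine integral_congr_ae ((fourier_multiplier h).mono fun x hx => ?_)
  simp only [hx, sob_weight]

/-- A symbol of growth `⟨k⟩^s` acts on `H^s`. -/
theorem MemHs.memLp_symbol {s : ℕ} {f : L2} (h : MemHs s f) {σ : ℝ → ℂ} {C : ℝ}
    (hσ : Measurable σ) (hC : ∀ k, ‖σ k‖ ≤ C * jb k ^ s) :
    MemLp (fun ξ => σ (freq ξ) * (𝓕 f : L2) ξ) 2 volume := by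
  refine (memHs_iff.1 h).of_le_mul (c := C) (aesm_symbol_mul hσ _) (ae_of_all _ fun ξ => ?_)
  rw [norm_mul, norm_mul, norm_sob, ← mul_assoc]
  exact mul_le_mul_of_nonneg_right (hC _) (norm_nonneg _)

theorem MemHs.norm_multiplier_le {s : ℕ} {f : L2} (h : MemHs s f) {σ : ℝ → ℂ} {C : ℝ}
    (hσ : Measurable σ) (hC : ∀ k, ‖σ k‖ ≤ C * jb k ^ s) :
    ‖multiplier σ f‖ ≤ C * hsNorm s f := by
  rw [hsNorm_eq_norm h, ← Lp.norm_fourier_eq (multiplier σ f),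
    ← Lp.norm_fourier_eq (multiplier (sob s) f)]
  refine norm_le_of_ae_le ?_
  filter_upwards [fourier_multiplier (h.memLp_symbol hσ hC),
    fourier_multiplier (memHs_iff.1 h)] with ξ h1 h2
  rw [h1, h2, norm_mul, norm_mul, norm_sob, ← mul_assoc]
  exact mul_le_mul_of_nonneg_right (hC _) (norm_nonneg _)

theorem multiplier_add {σ : ℝ → ℂ} {f g : L2}
    (hf : MemLp (fun ξ => σ (freq ξ) * (𝓕 f : L2) ξ) 2 volume)
    (hg : MemLp (fun ξ => σ (freq ξ) * (𝓕 g : L2) ξ) 2 volume) :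
    MemLp (fun ξ => σ (freq ξ) * (𝓕 (f + g) : L2) ξ) 2 volume ∧
      multiplier σ (f + g) = multiplier σ f + multiplier σ g := by
  have h : MemLp (fun ξ => σ (freq ξ) * (𝓕 (f + g) : L2) ξ) 2 volume := by
    refine (memLp_congr_ae ?_).1 (hf.add hg)
    filter_upwards [fourier_add_coe f g] with ξ h
    simp only [Pi.add_apply]; rw [h]; ring
  refine ⟨h, fourier_ext ?_⟩
  filter_upwards [fourier_multiplier h, fourier_multiplier hf, fourier_multiplier hg,
    fourier_add_coe f g, fourier_add_coe (multiplier σ f) (multiplier σ g)] with ξ h1 h2 h3 h4 h5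
  rw [h1, h5, h2, h3, h4]; ring

theorem multiplier_smul {σ : ℝ → ℂ} {f : L2} (c : ℂ)
    (hf : MemLp (fun ξ => σ (freq ξ) * (𝓕 f : L2) ξ) 2 volume) :
    MemLp (fun ξ => σ (freq ξ) * (𝓕 (c • f) : L2) ξ) 2 volume ∧
      multiplier σ (c • f) = c • multiplier σ f := by
  have h : MemLp (fun ξ => σ (freq ξ) * (𝓕 (c • f) : L2) ξ) 2 volume := by
    refine (memLp_congr_ae ?_).1 (hf.const_mul c)
    filter_upwards [fourier_smul_coe c f] with ξ h
    rw [h]; ring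
  refine ⟨h, fourier_ext ?_⟩
  filter_upwards [fourier_multiplier h, fourier_multiplier hf,
    fourier_smul_coe c f, fourier_smul_coe c (multiplier σ f)] with ξ h1 h2 h4 h5
  rw [h1, h5, h2, h4]; ring

theorem multiplier_sub {σ : ℝ → ℂ} {f g : L2}
    (hf : MemLp (fun ξ => σ (freq ξ) * (𝓕 f : L2) ξ) 2 volume)
    (hg : MemLp (fun ξ => σ (freq ξ) * (𝓕 g : L2) ξ) 2 volume) :
    MemLp (fun ξ => σ (freq ξ) * (𝓕 (f - g) : L2) ξ) 2 volume ∧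
      multiplier σ (f - g) = multiplier σ f - multiplier σ g := by
  obtain ⟨h1, h2⟩ := multiplier_smul (-1) hg
  obtain ⟨h3, h4⟩ := multiplier_add hf h1
  have e : f + (-1 : ℂ) • g = f - g := by module
  rw [e] at h3 h4
  exact ⟨h3, by rw [h4, h2]; module⟩

theorem MemHs.add {s : ℕ} {f g : L2} (hf : MemHs s f) (hg : MemHs s g) : MemHs s (f + g) :=
  memHs_iff.2 (multiplier_add (memHs_iff.1 hf) (memHs_iff.1 hg)).1

theorem MemHs.sub {s : ℕ} {f g : L2} (hf : MemHs s f) (hg : MemHs s g) : MemHs s (f - g) :=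
  memHs_iff.2 (multiplier_sub (memHs_iff.1 hf) (memHs_iff.1 hg)).1

theorem MemHs.smul {s : ℕ} {f : L2} (c : ℂ) (hf : MemHs s f) : MemHs s (c • f) :=
  memHs_iff.2 (multiplier_smul c (memHs_iff.1 hf)).1

theorem memHs_zero (s : ℕ) : MemHs s 0 := by
  refine (integrable_zero ℝ ℝ volume).congr ?_
  filter_upwards [fourier_zero_coe] with ξ h
  rw [h]; simp

theorem hsNorm_zero (s : ℕ) : hsNorm s 0 = 0 := by
  have : ∫ ξ : ℝ, (1 + freq ξ ^ 2) ^ s * ‖(𝓕 (0 : L2) : L2) ξ‖ ^ 2 = ∫ _ξ : ℝ, (0 : ℝ) := by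
    refine integral_congr_ae ?_
    filter_upwards [fourier_zero_coe] with ξ h
    rw [h]; simp
  rw [hsNorm, this]; simp

theorem hsNorm_add_le {s : ℕ} {f g : L2} (hf : MemHs s f) (hg : MemHs s g) :
    hsNorm s (f + g) ≤ hsNorm s f + hsNorm s g := by
  rw [hsNorm_eq_norm (hf.add hg), hsNorm_eq_norm hf, hsNorm_eq_norm hg,
    (multiplier_add (memHs_iff.1 hf) (memHs_iff.1 hg)).2]
  exact norm_add_le _ _

theorem hsNorm_smul {s : ℕ} {f : L2} (c : ℂ) (hf : MemHs s f) :
    hsNorm s (c • f) = ‖c‖ * hsNorm s f := by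
  rw [hsNorm_eq_norm (hf.smul c), hsNorm_eq_norm hf, (multiplier_smul c (memHs_iff.1 hf)).2,
    norm_smul]

theorem hsNorm_sub_le {s : ℕ} {f g : L2} (hf : MemHs s f) (hg : MemHs s g) :
    hsNorm s (f - g) ≤ hsNorm s f + hsNorm s g := by
  rw [hsNorm_eq_norm (hf.sub hg), hsNorm_eq_norm hf, hsNorm_eq_norm hg,
    (multiplier_sub (memHs_iff.1 hf) (memHs_iff.1 hg)).2]
  exact norm_sub_le _ _

theorem MemHs.mono {s r : ℕ} {f : L2} (h : MemHs s f) (hr : r ≤ s) : MemHs r f :=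
  memHs_iff.2 <| h.memLp_symbol (C := 1) (measurable_sob r) fun k => by
    rw [norm_sob, one_mul]; exact pow_le_pow_right₀ (one_le_jb k) hr

theorem MemHs.hsNorm_mono {s r : ℕ} {f : L2} (h : MemHs s f) (hr : r ≤ s) :
    hsNorm r f ≤ hsNorm s f := by
  rw [hsNorm_eq_norm (h.mono hr), ← one_mul (hsNorm s f)]
  refine h.norm_multiplier_le (measurable_sob r) fun k => ?_
  rw [norm_sob, one_mul]; exact pow_le_pow_right₀ (one_le_jb k) hr

theorem multiplier_one (f : L2) : multiplier (fun _ => 1) f = f := by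
  simp [multiplier, toL2_coe]

theorem MemHs.norm_le {s : ℕ} {f : L2} (h : MemHs s f) : ‖f‖ ≤ hsNorm s f := by
  have := h.norm_multiplier_le (σ := fun _ => 1) (C := 1) measurable_const fun k => by
    simpa using one_le_pow₀ (one_le_jb k)
  rwa [multiplier_one, one_mul] at this

/-! ### Integrability of the Fourier transform -/

theorem integrable_inv_jb_sq : Integrable (fun ξ => (jb (freq ξ) ^ 2)⁻¹) volume := by
  simp_rw [jb_sq, freq]
  exact integrable_inv_one_add_sq.comp_mul_left' (by positivity)

/-- In angular frequency this is π/(2π). It fixes the constants below: 71/100 is slightly above its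
square root, and two such integrals make the mass 1 of `pairWeight`. -/
theorem integral_inv_jb_sq : ∫ ξ, (jb (freq ξ) ^ 2)⁻¹ = 1 / 2 := by
  simp_rw [jb_sq, freq]
  rw [Measure.integral_comp_mul_left (fun x : ℝ => (1 + x ^ 2)⁻¹), integral_univ_inv_one_add_sq,
    abs_of_pos (by positivity), smul_eq_mul]
  field_simp

theorem lintegral_inv_jb_sq :
    ∫⁻ ξ, ENNReal.ofReal ((jb (freq ξ) ^ 2)⁻¹) = ENNReal.ofReal (1 / 2) := by
  rw [← integral_inv_jb_sq, ofReal_integral_eq_lintegral_ofReal integrable_inv_jb_sq]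
  exact ae_of_all _ fun ξ => by positivity

/-- Cauchy–Schwarz, splitting off ⟨k⟩⁻¹ against ⟨k⟩ times the transform. -/
theorem MemHs.integrable_fourier {s : ℕ} {f : L2} (h : MemHs s f) (hs : 1 ≤ s) :
    Integrable (𝓕 f : L2) volume ∧ ∫ ξ, ‖(𝓕 f : L2) ξ‖ ≤ 71 / 100 * hsNorm s f := by
  have h1 := h.mono hs
  have hm1 : MemLp (fun ξ => (jb (freq ξ))⁻¹) 2 volume := by
    rw [memLp_two_iff_integrable_sq_norm]
    · refine integrable_inv_jb_sq.congr (ae_of_all _ fun ξ => ?_)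
      simp
    · exact ((continuous_jb.comp continuous_freq).measurable.inv).aestronglyMeasurable
  have hm2 : MemLp (fun ξ => ‖sob 1 (freq ξ) * (𝓕 f : L2) ξ‖) 2 volume := (memHs_iff.1 h1).norm
  have e : ∀ ξ, ‖(𝓕 f : L2) ξ‖ = (jb (freq ξ))⁻¹ * ‖sob 1 (freq ξ) * (𝓕 f : L2) ξ‖ := fun ξ => by
    rw [norm_mul, norm_sob, pow_one, inv_mul_cancel_left₀ (jb_pos _).ne']
  have hi : Integrable (fun ξ => ‖(𝓕 f : L2) ξ‖) volume := by
    simp_rw [e]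
    exact hm1.integrable_mul hm2
  refine ⟨(integrable_norm_iff (Lp.aestronglyMeasurable _)).1 hi, ?_⟩
  have cs := integral_mul_le_Lp_mul_Lq_of_nonneg (μ := volume) Real.HolderConjugate.two_two
    (f := fun ξ => (jb (freq ξ))⁻¹) (g := fun ξ => ‖sob 1 (freq ξ) * (𝓕 f : L2) ξ‖)
    (ae_of_all _ fun ξ => inv_nonneg.2 (jb_pos _).le) (ae_of_all _ fun ξ => norm_nonneg _)
    (by simpa using hm1) (by simpa using hm2)
  simp_rw [← e] at cs
  refine cs.trans ?_
  have hn : hsNorm 1 f = (∫ ξ, ‖sob 1 (freq ξ) * (𝓕 f : L2) ξ‖ ^ (2 : ℝ)) ^ (1 / (2 : ℝ)) := by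
    rw [hsNorm, ← Real.sqrt_eq_rpow]
    simp_rw [Real.rpow_ofNat, sob_weight]
  rw [← hn]
  have hj : (∫ ξ, (jb (freq ξ))⁻¹ ^ (2 : ℝ)) = 1 / 2 := by
    rw [← integral_inv_jb_sq]
    simp
  rw [hj, ← Real.sqrt_eq_rpow]
  refine mul_le_mul ?_ (h.hsNorm_mono hs) (hsNorm_nonneg _ _) (by norm_num)
  rw [Real.sqrt_le_left (by norm_num)]; norm_num

/-- Functions with integrable Fourier transform are given by the inverse Fourier integral. -/
theorem coeFn_eq_fourierInv {f : L2} (h : Integrable (𝓕 f : L2) volume) :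
    f =ᵐ[volume] 𝓕⁻ ((𝓕 f : L2) : ℝ → ℂ) := by
  have := fourierInv_toL2 h (Lp.memLp _)
  rw [toL2_coe] at this
  simpa using this

theorem norm_fourierInv_le (h : ℝ → ℂ) (x : ℝ) : ‖𝓕⁻ h x‖ ≤ ∫ ξ, ‖h ξ‖ := by
  rw [Real.fourierInv_eq']
  refine (norm_integral_le_integral_norm _).trans (le_of_eq ?_)
  congr 1; ext ξ
  rw [norm_smul, Complex.norm_exp_ofReal_mul_I, one_mul]

/-- The Sobolev embedding `H^s ⊂ L^∞`. -/
theorem MemHs.ae_norm_le {s : ℕ} {f : L2} (h : MemHs s f) (hs : 1 ≤ s) :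
    ∀ᵐ x, ‖f x‖ ≤ 71 / 100 * hsNorm s f := by
  filter_upwards [coeFn_eq_fourierInv (h.integrable_fourier hs).1] with x hx
  rw [hx]
  exact (norm_fourierInv_le _ _).trans (h.integrable_fourier hs).2

/-! ### Products -/

/-- The pointwise product, as an element of `L²` (meaningful when it is square integrable). -/
def mul (f g : L2) : L2 := toL2 fun x => f x * g x

theorem mul_comm' (f g : L2) : mul f g = mul g f := by
  unfold mul; congr 1; ext x; ring

theorem memLp_mul {f g : L2} {C : ℝ} (hf : ∀ᵐ x, ‖f x‖ ≤ C) :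
    MemLp (fun x => f x * g x) 2 volume := by
  refine (Lp.memLp g).of_le_mul (c := C)
    ((Lp.aestronglyMeasurable f).mul (Lp.aestronglyMeasurable g)) ?_
  filter_upwards [hf] with x hx
  rw [norm_mul]
  exact mul_le_mul_of_nonneg_right hx (norm_nonneg _)

theorem coeFn_mul {f g : L2} {C : ℝ} (hf : ∀ᵐ x, ‖f x‖ ≤ C) :
    mul f g =ᵐ[volume] fun x => f x * g x := coeFn_toL2 (memLp_mul hf)

theorem norm_mul_le_of_ae {f g : L2} {C : ℝ} (hf : ∀ᵐ x, ‖f x‖ ≤ C) :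
    ‖mul f g‖ ≤ C * ‖g‖ := by
  refine norm_le_of_ae_le ?_
  filter_upwards [hf, coeFn_mul (g := g) hf] with x hx h
  rw [h, norm_mul]
  exact mul_le_mul_of_nonneg_right hx (norm_nonneg _)

end

noncomputable section

/-! ### The Fourier transform of a product -/

theorem integrable_mul_reflect {F G : ℝ → ℂ} (hF : MemLp F 2 volume) (hG : MemLp G 2 volume)
    (ξ : ℝ) : Integrable (fun η => F η * G (ξ - η)) volume := by
  have : MemLp (fun η => G (ξ - η)) 2 volume :=
    hG.comp_measurePreserving (Measure.measurePreserving_sub_left volume ξ)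
  exact hF.integrable_mul this

/-- The convolution of the two transforms is in L¹ and bounded, hence in L², so its L² inverse
transform is the pointwise inverse integral. The latter turns convolution into the product. -/
theorem fourier_mul {f g : L2} (hf : Integrable (𝓕 f : L2) volume)
    (hg : Integrable (𝓕 g : L2) volume) :
    (𝓕 (mul f g) : L2) =ᵐ[volume] fun ξ => ∫ η, (𝓕 f : L2) η * (𝓕 g : L2) (ξ - η) := by
  set F : ℝ → ℂ := ((𝓕 f : L2) : ℝ → ℂ) with hF
  set G : ℝ → ℂ := ((𝓕 g : L2) : ℝ → ℂ) with hG
  have hF2 : MemLp F 2 volume := Lp.memLp _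
  have hG2 : MemLp G 2 volume := Lp.memLp _
  set c : ℝ → ℂ := fun ξ => ∫ η, F η * G (ξ - η) with hc
  have hcc : c = MeasureTheory.convolution F G (ContinuousLinearMap.mul ℂ ℂ) volume := by
    ext ξ; rfl
  have hc1 : Integrable c volume := by
    rw [hcc]; exact hf.integrable_convolution _ hg
  obtain ⟨K, hK⟩ : ∃ K : ℝ, ∀ ξ, ‖c ξ‖ ≤ K := by
    refine ⟨(∫ η, ‖F η‖ ^ 2) + ∫ η, ‖G η‖ ^ 2, fun ξ => ?_⟩
    have i1 := (memLp_two_iff_integrable_sq_norm hF2.1).1 hF2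
    have i2 := (memLp_two_iff_integrable_sq_norm hG2.1).1 hG2
    have i3 : Integrable (fun η => ‖G (ξ - η)‖ ^ 2) volume := i2.comp_sub_left ξ
    calc ‖c ξ‖ ≤ ∫ η, ‖F η * G (ξ - η)‖ := norm_integral_le_integral_norm _
      _ ≤ ∫ η, (‖F η‖ ^ 2 + ‖G (ξ - η)‖ ^ 2) := by
        refine integral_mono (integrable_mul_reflect hF2 hG2 ξ).norm (i1.add i3) fun η => ?_
        simp only [norm_mul]
        nlinarith [sq_nonneg (‖F η‖ - ‖G (ξ - η)‖), sq_nonneg (‖F η‖ + ‖G (ξ - η)‖)]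
      _ = _ := by
        rw [integral_add i1 i3, integral_sub_left_eq_self (fun η => ‖G η‖ ^ 2) volume ξ]
  have hc2 : MemLp c 2 volume := by
    rw [integrable_norm_sq_iff hc1.1]
    refine (hc1.norm.const_mul K).mono' (hc1.1.norm.pow 2) (ae_of_all _ fun ξ => ?_)
    rw [Real.norm_of_nonneg (by positivity), sq]
    exact mul_le_mul_of_nonneg_right (hK _) (norm_nonneg _)
  have e : mul f g = 𝓕⁻ (toL2 c) := by
    rw [← toL2_coe (𝓕⁻ (toL2 c) : L2)]
    refine toL2_congr ?_
    filter_upwards [fourierInv_toL2 hc1 hc2, coeFn_eq_fourierInv hf, coeFn_eq_fourierInv hg]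
      with x h1 h2 h3
    rw [h1, h2, h3, Real.fourierInv_eq_fourier_neg, Real.fourierInv_eq_fourier_neg,
      Real.fourierInv_eq_fourier_neg, hcc, Real.fourier_mul_convolution_eq hf hg]
  rw [e]
  simpa using coeFn_toL2 hc2

/-! ### Bilinear estimates -/

/-- Cauchy–Schwarz in η separates the kernel, whose square integral is bounded uniformly in ξ. By
Tonelli the remaining convolution of F² and G² has the product of the masses as its integral. -/
theorem lintegral_sq_le_of_conv {κ : ℝ → ℝ → ENNReal} {F G S : ℝ → ENNReal} {K : ENNReal}
    (hκ : ∀ ξ, Measurable (κ ξ)) (hF : Measurable F) (hG : Measurable G)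
    (hK : ∀ ξ, ∫⁻ η, κ ξ η ^ 2 ≤ K)
    (hS : ∀ᵐ ξ, S ξ ≤ ∫⁻ η, κ ξ η * (F η * G (ξ - η))) :
    ∫⁻ ξ, S ξ ^ 2 ≤ K * ((∫⁻ η, F η ^ 2) * ∫⁻ η, G η ^ 2) := by
  have h1 : ∀ᵐ ξ, S ξ ^ 2 ≤ K * ∫⁻ η, F η ^ 2 * G (ξ - η) ^ 2 := by
    filter_upwards [hS] with ξ hξ
    have hFG : Measurable fun η => F η * G (ξ - η) :=
      hF.mul (hG.comp (measurable_const.sub measurable_id))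
    have cs := ENNReal.lintegral_mul_le_Lp_mul_Lq volume Real.HolderConjugate.two_two
      (hκ ξ).aemeasurable hFG.aemeasurable
    simp only [Pi.mul_apply] at cs
    calc S ξ ^ 2 ≤ ((∫⁻ η, κ ξ η ^ (2 : ℝ)) ^ (1 / (2 : ℝ)) *
          (∫⁻ η, (F η * G (ξ - η)) ^ (2 : ℝ)) ^ (1 / (2 : ℝ))) ^ 2 := by
            gcongr; exact hξ.trans cs
      _ = (∫⁻ η, κ ξ η ^ 2) * ∫⁻ η, F η ^ 2 * G (ξ - η) ^ 2 := by
            rw [mul_pow, ← ENNReal.rpow_natCast, ← ENNReal.rpow_natCast, ← ENNReal.rpow_mul,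
              ← ENNReal.rpow_mul]
            norm_num [mul_pow]
      _ ≤ _ := by gcongr; exact hK ξ
  calc ∫⁻ ξ, S ξ ^ 2 ≤ ∫⁻ ξ, K * ∫⁻ η, F η ^ 2 * G (ξ - η) ^ 2 := lintegral_mono_ae h1
    _ = K * ∫⁻ ξ, ∫⁻ η, F η ^ 2 * G (ξ - η) ^ 2 := by
        rw [lintegral_const_mul]
        exact Measurable.lintegral_prod_right' (f := fun p : ℝ × ℝ => F p.2 ^ 2 * G (p.1 - p.2) ^ 2)
          (by fun_prop)
    _ = K * ∫⁻ η, ∫⁻ ξ, F η ^ 2 * G (ξ - η) ^ 2 := by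
        rw [lintegral_lintegral_swap]
        exact Measurable.aemeasurable (by fun_prop)
    _ = K * ∫⁻ η, F η ^ 2 * ∫⁻ ξ, G ξ ^ 2 := by
        congr 1
        refine lintegral_congr fun η => ?_
        rw [lintegral_const_mul _ (by fun_prop)]
        congr 1
        exact lintegral_sub_right_eq_self (fun ξ => G ξ ^ 2) η
    _ = _ := by rw [lintegral_mul_const _ (by fun_prop)]

/-- The square integrable weight `(⟨a⟩⁻² + ⟨b⟩⁻²)^{1/2}` of the bilinear estimates. -/
def pairWeight (a b : ℝ) : ℝ := Real.sqrt ((jb a ^ 2)⁻¹ + (jb b ^ 2)⁻¹)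

theorem pairWeight_nonneg (a b : ℝ) : 0 ≤ pairWeight a b := Real.sqrt_nonneg _

theorem measurable_pairWeight : Measurable (Function.uncurry pairWeight) := by
  have := continuous_jb.measurable
  unfold pairWeight Function.uncurry
  fun_prop

theorem lintegral_pairWeight_sq (ξ : ℝ) :
    ∫⁻ η, ENNReal.ofReal (pairWeight (freq η) (freq (ξ - η))) ^ 2 ≤ 1 := by
  have e : ∀ η, ENNReal.ofReal (pairWeight (freq η) (freq (ξ - η))) ^ 2 =
      ENNReal.ofReal ((jb (freq η) ^ 2)⁻¹) + ENNReal.ofReal ((jb (freq (ξ - η)) ^ 2)⁻¹) := by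
    intro η
    rw [pairWeight, ← ENNReal.ofReal_pow (Real.sqrt_nonneg _),
      Real.sq_sqrt (by positivity), ENNReal.ofReal_add (by positivity) (by positivity)]
  simp_rw [e]
  have hm : Measurable fun η => ENNReal.ofReal ((jb (freq η) ^ 2)⁻¹) := by
    have h1 := continuous_jb.measurable
    have h2 := measurable_freq
    fun_prop
  rw [lintegral_add_left hm,
    lintegral_sub_left_eq_self (fun η => ENNReal.ofReal ((jb (freq η) ^ 2)⁻¹)) ξ,
    lintegral_inv_jb_sq, ← ENNReal.ofReal_add (by norm_num) (by norm_num)]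
  norm_num

/-- A bilinear Fourier multiplier whose symbol is controlled by the weights of `H^s` and
`pairWeight` maps `H^s × H^s` to `L²`. -/
theorem bilinear_bound {s : ℕ} {f g : L2} (hf : MemHs s f) (hg : MemHs s g) {S : ℝ → ℂ}
    (hSm : AEStronglyMeasurable S volume) {r : ℝ → ℝ → ℂ} {C : ℝ} (hC0 : 0 ≤ C)
    (hr : ∀ a b, ‖r a b‖ ≤ C * pairWeight a b * (jb a ^ s * jb b ^ s))
    (hS : ∀ᵐ ξ, S ξ =
      ∫ η, r (freq η) (freq (ξ - η)) * ((𝓕 f : L2) η * (𝓕 g : L2) (ξ - η))) :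
    MemLp S 2 volume ∧ ‖toL2 S‖ ≤ C * hsNorm s f * hsNorm s g := by
  set F : ℝ → ENNReal := fun η => ‖sob s (freq η) * (𝓕 f : L2) η‖ₑ
  set G : ℝ → ENNReal := fun η => ‖sob s (freq η) * (𝓕 g : L2) η‖ₑ
  have hsm : Measurable fun η => sob s (freq η) := (measurable_sob s).comp measurable_freq
  have hF : Measurable F := (hsm.mul (Lp.stronglyMeasurable _).measurable).enorm
  have hG : Measurable G := (hsm.mul (Lp.stronglyMeasurable _).measurable).enorm
  have key : ∫⁻ ξ, ‖S ξ‖ₑ ^ 2 ≤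
      ENNReal.ofReal (C ^ 2) * ((∫⁻ η, F η ^ 2) * ∫⁻ η, G η ^ 2) := by
    -- F and G carry the full H^s weights, so only C times `pairWeight` is left as kernel.
    refine lintegral_sq_le_of_conv
      (κ := fun ξ η => ENNReal.ofReal C * ENNReal.ofReal (pairWeight (freq η) (freq (ξ - η))))
      ?_ hF hG ?_ ?_
    · intro ξ
      have h2 := measurable_freq
      exact measurable_const.mul (measurable_pairWeight.comp
        (h2.prodMk (h2.comp (measurable_const.sub measurable_id)))).ennreal_ofReal
    · intro ξ
      simp_rw [mul_pow]
      rw [lintegral_const_mul', ENNReal.ofReal_pow hC0]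
      · exact mul_le_of_le_one_right' (lintegral_pairWeight_sq ξ)
      · exact ENNReal.pow_ne_top ENNReal.ofReal_ne_top
    · filter_upwards [hS] with ξ hξ
      rw [hξ]
      refine (enorm_integral_le_lintegral_enorm _).trans (lintegral_mono fun η => ?_)
      simp only [F, G, enorm_mul]
      have h1 : ‖r (freq η) (freq (ξ - η))‖ₑ ≤ ENNReal.ofReal C *
          ENNReal.ofReal (pairWeight (freq η) (freq (ξ - η))) *
            (‖sob s (freq η)‖ₑ * ‖sob s (freq (ξ - η))‖ₑ) := by
        rw [← ofReal_norm, ← ofReal_norm, ← ofReal_norm, ← ENNReal.ofReal_mul hC0,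
          ← ENNReal.ofReal_mul (norm_nonneg _),
          ← ENNReal.ofReal_mul (mul_nonneg hC0 (pairWeight_nonneg _ _)), norm_sob, norm_sob]
        exact ENNReal.ofReal_le_ofReal (hr _ _)
      calc _ ≤ (ENNReal.ofReal C *
          ENNReal.ofReal (pairWeight (freq η) (freq (ξ - η))) *
            (‖sob s (freq η)‖ₑ * ‖sob s (freq (ξ - η))‖ₑ)) *
            (‖(𝓕 f : L2) η‖ₑ * ‖(𝓕 g : L2) (ξ - η)‖ₑ) := by gcongr
        _ = _ := by ring
  have eF : ∫⁻ η, F η ^ 2 = ENNReal.ofReal (hsNorm s f) ^ 2 := by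
    rw [← enorm_toL2_sq (memHs_iff.1 hf), ← ofReal_norm, hsNorm_eq_norm hf, multiplier,
      ← Lp.norm_fourier_eq (𝓕⁻ _ : L2), FourierTransform.fourier_fourierInv_eq]
  have eG : ∫⁻ η, G η ^ 2 = ENNReal.ofReal (hsNorm s g) ^ 2 := by
    rw [← enorm_toL2_sq (memHs_iff.1 hg), ← ofReal_norm, hsNorm_eq_norm hg, multiplier,
      ← Lp.norm_fourier_eq (𝓕⁻ _ : L2), FourierTransform.fourier_fourierInv_eq]
  have hn0 := hsNorm_nonneg s f
  have hn1 := hsNorm_nonneg s g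
  rw [eF, eG, ← ENNReal.ofReal_pow hn0, ← ENNReal.ofReal_pow hn1,
    ← ENNReal.ofReal_mul (by positivity), ← ENNReal.ofReal_mul (by positivity)] at key
  have hm : MemLp S 2 volume :=
    (lintegral_enorm_sq_lt_top_iff hSm).2 (key.trans_lt ENNReal.ofReal_lt_top)
  refine ⟨hm, ?_⟩
  rw [← enorm_toL2_sq hm, ← ofReal_norm, ← ENNReal.ofReal_pow (norm_nonneg _),
    ENNReal.ofReal_le_ofReal_iff (by positivity)] at key
  refine (abs_le_of_sq_le_sq' (key.trans (le_of_eq (by ring))) (by positivity)).2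

end

noncomputable section

/-! ### Symbol estimates -/

theorem jb_le_jb {a b : ℝ} (h : |a| ≤ |b|) : jb a ≤ jb b :=
  Real.sqrt_le_sqrt (by nlinarith [sq_abs a, sq_abs b, abs_nonneg a])

/-- The sharp constant is 2/√3, and 7/6 is a rational number just above it. The square of 7/6 is
below 2, so powers of it can later be absorbed by the factor 2^s of α. -/
theorem jb_add_le_mul (a b : ℝ) : jb (a + b) ≤ 7 / 6 * (jb a * jb b) := by
  refine (abs_le_of_sq_le_sq' ?_ (by have := jb_pos a; have := jb_pos b; positivity)).2
  rw [mul_pow, mul_pow, jb_sq, jb_sq, jb_sq]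
  nlinarith [sq_nonneg (a - b), sq_nonneg (1 - 2 * a * b), sq_nonneg a, sq_nonneg b,
    sq_nonneg (a * b)]

theorem jb_add_le_add (a b : ℝ) : jb (a + b) ≤ jb a + jb b := by
  have h1 := abs_le_jb a
  have h2 := abs_le_jb b
  have h3 := one_le_jb a
  have h4 := one_le_jb b
  refine (abs_le_of_sq_le_sq' ?_ (by linarith)).2
  have h5 : a * b ≤ jb a * jb b := calc
    a * b ≤ |a * b| := le_abs_self _
    _ = |a| * |b| := abs_mul _ _
    _ ≤ jb a * jb b := mul_le_mul h1 h2 (abs_nonneg _) (by linarith)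
  nlinarith [jb_sq a, jb_sq b, jb_sq (a + b)]

theorem jb_add_le_two_mul {a b : ℝ} (h : |b| ≤ |a|) : jb (a + b) ≤ 2 * jb a :=
  (jb_add_le_add a b).trans (by linarith [jb_le_jb h])

theorem two_mul_abs_le_jb_sq (b : ℝ) : 2 * |b| ≤ jb b ^ 2 := by
  rw [jb_sq]; nlinarith [sq_abs b, sq_nonneg (|b| - 1)]

theorem inv_jb_le_pairWeight_left (a b : ℝ) : (jb a)⁻¹ ≤ pairWeight a b := by
  refine Real.le_sqrt_of_sq_le ?_
  rw [inv_pow]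
  have := jb_pos b
  have : 0 ≤ (jb b ^ 2)⁻¹ := by positivity
  linarith

theorem pairWeight_comm (a b : ℝ) : pairWeight a b = pairWeight b a := by
  unfold pairWeight; rw [add_comm]

/-- Here 17/12 is a rational number just above √2. -/
theorem inv_jb_add_le_pairWeight (a b : ℝ) :
    (jb a)⁻¹ + (jb b)⁻¹ ≤ 17 / 12 * pairWeight a b := by
  have ha := inv_pos.2 (jb_pos a)
  have hb := inv_pos.2 (jb_pos b)
  refine (abs_le_of_sq_le_sq' ?_ (mul_nonneg (by norm_num) (pairWeight_nonneg a b))).2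
  rw [mul_pow, pairWeight, Real.sq_sqrt (by positivity), ← inv_pow, ← inv_pow]
  nlinarith [sq_nonneg ((jb a)⁻¹ - (jb b)⁻¹), sq_nonneg (jb a)⁻¹, sq_nonneg (jb b)⁻¹]

/-- The constant of the algebra property of `H^s`. -/
def algC (s : ℕ) : ℝ := 17 / 12 * (7 / 6) ^ (s - 1)

/-- Of the s factors ⟨a+b⟩, all but one are bounded by the product inequality. The last is bounded
by ⟨a⟩ + ⟨b⟩ = (⟨a⟩⁻¹ + ⟨b⟩⁻¹)⟨a⟩⟨b⟩, which provides the square integrable weight. -/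
theorem norm_sob_add_le {s : ℕ} (hs : 1 ≤ s) (a b : ℝ) :
    ‖sob s (a + b)‖ ≤ algC s * pairWeight a b * (jb a ^ s * jb b ^ s) := by
  have ha := jb_pos a
  have hb := jb_pos b
  obtain ⟨r, rfl⟩ : ∃ r, s = r + 1 := ⟨s - 1, by omega⟩
  rw [norm_sob, algC, Nat.add_sub_cancel, pow_succ]
  have h1 : jb (a + b) ^ r ≤ (7 / 6) ^ r * (jb a ^ r * jb b ^ r) := by
    rw [← mul_pow, ← mul_pow]
    exact pow_le_pow_left₀ (jb_pos _).le (jb_add_le_mul a b) r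
  have h2 : jb (a + b) ≤ 17 / 12 * pairWeight a b * (jb a * jb b) := by
    have h3 := mul_le_mul_of_nonneg_right (inv_jb_add_le_pairWeight a b) (mul_pos ha hb).le
    have h4 : ((jb a)⁻¹ + (jb b)⁻¹) * (jb a * jb b) = jb a + jb b := by field_simp; ring
    rw [h4] at h3
    exact (jb_add_le_add a b).trans h3
  calc jb (a + b) ^ r * jb (a + b) ≤
      ((7 / 6) ^ r * (jb a ^ r * jb b ^ r)) * (17 / 12 * pairWeight a b * (jb a * jb b)) :=
        mul_le_mul h1 h2 (jb_pos _).le (by positivity)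
    _ = _ := by ring

/-- The regularized symbol `(1 + ik)^s e^{-εk²}`. -/
def msym (s : ℕ) (ε : ℝ) (k : ℝ) : ℂ := sob s k * (Real.exp (-(ε * k ^ 2)) : ℂ)

/-- The symbol `ik (1 + ik)^s e^{-εk²}`. -/
def psym (s : ℕ) (ε : ℝ) (k : ℝ) : ℂ := Complex.I * (k : ℂ) * msym s ε k

theorem continuous_msym (s : ℕ) (ε : ℝ) : Continuous (msym s ε) := by
  have := continuous_sob s
  unfold msym; fun_prop

theorem continuous_psym (s : ℕ) (ε : ℝ) : Continuous (psym s ε) := by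
  have := continuous_msym s ε
  unfold psym; fun_prop

theorem norm_msym (s : ℕ) (ε k : ℝ) :
    ‖msym s ε k‖ = jb k ^ s * Real.exp (-(ε * k ^ 2)) := by
  rw [msym, norm_mul, norm_sob, Complex.norm_real, Real.norm_of_nonneg (Real.exp_pos _).le]

theorem norm_msym_le (s : ℕ) {ε : ℝ} (hε : 0 ≤ ε) (k : ℝ) : ‖msym s ε k‖ ≤ jb k ^ s := by
  rw [norm_msym]
  refine mul_le_of_le_one_right (pow_nonneg (jb_pos k).le _) ?_
  rw [Real.exp_le_one_iff]
  have := mul_nonneg hε (sq_nonneg k); linarith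

theorem norm_psym (s : ℕ) (ε k : ℝ) : ‖psym s ε k‖ = |k| * ‖msym s ε k‖ := by
  rw [psym, norm_mul, norm_mul, Complex.norm_I, one_mul, Complex.norm_real, Real.norm_eq_abs]

theorem norm_psym_le (s : ℕ) {ε : ℝ} (hε : 0 ≤ ε) (k : ℝ) : ‖psym s ε k‖ ≤ |k| * jb k ^ s := by
  rw [norm_psym]
  exact mul_le_mul_of_nonneg_left (norm_msym_le s hε k) (abs_nonneg _)

theorem hasDerivAt_psym (s : ℕ) (ε k : ℝ) :
    HasDerivAt (psym (s + 1) ε)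
      (Complex.I * (Real.exp (-(ε * k ^ 2)) : ℂ) * (((1 - 2 * (ε * k ^ 2) : ℝ) : ℂ) * sob (s + 1) k
        + ((s : ℂ) + 1) * (Complex.I * k) * sob s k)) k := by
  have h0 : HasDerivAt (fun k : ℝ => (k : ℂ)) 1 k := Complex.ofRealCLM.hasDerivAt
  have h1 : HasDerivAt (sob (s + 1)) (((s + 1 : ℕ) : ℂ) * (1 + Complex.I * k) ^ s *
      (Complex.I * 1)) k := ((h0.const_mul Complex.I).const_add 1).pow (s + 1)
  have h2 : HasDerivAt (fun k : ℝ => Real.exp (-(ε * k ^ 2)))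
      (Real.exp (-(ε * k ^ 2)) * (-(ε * (2 * k)))) k := by
    have := (((hasDerivAt_pow 2 k).const_mul ε).neg).exp
    simpa using this
  have h3 := (h0.const_mul Complex.I).mul (h1.mul h2.ofReal_comp)
  refine h3.congr_deriv ?_
  simp only [sob, Pi.mul_apply]
  push_cast
  ring

/-- The bound is uniform in ε: differentiating the Gaussian produces only y = εk², and e^{−y}|1 −
2y| ≤ 1 for y ≥ 0. -/
theorem norm_deriv_psym_le (s : ℕ) {ε : ℝ} (hε : 0 ≤ ε) (k : ℝ) :
    ‖Complex.I * (Real.exp (-(ε * k ^ 2)) : ℂ) *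
      (((1 - 2 * (ε * k ^ 2) : ℝ) : ℂ) * sob (s + 1) k
        + ((s : ℂ) + 1) * (Complex.I * k) * sob s k)‖ ≤ (s + 2) * jb k ^ (s + 1) := by
  set y := ε * k ^ 2 with hy
  have hy0 : 0 ≤ y := by positivity
  have hJ := jb_pos k
  have he : Real.exp (-y) ≤ 1 := by rw [Real.exp_le_one_iff]; linarith
  have h1 : Real.exp (-y) * |1 - 2 * y| ≤ 1 := by
    rw [Real.exp_neg, inv_mul_le_one₀ (Real.exp_pos y), abs_le]
    have := Real.quadratic_le_exp_of_nonneg hy0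
    constructor <;> nlinarith [sq_nonneg (y - 1)]
  have e1 : ‖((s : ℂ) + 1)‖ = s + 1 := by
    have : ((s : ℂ) + 1) = ((s + 1 : ℕ) : ℂ) := by push_cast; rfl
    rw [this, Complex.norm_natCast]; push_cast; rfl
  rw [norm_mul, norm_mul, Complex.norm_I, one_mul, Complex.norm_real,
    Real.norm_of_nonneg (Real.exp_pos _).le]
  calc Real.exp (-y) * ‖((1 - 2 * y : ℝ) : ℂ) * sob (s + 1) k +
          ((s : ℂ) + 1) * (Complex.I * k) * sob s k‖
      ≤ Real.exp (-y) * (|1 - 2 * y| * jb k ^ (s + 1) + (s + 1) * |k| * jb k ^ s) := by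
        gcongr
        refine (norm_add_le _ _).trans (le_of_eq ?_)
        simp only [norm_mul, norm_sob, Complex.norm_real, Complex.norm_I, one_mul, e1,
          Real.norm_eq_abs]
    _ = (Real.exp (-y) * |1 - 2 * y|) * jb k ^ (s + 1) +
          Real.exp (-y) * ((s + 1) * |k| * jb k ^ s) := by ring
    _ ≤ 1 * jb k ^ (s + 1) + 1 * ((s + 1) * jb k * jb k ^ s) := by
        gcongr
        exact abs_le_jb k
    _ = _ := by ring

theorem norm_psym_sub_le {s : ℕ} (hs : 1 ≤ s) {ε : ℝ} (hε : 0 ≤ ε) {a b X : ℝ} (ha : jb a ≤ X)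
    (hb : jb b ≤ X) : ‖psym s ε b - psym s ε a‖ ≤ (s + 1) * X ^ s * |b - a| := by
  obtain ⟨r, rfl⟩ : ∃ r, s = r + 1 := ⟨s - 1, by omega⟩
  have := (convex_uIcc a b).norm_image_sub_le_of_norm_hasDerivWithin_le
    (f := psym (r + 1) ε) (C := (((r + 1 : ℕ) : ℝ) + 1) * X ^ (r + 1))
    (fun x _ => (hasDerivAt_psym r ε x).hasDerivWithinAt) (fun x hx => ?_)
    (left_mem_uIcc) (right_mem_uIcc)
  · simpa using this
  · refine (norm_deriv_psym_le r hε x).trans ?_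
    -- A point between a and b has absolute value at most the larger of |a| and |b|.
    have hx' : jb x ≤ X := by
      rcases le_total |a| |b| with h | h
      · refine (jb_le_jb ?_).trans hb
        rw [mem_uIcc] at hx
        rcases hx with hx | hx <;> rw [abs_le] <;>
          constructor <;> cases abs_cases a <;> cases abs_cases b <;> linarith
      · refine (jb_le_jb ?_).trans ha
        rw [mem_uIcc] at hx
        rcases hx with hx | hx <;> rw [abs_le] <;>
          constructor <;> cases abs_cases a <;> cases abs_cases b <;> linarith
    have := pow_le_pow_left₀ (jb_pos x).le hx' (r + 1)
    push_cast
    nlinarith [pow_pos (jb_pos x) (r + 1), (Nat.cast_nonneg r : (0 : ℝ) ≤ r)]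

/-- The constant of the commutator estimate. -/
def comC (s : ℕ) : ℝ := (8 * (s + 1) * (7 / 6) ^ (s - 3) + 1) / 2

/-- With b the lower frequency, the mean value theorem replaces the derivative at frequency a by |b|
≤ ⟨b⟩²/2. Of the s factors X, three are bounded by 2⟨a⟩ and the others by (7/6)⟨a⟩⟨b⟩. This saves
⟨b⟩³, which pays for ⟨b⟩² and leaves ⟨b⟩⁻¹ for integrability; hence s ≥ 3. The term at b alone is
harmless because ⟨b⟩³ ≤ ⟨a⟩^s. -/
theorem norm_psym_add_sub_le_of_abs_le {s : ℕ} (hs : 3 ≤ s) {ε : ℝ} (hε : 0 ≤ ε) {a b : ℝ}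
    (hab : |b| ≤ |a|) :
    ‖psym s ε (a + b) - psym s ε a - psym s ε b‖ ≤
      comC s * (jb b)⁻¹ * (jb a ^ s * jb b ^ s) := by
  have ha := jb_pos a
  have hb := jb_pos b
  have ha1 := one_le_jb a
  have hb1 := one_le_jb b
  have hJ := jb_le_jb hab
  set X := max (jb a) (jb (a + b)) with hX
  have hX0 : 0 < X := lt_of_lt_of_le ha (le_max_left _ _)
  have hX2 : X ≤ 2 * jb a := max_le (by linarith) (jb_add_le_two_mul hab)
  have hX3 : X ≤ 7 / 6 * (jb a * jb b) := max_le (by nlinarith) (jb_add_le_mul a b)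
  have h1 := norm_psym_sub_le (s := s) (by omega) hε (le_max_left (jb a) (jb (a + b)))
    (le_max_right (jb a) (jb (a + b)))
  rw [add_sub_cancel_left] at h1
  have h2 := norm_psym_le s hε b
  have h3 := two_mul_abs_le_jb_sq b
  obtain ⟨r, rfl⟩ : ∃ r, s = r + 3 := ⟨s - 3, by omega⟩
  have hXs : X ^ (r + 3) ≤ ((7 / 6) ^ r * (jb a ^ r * jb b ^ r)) * (8 * jb a ^ 3) := by
    rw [pow_add]
    refine mul_le_mul ?_ ?_ (by positivity) (by positivity)
    · rw [← mul_pow, ← mul_pow]; exact pow_le_pow_left₀ hX0.le hX3 r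
    · calc X ^ 3 ≤ (2 * jb a) ^ 3 := pow_le_pow_left₀ hX0.le hX2 3
        _ = _ := by ring
  have e1 : ‖psym (r + 3) ε (a + b) - psym (r + 3) ε a‖ ≤
      4 * (r + 4) * (7 / 6) ^ r * (jb b)⁻¹ * (jb a ^ (r + 3) * jb b ^ (r + 3)) := by
    refine h1.trans ?_
    calc (((r + 3 : ℕ) : ℝ) + 1) * X ^ (r + 3) * |b|
        ≤ (((r + 3 : ℕ) : ℝ) + 1) * (((7 / 6) ^ r * (jb a ^ r * jb b ^ r)) * (8 * jb a ^ 3)) *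
          (jb b ^ 2 / 2) := by
            gcongr; linarith
      _ = _ := by
            push_cast
            field_simp
            ring
  have e2 : ‖psym (r + 3) ε b‖ ≤ 1 / 2 * (jb b)⁻¹ * (jb a ^ (r + 3) * jb b ^ (r + 3)) := by
    refine h2.trans ?_
    have h5 : jb b ^ 3 ≤ jb a ^ (r + 3) :=
      (pow_le_pow_left₀ hb.le hJ 3).trans (pow_le_pow_right₀ ha1 (by omega))
    calc |b| * jb b ^ (r + 3) ≤ (jb b ^ 2 / 2) * jb b ^ (r + 3) := by gcongr; linarith
      _ = 1 / 2 * (jb b)⁻¹ * (jb b ^ 3 * jb b ^ (r + 3)) := by field_simp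
      _ ≤ _ := by gcongr
  calc _ ≤ ‖psym (r + 3) ε (a + b) - psym (r + 3) ε a‖ + ‖psym (r + 3) ε b‖ := norm_sub_le _ _
    _ ≤ _ := add_le_add e1 e2
    _ = _ := by
      rw [comC, Nat.add_sub_cancel]; push_cast; ring

theorem comC_nonneg (s : ℕ) : 0 ≤ comC s := by unfold comC; positivity

theorem algC_nonneg (s : ℕ) : 0 ≤ algC s := by unfold algC; positivity

theorem norm_psym_add_sub_le {s : ℕ} (hs : 3 ≤ s) {ε : ℝ} (hε : 0 ≤ ε) (a b : ℝ) :
    ‖psym s ε (a + b) - psym s ε a - psym s ε b‖ ≤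
      comC s * pairWeight a b * (jb a ^ s * jb b ^ s) := by
  have ha := jb_pos a
  have hb := jb_pos b
  have hc := comC_nonneg s
  rcases le_total |b| |a| with h | h
  · refine (norm_psym_add_sub_le_of_abs_le hs hε h).trans ?_
    gcongr
    rw [pairWeight_comm]; exact inv_jb_le_pairWeight_left b a
  · have := norm_psym_add_sub_le_of_abs_le hs hε h
    rw [add_comm b a, sub_right_comm, mul_comm (jb b ^ s)] at this
    refine this.trans ?_
    gcongr
    exact inv_jb_le_pairWeight_left a b

end

noncomputable section

/-! ### Local smoothing -/

theorem lintegral_enorm_fourierInv_sq {h : ℝ → ℂ} (h1 : Integrable h volume)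
    (h2 : MemLp h 2 volume) : ∫⁻ x, ‖𝓕⁻ h x‖ₑ ^ 2 = ∫⁻ x, ‖h x‖ₑ ^ 2 := by
  have e : ∫⁻ x, ‖𝓕⁻ h x‖ₑ ^ 2 = ‖(𝓕⁻ (toL2 h) : L2)‖ₑ ^ 2 := by
    rw [enorm_sq_eq_lintegral]
    exact lintegral_congr_ae ((fourierInv_toL2 h1 h2).mono fun x hx => by simp only [hx])
  rw [e, ← enorm_toL2_sq h2, ← ofReal_norm, ← ofReal_norm, ← Lp.norm_fourier_eq (𝓕⁻ _ : L2),
    FourierTransform.fourier_fourierInv_eq]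

/-- The substitution x = 4π²ξ³ has Jacobian 12π²ξ² = 3k². The factor 4π² is chosen so that k³t =
2π·t·x, making x the frequency dual to time. -/
theorem lintegral_comp_freq_cube (g : ℝ → ENNReal) :
    ∫⁻ ξ, ENNReal.ofReal (3 * freq ξ ^ 2) * g (4 * Real.pi ^ 2 * ξ ^ 3) = ∫⁻ x, g x := by
  have hd : ∀ x ∈ (univ : Set ℝ), HasDerivWithinAt (fun ξ : ℝ => 4 * Real.pi ^ 2 * ξ ^ 3)
      (3 * freq x ^ 2) univ x := fun x _ => by
    refine (((hasDerivAt_pow 3 x).const_mul (4 * Real.pi ^ 2)).congr_deriv ?_).hasDerivWithinAt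
    simp only [freq]; push_cast; ring
  have hinj : InjOn (fun ξ : ℝ => 4 * Real.pi ^ 2 * ξ ^ 3) univ := by
    intro a _ b _ hab
    have h2 : a ^ 3 = b ^ 3 := mul_left_cancel₀ (by positivity) hab
    exact (Odd.strictMono_pow (by decide : Odd 3)).injective h2
  have hsurj : (fun ξ : ℝ => 4 * Real.pi ^ 2 * ξ ^ 3) '' univ = univ := by
    rw [image_univ, range_eq_univ]
    intro y
    obtain ⟨x, hx⟩ := (Odd.strictMono_pow (R := ℝ) (by decide : Odd 3)).orderIsoOfSurjective _
      (Continuous.surjective (f := fun x : ℝ => x ^ 3) (by fun_prop)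
        (tendsto_pow_atTop (by norm_num)) (by
          have := tendsto_neg_atTop_atBot.comp ((tendsto_pow_atTop (α := ℝ) (n := 3)
            (by norm_num)).comp tendsto_neg_atBot_atTop)
          refine this.congr fun x => ?_
          simp only [Function.comp]; ring)) |>.surjective (y / (4 * Real.pi ^ 2))
    refine ⟨x, ?_⟩
    have hx' : x ^ 3 = y / (4 * Real.pi ^ 2) := hx
    simp only [hx']
    field_simp
  have := lintegral_image_eq_lintegral_abs_deriv_mul MeasurableSet.univ hd hinj g
  rw [hsurj, setLIntegral_univ, setLIntegral_univ] at this
  rw [this]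
  refine lintegral_congr fun ξ => ?_
  rw [abs_of_nonneg (by positivity)]

/-- The Airy phase `e^{ik³t}`. -/
def airySym (t k : ℝ) : ℂ := Complex.exp (Complex.I * (k : ℂ) ^ 3 * (t : ℂ))

theorem airySym_eq (t k : ℝ) : airySym t k = Complex.exp (((k ^ 3 * t : ℝ) : ℂ) * Complex.I) := by
  rw [airySym]; congr 1; push_cast; ring

theorem norm_airySym (t k : ℝ) : ‖airySym t k‖ = 1 := by
  rw [airySym_eq, Complex.norm_exp_ofReal_mul_I]

theorem continuous_airySym : Continuous (Function.uncurry airySym) := by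
  unfold airySym Function.uncurry; fun_prop

/-- Kato smoothing at a point: time integrals of `∫ k d(k) e^{ik³t} dk`. -/
theorem lintegral_airy_sq_le {c d : ℝ → ℂ} (hc : Integrable c volume) (hd : Measurable d)
    (hcd : ∀ ξ, c ξ = (freq ξ : ℂ) * d ξ) (T : ℝ) :
    ∫⁻ t in Ioc 0 T, ‖∫ ξ, airySym t (freq ξ) * c ξ‖ₑ ^ 2 ≤
      ENNReal.ofReal (1 / 3) * ∫⁻ ξ, ‖d ξ‖ₑ ^ 2 := by
  set g : ℝ → ℂ := fun t => ∫ ξ, airySym t (freq ξ) * c ξ with hg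
  have hgc : Continuous g := by
    refine continuous_of_dominated (bound := fun ξ => ‖c ξ‖) ?_ ?_ hc.norm ?_
    · intro t
      exact ((continuous_airySym.comp (continuous_const.prodMk continuous_freq)
        ).aestronglyMeasurable).mul hc.1
    · intro t
      exact ae_of_all _ fun ξ => by rw [norm_mul, norm_airySym, one_mul]
    · refine ae_of_all _ fun ξ => ?_
      exact (continuous_airySym.comp (continuous_id.prodMk continuous_const)).mul continuous_const
  set I : Set ℝ := Ioc 0 T
  have hgI : IntegrableOn (fun t => ‖g t‖ ^ 2) I volume :=
    ((hgc.norm.pow 2).integrableOn_Icc).mono_set Ioc_subset_Icc_self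
  -- Duality: g is paired with its own conjugate, cut off to the time interval. Boundedness of the
  -- interval makes K finite, so that a root of K can be cancelled at the end.
  set χ : ℝ → ℂ := I.indicator fun t => (starRingEnd ℂ) (g t) with hχ
  have hχ1 : Integrable χ volume := by
    rw [hχ, integrable_indicator_iff measurableSet_Ioc]
    exact ((Complex.continuous_conj.comp hgc).integrableOn_Icc).mono_set Ioc_subset_Icc_self
  have hχsq : ∀ t, ‖χ t‖ ^ 2 = I.indicator (fun t => ‖g t‖ ^ 2) t := fun t => by
    by_cases ht : t ∈ I <;> simp [hχ, ht]
  have hχ2 : MemLp χ 2 volume := by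
    rw [integrable_norm_sq_iff hχ1.1]
    simp_rw [hχsq]
    exact hgI.integrable_indicator measurableSet_Ioc
  set K : ENNReal := ∫⁻ t in I, ‖g t‖ₑ ^ 2 with hK
  have hofR : ∀ z : ℂ, ENNReal.ofReal (‖z‖ ^ 2) = ‖z‖ₑ ^ 2 := fun z => by
    rw [ENNReal.ofReal_pow (norm_nonneg _), ofReal_norm]
  have hKχ : ∫⁻ t, ‖χ t‖ₑ ^ 2 = K := by
    rw [hK, ← lintegral_indicator measurableSet_Ioc]
    refine lintegral_congr fun t => ?_
    by_cases ht : t ∈ I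
    · rw [indicator_of_mem ht, hχ, indicator_of_mem ht, ← ofReal_norm, RCLike.norm_conj,
        ofReal_norm]
    · rw [indicator_of_notMem ht, hχ, indicator_of_notMem ht]; simp
  have hKtop : K ≠ ⊤ := by
    rw [← hKχ]
    exact ((lintegral_enorm_sq_lt_top_iff hχ1.1).1 hχ2).ne
  have hKr : K = ENNReal.ofReal (∫ t in I, ‖g t‖ ^ 2) := by
    rw [hK, ofReal_integral_eq_lintegral_ofReal hgI (ae_of_all _ fun t => by positivity)]
    exact lintegral_congr fun t => (hofR _).symm
  -- Fubini turns the pairing into an integral over ξ in which χ appears only through its inverse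
  -- transform at time frequency 4π²ξ³.
  have swap : ((∫ t in I, ‖g t‖ ^ 2 : ℝ) : ℂ) =
      ∫ ξ, c ξ * 𝓕⁻ χ (4 * Real.pi ^ 2 * ξ ^ 3) := by
    have e1 : ((∫ t in I, ‖g t‖ ^ 2 : ℝ) : ℂ) =
        ∫ t, ∫ ξ, χ t * (airySym t (freq ξ) * c ξ) := by
      rw [← integral_complex_ofReal, ← integral_indicator measurableSet_Ioc]
      refine integral_congr_ae (ae_of_all _ fun t => ?_)
      simp only
      rw [integral_const_mul]
      change _ = χ t * g t
      by_cases ht : t ∈ I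
      · rw [indicator_of_mem ht, hχ, indicator_of_mem ht, mul_comm, Complex.mul_conj,
          Complex.normSq_eq_norm_sq]
      · rw [indicator_of_notMem ht, hχ, indicator_of_notMem ht, zero_mul]
    rw [e1, integral_integral_swap]
    · refine integral_congr_ae (ae_of_all _ fun ξ => ?_)
      simp only
      rw [Real.fourierInv_eq', ← integral_const_mul]
      refine integral_congr_ae (ae_of_all _ fun t => ?_)
      simp only [smul_eq_mul, airySym_eq]
      have : freq ξ ^ 3 * t = 2 * Real.pi * inner ℝ t (4 * Real.pi ^ 2 * ξ ^ 3) := by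
        simp only [freq, RCLike.inner_apply, conj_trivial]; ring
      rw [this]; ring
    · have h1 := hχ1.mul_prod hc
      have h2 : AEStronglyMeasurable (fun p : ℝ × ℝ => airySym p.1 (freq p.2))
          (volume.prod volume) :=
        (continuous_airySym.comp (continuous_fst.prodMk
          (continuous_freq.comp continuous_snd))).aestronglyMeasurable
      refine (h1.bdd_mul (c := 1) h2 (ae_of_all _ fun p => (norm_airySym _ _).le)).congr
        (ae_of_all _ fun p => ?_)
      simp only [Function.uncurry]; ring
  have bound : K ≤ (ENNReal.ofReal (1 / 3) * ∫⁻ ξ, ‖d ξ‖ₑ ^ 2) ^ (1 / (2 : ℝ)) *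
      K ^ (1 / (2 : ℝ)) := by
    have hχc : Measurable (𝓕⁻ χ) := by
      have : (𝓕⁻ χ : ℝ → ℂ) = fun x => 𝓕 χ (-x) := by
        ext x; exact Real.fourierInv_eq_fourier_neg χ x
      rw [this]
      exact ((VectorFourier.fourierIntegral_continuous Real.continuous_fourierChar
        (by exact continuous_inner) hχ1).comp continuous_neg).measurable
    have hfm := measurable_freq
    -- The factor k of c goes with χ, normalised by √3 so that its square is the Jacobian 3k². After
    -- Cauchy–Schwarz, Plancherel in time returns K.
    have step : K ≤ ∫⁻ ξ, (ENNReal.ofReal (Real.sqrt (1 / 3)) * ‖d ξ‖ₑ) *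
        (ENNReal.ofReal (Real.sqrt 3 * |freq ξ|) * ‖𝓕⁻ χ (4 * Real.pi ^ 2 * ξ ^ 3)‖ₑ) := by
      rw [hKr]
      have hnn : 0 ≤ ∫ t in I, ‖g t‖ ^ 2 := integral_nonneg fun t => by positivity
      rw [← Real.norm_of_nonneg hnn, ← Complex.norm_real, ofReal_norm, swap]
      refine (enorm_integral_le_lintegral_enorm _).trans (lintegral_mono fun ξ => le_of_eq ?_)
      simp only
      rw [hcd, enorm_mul, enorm_mul, ← ofReal_norm ((freq ξ : ℂ)), Complex.norm_real,
        Real.norm_eq_abs, ENNReal.ofReal_mul (Real.sqrt_nonneg _)]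
      have h3 : ENNReal.ofReal (Real.sqrt (1 / 3)) * ENNReal.ofReal (Real.sqrt 3) = 1 := by
        rw [← ENNReal.ofReal_mul (Real.sqrt_nonneg _), ← Real.sqrt_mul (by norm_num)]
        norm_num
      calc _ = (ENNReal.ofReal (Real.sqrt (1 / 3)) * ENNReal.ofReal (Real.sqrt 3)) *
            (ENNReal.ofReal |freq ξ| * ‖d ξ‖ₑ * ‖𝓕⁻ χ (4 * Real.pi ^ 2 * ξ ^ 3)‖ₑ) := by
              rw [h3, one_mul]
        _ = _ := by ring
    refine step.trans ?_
    have cs := ENNReal.lintegral_mul_le_Lp_mul_Lq volume Real.HolderConjugate.two_two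
      (f := fun ξ => ENNReal.ofReal (Real.sqrt (1 / 3)) * ‖d ξ‖ₑ)
      (g := fun ξ => ENNReal.ofReal (Real.sqrt 3 * |freq ξ|) *
        ‖𝓕⁻ χ (4 * Real.pi ^ 2 * ξ ^ 3)‖ₑ)
      (by fun_prop) (by
        have h5 : Measurable fun ξ : ℝ => 𝓕⁻ χ (4 * Real.pi ^ 2 * ξ ^ 3) :=
          hχc.comp (by fun_prop)
        fun_prop)
    simp only [Pi.mul_apply] at cs
    refine cs.trans (le_of_eq ?_)
    congr 2
    · rw [← lintegral_const_mul _ (by fun_prop)]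
      refine lintegral_congr fun ξ => ?_
      rw [ENNReal.rpow_ofNat, mul_pow, ← ENNReal.ofReal_pow (Real.sqrt_nonneg _),
        Real.sq_sqrt (by norm_num)]
    · rw [← hKχ, ← lintegral_enorm_fourierInv_sq hχ1 hχ2,
        ← lintegral_comp_freq_cube fun x => ‖𝓕⁻ χ x‖ₑ ^ 2]
      refine lintegral_congr fun ξ => ?_
      rw [ENNReal.rpow_ofNat, mul_pow, ← ENNReal.ofReal_pow (by positivity), mul_pow,
        Real.sq_sqrt (by norm_num), sq_abs]
  by_cases h0 : K = 0
  · rw [h0]; exact zero_le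
  set D : ENNReal := ENNReal.ofReal (1 / 3) * ∫⁻ ξ, ‖d ξ‖ₑ ^ 2
  have hsq : ∀ z : ENNReal, z ^ (1 / (2 : ℝ)) * z ^ (1 / (2 : ℝ)) = z := fun z => by
    rw [← ENNReal.rpow_add_of_nonneg _ _ (by norm_num) (by norm_num)]; norm_num
  have hr0 : K ^ (1 / (2 : ℝ)) ≠ 0 := by simp [h0]
  have hrt : K ^ (1 / (2 : ℝ)) ≠ ⊤ := by simp [hKtop]
  have h4 : K ^ (1 / (2 : ℝ)) ≤ D ^ (1 / (2 : ℝ)) := by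
    rw [← ENNReal.mul_le_mul_iff_left hr0 hrt, hsq]; exact bound
  calc K = K ^ (1 / (2 : ℝ)) * K ^ (1 / (2 : ℝ)) := (hsq K).symm
    _ ≤ D ^ (1 / (2 : ℝ)) * D ^ (1 / (2 : ℝ)) := by gcongr
    _ = D := hsq D

end

noncomputable section

/-! ### Linearity of products -/

/-- `mul` is 0 when the pointwise product is not square integrable. One essentially bounded factor
excludes this, which is why the algebraic rules of this group carry such hypotheses. -/
theorem mul_add_of_ae {f g h : L2} {C : ℝ} (hf : ∀ᵐ x, ‖f x‖ ≤ C) :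
    mul f (g + h) = mul f g + mul f h := by
  refine L2_ext ?_
  filter_upwards [coeFn_mul (g := g) hf, coeFn_mul (g := h) hf, coeFn_mul (g := g + h) hf,
    Lp.coeFn_add g h, Lp.coeFn_add (mul f g) (mul f h)] with x h1 h2 h3 h4 h5
  rw [h3, h5, Pi.add_apply, h1, h2, h4, Pi.add_apply]; ring

theorem mul_sub_of_ae {f g h : L2} {C : ℝ} (hf : ∀ᵐ x, ‖f x‖ ≤ C) :
    mul f (g - h) = mul f g - mul f h := by
  refine L2_ext ?_
  filter_upwards [coeFn_mul (g := g) hf, coeFn_mul (g := h) hf, coeFn_mul (g := g - h) hf,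
    Lp.coeFn_sub g h, Lp.coeFn_sub (mul f g) (mul f h)] with x h1 h2 h3 h4 h5
  rw [h3, h5, Pi.sub_apply, h1, h2, h4, Pi.sub_apply]; ring

theorem mul_smul_of_ae {f g : L2} {C : ℝ} (c : ℂ) (hf : ∀ᵐ x, ‖f x‖ ≤ C) :
    mul f (c • g) = c • mul f g := by
  refine L2_ext ?_
  filter_upwards [coeFn_mul (g := g) hf, coeFn_mul (g := c • g) hf,
    Lp.coeFn_smul c g, Lp.coeFn_smul c (mul f g)] with x h1 h3 h4 h5
  rw [h3, h5, Pi.smul_apply, h1, h4, Pi.smul_apply, smul_eq_mul, smul_eq_mul]; ring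

theorem add_mul_of_ae {f g h : L2} {C C' : ℝ} (hf : ∀ᵐ x, ‖f x‖ ≤ C) (hg : ∀ᵐ x, ‖g x‖ ≤ C') :
    mul (f + g) h = mul f h + mul g h := by
  refine L2_ext ?_
  have hfg : ∀ᵐ x, ‖(f + g) x‖ ≤ C + C' := by
    filter_upwards [hf, hg, Lp.coeFn_add f g] with x h1 h2 h3
    rw [h3]; exact (norm_add_le _ _).trans (add_le_add h1 h2)
  filter_upwards [coeFn_mul (g := h) hf, coeFn_mul (g := h) hg, coeFn_mul (g := h) hfg,
    Lp.coeFn_add f g, Lp.coeFn_add (mul f h) (mul g h)] with x h1 h2 h3 h4 h5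
  rw [h3, h5, Pi.add_apply, h1, h2, h4, Pi.add_apply]; ring

theorem sub_mul_of_ae {f g h : L2} {C C' : ℝ} (hf : ∀ᵐ x, ‖f x‖ ≤ C) (hg : ∀ᵐ x, ‖g x‖ ≤ C') :
    mul (f - g) h = mul f h - mul g h := by
  refine L2_ext ?_
  have hfg : ∀ᵐ x, ‖(f - g) x‖ ≤ C + C' := by
    filter_upwards [hf, hg, Lp.coeFn_sub f g] with x h1 h2 h3
    rw [h3]; exact (norm_sub_le _ _).trans (add_le_add h1 h2)
  filter_upwards [coeFn_mul (g := h) hf, coeFn_mul (g := h) hg, coeFn_mul (g := h) hfg,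
    Lp.coeFn_sub f g, Lp.coeFn_sub (mul f h) (mul g h)] with x h1 h2 h3 h4 h5
  rw [h3, h5, Pi.sub_apply, h1, h2, h4, Pi.sub_apply]; ring

theorem mul_assoc_of_ae {f g h : L2} {C C' : ℝ} (hf : ∀ᵐ x, ‖f x‖ ≤ C) (hg : ∀ᵐ x, ‖g x‖ ≤ C') :
    mul (mul f g) h = mul f (mul g h) := by
  refine L2_ext ?_
  have hfg : ∀ᵐ x, ‖mul f g x‖ ≤ C * C' := by
    filter_upwards [hf, hg, coeFn_mul (g := g) hf] with x h1 h2 h3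
    rw [h3, norm_mul]
    exact mul_le_mul h1 h2 (norm_nonneg _) ((norm_nonneg _).trans h1)
  filter_upwards [coeFn_mul (g := g) hf, coeFn_mul (g := h) hg, coeFn_mul (g := h) hfg,
    coeFn_mul (g := mul g h) hf] with x h1 h2 h3 h4
  rw [h3, h4, h1, h2]; ring

/-! ### Products with regularized functions -/

/-- Bounded square integrable symbols. -/
structure IsRegSymbol (σ : ℝ → ℂ) : Prop where
  bdd : IsBddSymbol σ
  memLp : MemLp (fun ξ => σ (freq ξ)) 2 volume

/-- A single term of the exponential series at ε⟨k⟩² beats any power. Decay like ⟨k⟩⁻² makes the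
symbol both bounded and square integrable. -/
theorem exists_jb_pow_mul_exp_le (n : ℕ) {ε : ℝ} (hε : 0 < ε) :
    ∃ C : ℝ, 0 ≤ C ∧ ∀ k : ℝ, jb k ^ n * Real.exp (-(ε * k ^ 2)) ≤ C * (jb k ^ 2)⁻¹ := by
  refine ⟨Real.exp ε * ((n + 1).factorial / ε ^ (n + 1)), by positivity, fun k => ?_⟩
  have hJ := jb_pos k
  have h1 : jb k ^ n ≤ (jb k ^ 2) ^ n := by
    rw [← pow_mul]; exact pow_le_pow_right₀ (one_le_jb k) (by omega)
  have h2 := Real.pow_div_factorial_le_exp (ε * jb k ^ 2) (by positivity) (n + 1)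
  rw [div_le_iff₀ (by positivity), mul_pow] at h2
  have h3 : (jb k ^ 2) ^ (n + 1) ≤
      Real.exp (ε * jb k ^ 2) * ((n + 1).factorial / ε ^ (n + 1)) := by
    rw [← mul_div_assoc, le_div_iff₀ (by positivity)]; linarith
  have h4 : Real.exp (ε * jb k ^ 2) = Real.exp ε * Real.exp (ε * k ^ 2) := by
    rw [← Real.exp_add, jb_sq]; ring_nf
  rw [h4] at h3
  rw [← div_eq_mul_inv, le_div_iff₀ (by positivity), Real.exp_neg]
  calc jb k ^ n * (Real.exp (ε * k ^ 2))⁻¹ * jb k ^ 2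
      ≤ (jb k ^ 2) ^ n * (Real.exp (ε * k ^ 2))⁻¹ * jb k ^ 2 := by gcongr
    _ = (jb k ^ 2) ^ (n + 1) * (Real.exp (ε * k ^ 2))⁻¹ := by ring
    _ ≤ (Real.exp ε * Real.exp (ε * k ^ 2) * ((n + 1).factorial / ε ^ (n + 1))) *
        (Real.exp (ε * k ^ 2))⁻¹ := by gcongr
    _ = _ := by field_simp

theorem isRegSymbol_of_le {σ : ℝ → ℂ} (hσ : Measurable σ) {C : ℝ} (hC : 0 ≤ C)
    (h : ∀ k, ‖σ k‖ ≤ C * (jb k ^ 2)⁻¹) : IsRegSymbol σ := by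
  have h1 : ∀ k, (jb k ^ 2)⁻¹ ≤ 1 := fun k => inv_le_one_of_one_le₀ (one_le_pow₀ (one_le_jb k))
  refine ⟨⟨hσ, C, fun k => (h k).trans (mul_le_of_le_one_right hC (h1 k))⟩, ?_⟩
  have hm : AEStronglyMeasurable (fun ξ => σ (freq ξ)) volume :=
    (hσ.comp measurable_freq).aestronglyMeasurable
  rw [integrable_norm_sq_iff hm]
  refine (integrable_inv_jb_sq.const_mul (C ^ 2)).mono' (hm.norm.pow 2) (ae_of_all _ fun ξ => ?_)
  rw [Real.norm_of_nonneg (by positivity)]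
  have h0 : 0 ≤ (jb (freq ξ) ^ 2)⁻¹ := by positivity
  calc ‖σ (freq ξ)‖ ^ 2 ≤ (C * (jb (freq ξ) ^ 2)⁻¹) ^ 2 := by gcongr; exact h _
    _ = C ^ 2 * ((jb (freq ξ) ^ 2)⁻¹ * (jb (freq ξ) ^ 2)⁻¹) := by ring
    _ ≤ C ^ 2 * ((jb (freq ξ) ^ 2)⁻¹ * 1) := by gcongr; exact h1 _
    _ = _ := by ring

theorem isRegSymbol_msym (s : ℕ) {ε : ℝ} (hε : 0 < ε) : IsRegSymbol (msym s ε) := by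
  obtain ⟨C, hC, h⟩ := exists_jb_pow_mul_exp_le s hε
  exact isRegSymbol_of_le (continuous_msym s ε).measurable hC fun k => by
    rw [norm_msym]; exact h k

theorem isRegSymbol_psym (s : ℕ) {ε : ℝ} (hε : 0 < ε) : IsRegSymbol (psym s ε) := by
  obtain ⟨C, hC, h⟩ := exists_jb_pow_mul_exp_le (s + 1) hε
  refine isRegSymbol_of_le (continuous_psym s ε).measurable hC fun k => ?_
  refine le_trans ?_ (h k)
  rw [norm_psym, norm_msym, pow_succ' (jb k) s, mul_assoc]
  exact mul_le_mul_of_nonneg_right (abs_le_jb k)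
    (mul_nonneg (pow_nonneg (jb_pos k).le _) (Real.exp_pos _).le)

theorem IsRegSymbol.integrable {σ : ℝ → ℂ} (hσ : IsRegSymbol σ) (f : L2) :
    Integrable (fun ξ => σ (freq ξ) * f ξ) volume := hσ.memLp.integrable_mul (Lp.memLp f)

/-- By Cauchy–Schwarz a regularized function has integrable transform, hence is essentially bounded,
so its product with an arbitrary L² function is meaningful. -/
theorem IsRegSymbol.exists_bound {σ : ℝ → ℂ} (hσ : IsRegSymbol σ) :
    ∃ C : ℝ, 0 ≤ C ∧ ∀ f : L2, ∫ ξ, ‖σ (freq ξ) * f ξ‖ ≤ C * ‖f‖ := by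
  refine ⟨‖toL2 fun ξ => σ (freq ξ)‖, norm_nonneg _, fun f => ?_⟩
  have cs := integral_mul_le_Lp_mul_Lq_of_nonneg (μ := volume) Real.HolderConjugate.two_two
    (f := fun ξ => ‖σ (freq ξ)‖) (g := fun ξ => ‖f ξ‖)
    (ae_of_all _ fun ξ => norm_nonneg _) (ae_of_all _ fun ξ => norm_nonneg _)
    (by simpa using hσ.memLp.norm) (by simpa using (Lp.memLp f).norm)
  simp_rw [norm_mul]
  refine cs.trans (le_of_eq ?_)
  simp_rw [Real.rpow_ofNat]
  rw [← norm_sq_eq_integral, ← norm_toL2_sq hσ.memLp, ← Real.sqrt_eq_rpow, ← Real.sqrt_eq_rpow,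
    Real.sqrt_sq (norm_nonneg _), Real.sqrt_sq (norm_nonneg _)]

theorem IsRegSymbol.coeFn_multiplier {σ : ℝ → ℂ} (hσ : IsRegSymbol σ) (f : L2) :
    multiplier σ f =ᵐ[volume] 𝓕⁻ fun ξ => σ (freq ξ) * (𝓕 f : L2) ξ :=
  fourierInv_toL2 (hσ.integrable _) (hσ.bdd.memLp _)

/-- A uniform bound of the regularization operator from `L²` to `L^∞`. -/
def regBound (σ : ℝ → ℂ) (hσ : IsRegSymbol σ) : ℝ := hσ.exists_bound.choose

theorem IsRegSymbol.ae_norm_le {σ : ℝ → ℂ} (hσ : IsRegSymbol σ) (f : L2) :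
    ∀ᵐ x, ‖multiplier σ f x‖ ≤ regBound σ hσ * ‖f‖ := by
  filter_upwards [hσ.coeFn_multiplier f] with x hx
  rw [hx, ← Lp.norm_fourier_eq f]
  exact (norm_fourierInv_le _ _).trans (hσ.exists_bound.choose_spec.2 _)

/-- The bounded bilinear operator `(b, f) ↦ b · F⁻¹(σ F f)`. -/
def regMul (σ : ℝ → ℂ) (hσ : IsRegSymbol σ) : L2 →L[ℂ] L2 →L[ℂ] L2 :=
  LinearMap.mkContinuous₂
    (LinearMap.mk₂ ℂ (fun b f => mul (multiplierL σ hσ.bdd f) b)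
      (fun _ _ f => mul_add_of_ae (hσ.ae_norm_le f))
      (fun c _ f => mul_smul_of_ae c (hσ.ae_norm_le f))
      (fun b f g => by
        rw [map_add]; exact add_mul_of_ae (hσ.ae_norm_le f) (hσ.ae_norm_le g))
      (fun c b f => by
        rw [map_smul, mul_comm', mul_comm' _ b]
        refine L2_ext ?_
        have h := hσ.ae_norm_le f
        have h' := hσ.ae_norm_le (c • f)
        filter_upwards [coeFn_mul (g := b) h, coeFn_mul (g := b) h',
          Lp.coeFn_smul c (multiplier σ f), Lp.coeFn_smul c (mul b (multiplier σ f)),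
          (Filter.EventuallyEq.refl _ _ :
            (multiplierL σ hσ.bdd (c • f) : L2) =ᵐ[volume] multiplierL σ hσ.bdd (c • f))]
          with x h1 h2 h3 h4 _
        have e : multiplier σ (c • f) = c • multiplier σ f := (multiplierL σ hσ.bdd).map_smul c f
        rw [e] at h2
        simp only [multiplierL_apply]
        rw [mul_comm' b (c • _), h2, h4, Pi.smul_apply, mul_comm' b, h1, h3, Pi.smul_apply,
          smul_eq_mul, smul_eq_mul]
        ring))
    (regBound σ hσ) fun b f => by
      refine (norm_mul_le_of_ae (hσ.ae_norm_le f)).trans (le_of_eq ?_)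
      ring

theorem regMul_apply (σ : ℝ → ℂ) (hσ : IsRegSymbol σ) (b f : L2) :
    regMul σ hσ b f = mul b (multiplier σ f) := mul_comm' _ _

/-! ### The Airy group -/

theorem isBddSymbol_airySym (t : ℝ) : IsBddSymbol (airySym t) :=
  ⟨(continuous_airySym.comp (continuous_const.prodMk continuous_id)).measurable, 1,
    fun k => (norm_airySym t k).le⟩

/-- The Airy group as a family of bounded operators. -/
def airyL (t : ℝ) : L2 →L[ℂ] L2 := multiplierL (airySym t) (isBddSymbol_airySym t)

theorem airyL_apply (t : ℝ) (f : L2) : airyL t f = airy t f := rfl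

theorem fourier_airyL (t : ℝ) (f : L2) :
    (𝓕 (airyL t f) : L2) =ᵐ[volume] fun ξ => airySym t (freq ξ) * (𝓕 f : L2) ξ :=
  fourier_multiplier ((isBddSymbol_airySym t).memLp _)

theorem norm_airyL (t : ℝ) (f : L2) : ‖airyL t f‖ = ‖f‖ := by
  rw [← Lp.norm_fourier_eq (airyL t f), ← Lp.norm_fourier_eq f]
  refine le_antisymm ((norm_le_of_ae_le (C := 1) ?_).trans_eq (one_mul _))
    ((norm_le_of_ae_le (C := 1) ?_).trans_eq (one_mul _))
  all_goals
    filter_upwards [fourier_airyL t f] with ξ h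
    simp [h, norm_airySym]

theorem airySym_add (t r k : ℝ) : airySym (t + r) k = airySym t k * airySym r k := by
  rw [airySym, airySym, airySym, ← Complex.exp_add]; congr 1; push_cast; ring

theorem airyL_add (t r : ℝ) (f : L2) : airyL (t + r) f = airyL t (airyL r f) := by
  refine fourier_ext ?_
  filter_upwards [fourier_airyL (t + r) f, fourier_airyL t (airyL r f), fourier_airyL r f]
    with ξ h1 h2 h3
  rw [h1, h2, h3, airySym_add]; ring

theorem airyL_zero (f : L2) : airyL 0 f = f := by
  have : airySym 0 = fun _ => 1 := by ext k; simp [airySym]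
  rw [airyL, multiplierL_apply, this, multiplier_one]

/-- Multipliers commute with the Airy group. -/
theorem multiplier_airyL {σ : ℝ → ℂ} {f : L2} (hσ : Measurable σ)
    (h : MemLp (fun ξ => σ (freq ξ) * (𝓕 f : L2) ξ) 2 volume) (t : ℝ) :
    MemLp (fun ξ => σ (freq ξ) * (𝓕 (airyL t f) : L2) ξ) 2 volume ∧
      multiplier σ (airyL t f) = airyL t (multiplier σ f) := by
  have h' : MemLp (fun ξ => σ (freq ξ) * (𝓕 (airyL t f) : L2) ξ) 2 volume := by
    refine h.of_le (aesm_symbol_mul hσ _) ?_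
    filter_upwards [fourier_airyL t f] with ξ h
    rw [h, norm_mul, norm_mul, norm_mul, norm_airySym, one_mul]
  refine ⟨h', fourier_ext ?_⟩
  filter_upwards [fourier_airyL t f, fourier_airyL t (multiplier σ f), fourier_multiplier h,
    fourier_multiplier h'] with ξ h1 h2 h3 h4
  rw [h4, h2, h1, h3]; ring

theorem MemHs.airyL {s : ℕ} {f : L2} (h : MemHs s f) (t : ℝ) : MemHs s (airyL t f) :=
  memHs_iff.2 (multiplier_airyL (measurable_sob s) (memHs_iff.1 h) t).1

theorem continuous_airyL_apply (f : L2) : Continuous fun t => airyL t f := by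
  rw [continuous_iff_continuousAt]
  intro t
  rw [ContinuousAt, tendsto_iff_norm_sub_tendsto_zero]
  have hm : ∀ r, Measurable (airySym r) := fun r => (isBddSymbol_airySym r).1
  have key := tendsto_multiplier_zero (l := 𝓝 t) (σ := fun r k => airySym r k - airySym t k)
    (B := fun _ => 2) (f := f) (fun r => (hm r).sub (hm t))
    (by
      simp_rw [mul_pow]
      exact (((memLp_two_iff_integrable_sq_norm (Lp.aestronglyMeasurable _)).1
        (Lp.memLp (𝓕 f : L2))).const_mul _))
    (Eventually.of_forall fun r k => (norm_sub_le _ _).trans (by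
      rw [norm_airySym, norm_airySym]; norm_num))
    (fun k => by
      have hc : Continuous fun r => airySym r k - airySym t k :=
        (continuous_airySym.comp (continuous_id.prodMk continuous_const)).sub continuous_const
      simpa using hc.tendsto t)
  refine key.congr fun r => ?_
  congr 1
  have hb : IsBddSymbol fun k => airySym r k - airySym t k :=
    ⟨(hm r).sub (hm t), 2, fun k => (norm_sub_le _ _).trans (by
      rw [norm_airySym, norm_airySym]; norm_num)⟩
  refine fourier_ext ?_
  filter_upwards [fourier_multiplier (σ := fun k => airySym r k - airySym t k)
    (hb.memLp (𝓕 f : L2)), fourier_airyL r f, fourier_airyL t f,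
    fourier_sub_coe (airyL r f) (airyL t f)] with ξ h1 h2 h3 h4
  rw [h1, h4, h2, h3]; ring

/-- Joint continuity follows from strong continuity because each operator is an isometry. -/
theorem continuous_airyL : Continuous fun p : ℝ × L2 => airyL p.1 p.2 := by
  rw [continuous_iff_continuousAt]
  rintro ⟨t, f⟩
  rw [ContinuousAt, tendsto_iff_norm_sub_tendsto_zero]
  have h1 : Tendsto (fun p : ℝ × L2 => ‖p.2 - f‖ + ‖airyL p.1 f - airyL t f‖) (𝓝 (t, f))
      (𝓝 0) := by
    have c1 : Continuous fun p : ℝ × L2 => ‖p.2 - f‖ + ‖airyL p.1 f - airyL t f‖ := by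
      have := (continuous_airyL_apply f).comp (continuous_fst (X := ℝ) (Y := L2))
      exact (continuous_snd.sub continuous_const).norm.add (this.sub continuous_const).norm
    simpa using c1.tendsto (t, f)
  refine squeeze_zero (fun _ => norm_nonneg _) (fun p => ?_) h1
  rw [← norm_airyL p.1 (p.2 - f), map_sub]
  exact norm_sub_le_norm_sub_add_norm_sub _ _ _

theorem continuous_airyL_comp {X : Type*} [TopologicalSpace X] {a : X → ℝ} {f : X → L2}
    (ha : Continuous a) (hf : Continuous f) : Continuous fun x => airyL (a x) (f x) :=
  Continuous.comp (g := fun p : ℝ × L2 => airyL p.1 p.2) (f := fun x => (a x, f x))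
    continuous_airyL (ha.prodMk hf)

/-- Kato smoothing for the product of a square integrable function with a solution of the
Airy equation. -/
theorem lintegral_regMul_airyL_sq_le (s : ℕ) {ε : ℝ} (hε : 0 < ε) (b ψ : L2) (T : ℝ) :
    ∫⁻ t in Ioc 0 T, ‖regMul (psym s ε) (isRegSymbol_psym s hε) b (airyL t ψ)‖ₑ ^ 2 ≤
      ENNReal.ofReal (1 / 3) * (‖b‖ₑ ^ 2 * ‖multiplier (msym s ε) ψ‖ₑ ^ 2) := by
  have hp := isRegSymbol_psym s hε
  have hm := isRegSymbol_msym s hε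
  set Ψ : ℝ → ℂ := fun ξ => (𝓕 ψ : L2) ξ
  have hΨ : Measurable Ψ := (Lp.stronglyMeasurable _).measurable
  -- A representative given by an explicit integral, hence jointly measurable in (t, x), as Tonelli
  -- requires.
  set u : ℝ → ℝ → ℂ := fun t x => ∫ ξ, airySym t (freq ξ) *
    (Complex.exp (((2 * Real.pi * (ξ * x) : ℝ) : ℂ) * Complex.I) * (psym s ε (freq ξ) * Ψ ξ))
    with hu
  have hfm := measurable_freq
  have hpm := (continuous_psym s ε).measurable
  have hmm := (continuous_msym s ε).measurable
  have ham := continuous_airySym.measurable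
  have hum : Measurable (Function.uncurry u) := by
    have : StronglyMeasurable fun q : (ℝ × ℝ) × ℝ => airySym q.1.1 (freq q.2) *
        (Complex.exp (((2 * Real.pi * (q.2 * q.1.2) : ℝ) : ℂ) * Complex.I) *
          (psym s ε (freq q.2) * Ψ q.2)) := by
      refine Measurable.stronglyMeasurable ?_
      refine (ham.comp (measurable_fst.fst.prodMk (hfm.comp measurable_snd))).mul ?_
      refine Measurable.mul (by fun_prop) ((hpm.comp (hfm.comp measurable_snd)).mul
        (hΨ.comp measurable_snd))
    exact this.integral_prod_right.measurable
  have hux : ∀ t, multiplier (psym s ε) (airyL t ψ) =ᵐ[volume] u t := fun t => by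
    filter_upwards [hp.coeFn_multiplier (airyL t ψ)] with x hx
    rw [hx, Real.fourierInv_eq']
    refine integral_congr_ae ?_
    filter_upwards [fourier_airyL t ψ] with ξ h
    rw [h, smul_eq_mul]
    have : inner ℝ ξ x = ξ * x := by simp [RCLike.inner_apply, mul_comm]
    rw [this]; ring
  have e1 : ∀ t, ‖regMul (psym s ε) hp b (airyL t ψ)‖ₑ ^ 2 = ∫⁻ x, ‖b x‖ₑ ^ 2 * ‖u t x‖ₑ ^ 2 :=
    fun t => by
      rw [enorm_sq_eq_lintegral, regMul_apply, mul_comm']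
      refine lintegral_congr_ae ?_
      filter_upwards [coeFn_mul (g := b) (hp.ae_norm_le (airyL t ψ)), hux t] with x h1 h2
      rw [h1, h2, enorm_mul, mul_pow, mul_comm]
  have hbm : Measurable fun x => b x := (Lp.stronglyMeasurable b).measurable
  have hMψ : ‖multiplier (msym s ε) ψ‖ₑ ^ 2 = ∫⁻ ξ, ‖msym s ε (freq ξ) * Ψ ξ‖ₑ ^ 2 := by
    rw [← enorm_toL2_sq (hm.bdd.memLp (𝓕 ψ : L2)), multiplier, ← ofReal_norm, ← ofReal_norm,
      ← Lp.norm_fourier_eq (𝓕⁻ _ : L2), FourierTransform.fourier_fourierInv_eq]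
  -- For fixed x the phase e^{ikx} is absorbed into the amplitude without changing its modulus, so
  -- the bound does not depend on x.
  have kato : ∀ x, ∫⁻ t in Ioc 0 T, ‖u t x‖ₑ ^ 2 ≤
      ENNReal.ofReal (1 / 3) * ‖multiplier (msym s ε) ψ‖ₑ ^ 2 := fun x => by
    have hph : ∀ ξ : ℝ, ‖Complex.exp (((2 * Real.pi * (ξ * x) : ℝ) : ℂ) * Complex.I)‖ = 1 :=
      fun ξ => Complex.norm_exp_ofReal_mul_I _
    have hphm : Measurable fun ξ : ℝ =>
        Complex.exp (((2 * Real.pi * (ξ * x) : ℝ) : ℂ) * Complex.I) := by fun_prop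
    have := lintegral_airy_sq_le
      (c := fun ξ => Complex.exp (((2 * Real.pi * (ξ * x) : ℝ) : ℂ) * Complex.I) *
        (psym s ε (freq ξ) * Ψ ξ))
      (d := fun ξ => Complex.exp (((2 * Real.pi * (ξ * x) : ℝ) : ℂ) * Complex.I) *
        (Complex.I * (msym s ε (freq ξ) * Ψ ξ)))
      ((hp.integrable (𝓕 ψ : L2)).bdd_mul (c := 1) hphm.aestronglyMeasurable
        (ae_of_all _ fun ξ => (hph ξ).le))
      (hphm.mul (((hmm.comp hfm).mul hΨ).const_mul _))
      (fun ξ => by rw [psym]; ring) T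
    refine this.trans (le_of_eq ?_)
    rw [hMψ]
    congr 1
    refine lintegral_congr fun ξ => ?_
    rw [enorm_mul, enorm_mul, ← ofReal_norm (Complex.exp _), hph, ← ofReal_norm Complex.I,
      Complex.norm_I, ENNReal.ofReal_one, one_mul, one_mul]
  calc ∫⁻ t in Ioc 0 T, ‖regMul (psym s ε) hp b (airyL t ψ)‖ₑ ^ 2
      = ∫⁻ t in Ioc 0 T, ∫⁻ x, ‖b x‖ₑ ^ 2 * ‖u t x‖ₑ ^ 2 := lintegral_congr fun t => e1 t
    -- Time is integrated first; since b does not depend on t, |b(x)|² comes out of the time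
    -- integral.
    _ = ∫⁻ x, ∫⁻ t in Ioc 0 T, ‖b x‖ₑ ^ 2 * ‖u t x‖ₑ ^ 2 := by
        rw [lintegral_lintegral_swap]
        exact Measurable.aemeasurable
          (((hbm.comp measurable_snd).enorm.pow_const 2).mul (hum.enorm.pow_const 2))
    _ = ∫⁻ x, ‖b x‖ₑ ^ 2 * ∫⁻ t in Ioc 0 T, ‖u t x‖ₑ ^ 2 := by
        refine lintegral_congr fun x => ?_
        rw [lintegral_const_mul]
        exact (hum.comp (measurable_id.prodMk measurable_const)).enorm.pow_const 2
    _ ≤ ∫⁻ x, ‖b x‖ₑ ^ 2 * (ENNReal.ofReal (1 / 3) * ‖multiplier (msym s ε) ψ‖ₑ ^ 2) :=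
        lintegral_mono fun x => by gcongr; exact kato x
    _ = _ := by
        rw [lintegral_mul_const _ (hbm.enorm.pow_const 2), ← enorm_sq_eq_lintegral]; ring

end

noncomputable section

/-! ### Space-time norms -/

/-- The norm of `L²([0, T]; E)`. -/
def tnorm {E : Type*} [NormedAddCommGroup E] (T : ℝ) (F : ℝ → E) : ENNReal :=
  eLpNorm F 2 (volume.restrict (Ioc 0 T))

theorem tnorm_sq {E : Type*} [NormedAddCommGroup E] (T : ℝ) (F : ℝ → E) :
    tnorm T F ^ 2 = ∫⁻ t in Ioc 0 T, ‖F t‖ₑ ^ 2 := by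
  rw [tnorm, eLpNorm_eq_lintegral_rpow_enorm_toReal (by norm_num) (by norm_num)]
  simp only [ENNReal.toReal_ofNat, ENNReal.rpow_ofNat, one_div]
  rw [← ENNReal.rpow_natCast, ← ENNReal.rpow_mul]
  norm_num

theorem ennreal_le_of_sq_le {a b : ENNReal} (h : a ^ 2 ≤ b ^ 2) : a ≤ b :=
  (ENNReal.pow_le_pow_left_iff (by norm_num)).1 h

theorem lintegral_sq_le_mul {μ : Measure ℝ} {f : ℝ → ENNReal} (hf : AEMeasurable f μ) :
    (∫⁻ t, f t ∂μ) ^ 2 ≤ μ univ * ∫⁻ t, f t ^ 2 ∂μ := by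
  have cs := ENNReal.lintegral_mul_le_Lp_mul_Lq μ Real.HolderConjugate.two_two
    (f := fun _ => 1) (g := f) (by fun_prop) hf
  simp only [Pi.mul_apply, one_mul, ENNReal.one_rpow, lintegral_const] at cs
  calc (∫⁻ t, f t ∂μ) ^ 2 ≤ ((μ univ) ^ (1 / (2 : ℝ)) *
        (∫⁻ t, f t ^ (2 : ℝ) ∂μ) ^ (1 / (2 : ℝ))) ^ 2 := by gcongr
    _ = _ := by
      rw [mul_pow, ← ENNReal.rpow_natCast, ← ENNReal.rpow_natCast, ← ENNReal.rpow_mul,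
        ← ENNReal.rpow_mul]
      norm_num

theorem enorm_intervalIntegral_le {E : Type*} [NormedAddCommGroup E] [NormedSpace ℝ E] {T t : ℝ}
    (ht : t ∈ Icc 0 T) (F : ℝ → E) :
    ‖∫ τ in (0 : ℝ)..t, F τ‖ₑ ≤ ∫⁻ τ in Ioc 0 T, ‖F τ‖ₑ := by
  rw [intervalIntegral.integral_of_le ht.1]
  exact (enorm_integral_le_lintegral_enorm _).trans
    (lintegral_mono_set (Ioc_subset_Ioc_right ht.2))

/-- Minkowski's inequality for Volterra operators. -/
theorem tnorm_integral_sq_le {E : Type*} [NormedAddCommGroup E] [NormedSpace ℝ E]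
    {F : ℝ → ℝ → E} (hF : Continuous (Function.uncurry F)) (T : ℝ) :
    tnorm T (fun t => ∫ τ in (0 : ℝ)..t, F t τ) ^ 2 ≤
      ENNReal.ofReal T * ∫⁻ τ in Ioc 0 T, tnorm T (fun t => F t τ) ^ 2 := by
  simp_rw [tnorm_sq]
  have hm : Measurable fun p : ℝ × ℝ => ‖F p.1 p.2‖ₑ ^ 2 :=
    (hF.enorm.measurable).pow_const 2
  calc ∫⁻ t in Ioc 0 T, ‖∫ τ in (0 : ℝ)..t, F t τ‖ₑ ^ 2
      ≤ ∫⁻ t in Ioc 0 T, ENNReal.ofReal T * ∫⁻ τ in Ioc 0 T, ‖F t τ‖ₑ ^ 2 := by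
        refine setLIntegral_mono' measurableSet_Ioc fun t ht => ?_
        have hFt : Continuous fun τ => ‖F t τ‖ₑ :=
          hF.enorm.comp (continuous_const.prodMk continuous_id)
        -- The upper limit t is enlarged to T, where F is still defined; Cauchy–Schwarz in τ then
        -- costs the factor T.
        calc _ ≤ (∫⁻ τ in Ioc 0 T, ‖F t τ‖ₑ) ^ 2 := by
              gcongr; exact enorm_intervalIntegral_le (Ioc_subset_Icc_self ht) _
          _ ≤ _ := by
              refine (lintegral_sq_le_mul hFt.aemeasurable).trans (le_of_eq ?_)
              simp
    _ = ENNReal.ofReal T * ∫⁻ t in Ioc 0 T, ∫⁻ τ in Ioc 0 T, ‖F t τ‖ₑ ^ 2 := by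
        rw [lintegral_const_mul' _ _ ENNReal.ofReal_ne_top]
    _ = _ := by
        rw [lintegral_lintegral_swap hm.aemeasurable]

/-! ### Solutions of the inhomogeneous Airy equation -/

/-- The solution of `u_t + u_xxx = -h` with initial value `φ`. -/
def airyCurve (φ : L2) (h : ℝ → L2) (t : ℝ) : L2 :=
  airyL t (φ - ∫ τ in (0 : ℝ)..t, airyL (-τ) (h τ))

theorem continuous_airyL_neg {h : ℝ → L2} (hh : Continuous h) :
    Continuous fun τ => airyL (-τ) (h τ) := continuous_airyL_comp continuous_neg hh

theorem continuous_airyCurve (φ : L2) {h : ℝ → L2} (hh : Continuous h) :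
    Continuous (airyCurve φ h) := by
  refine continuous_airyL_comp continuous_id (continuous_const.sub ?_)
  exact intervalIntegral.continuous_primitive
    (fun a b => (continuous_airyL_neg hh).intervalIntegrable a b) 0

theorem airyL_airyL_neg (t τ : ℝ) (f : L2) : airyL t (airyL (-τ) f) = airyL (t - τ) f := by
  rw [← airyL_add, sub_eq_add_neg]

theorem airyCurve_eq (φ : L2) {h : ℝ → L2} (hh : Continuous h) (t : ℝ) :
    airyCurve φ h t = airyL t φ - ∫ τ in (0 : ℝ)..t, airyL (t - τ) (h τ) := by
  rw [airyCurve, map_sub, ← ContinuousLinearMap.intervalIntegral_comp_comm _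
    ((continuous_airyL_neg hh).intervalIntegrable _ _)]
  simp_rw [airyL_airyL_neg]

theorem map_airyCurve {A : L2 →L[ℂ] L2} (hA : ∀ t f, A (airyL t f) = airyL t (A f)) (φ : L2)
    {h : ℝ → L2} (hh : Continuous h) (t : ℝ) :
    A (airyCurve φ h t) = airyCurve (A φ) (fun τ => A (h τ)) t := by
  rw [airyCurve, airyCurve, hA, map_sub, ← ContinuousLinearMap.intervalIntegral_comp_comm _
    ((continuous_airyL_neg hh).intervalIntegrable _ _)]
  simp_rw [hA]

theorem airyCurve_sub (φ ψ : L2) {h k : ℝ → L2} (hh : Continuous h) (hk : Continuous k) (t : ℝ) :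
    airyCurve φ h t - airyCurve ψ k t = airyCurve (φ - ψ) (fun τ => h τ - k τ) t := by
  simp only [airyCurve]
  rw [← map_sub]
  congr 1
  simp only [map_sub]
  rw [intervalIntegral.integral_sub ((continuous_airyL_neg hh).intervalIntegrable _ _)
    ((continuous_airyL_neg hk).intervalIntegrable _ _)]
  abel

theorem enorm_airyL (t : ℝ) (f : L2) : ‖airyL t f‖ₑ = ‖f‖ₑ := by
  rw [← ofReal_norm, norm_airyL, ofReal_norm]

theorem enorm_airyCurve_le (φ : L2) {h : ℝ → L2} (hh : Continuous h) {t T : ℝ}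
    (ht : t ∈ Icc 0 T) :
    ‖airyCurve φ h t‖ₑ ≤ ‖φ‖ₑ + ENNReal.ofReal (Real.sqrt T) * tnorm T h := by
  rw [airyCurve, enorm_airyL]
  refine (enorm_sub_le).trans (add_le_add le_rfl ?_)
  refine (enorm_intervalIntegral_le ht _).trans ?_
  simp_rw [enorm_airyL]
  refine ennreal_le_of_sq_le ?_
  rw [mul_pow, tnorm_sq, ← ENNReal.ofReal_pow (Real.sqrt_nonneg _),
    Real.sq_sqrt (ht.1.trans ht.2)]
  refine (lintegral_sq_le_mul hh.enorm.aemeasurable).trans (le_of_eq ?_)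
  simp

/-! ### Differentiability in time -/

/-- The symbol `ik³` of the generator of the Airy group. -/
def cubeSym (k : ℝ) : ℂ := Complex.I * (k : ℂ) ^ 3

theorem continuous_cubeSym : Continuous cubeSym := by unfold cubeSym; fun_prop

theorem norm_cubeSym_le (k : ℝ) : ‖cubeSym k‖ ≤ 1 * jb k ^ 3 := by
  rw [cubeSym, norm_mul, Complex.norm_I, norm_pow, Complex.norm_real, Real.norm_eq_abs]
  gcongr
  exact abs_le_jb k

theorem airySym_eq_exp_mul (t k : ℝ) : airySym t k = Complex.exp (t * cubeSym k) := by
  rw [airySym, cubeSym]; congr 1; ring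

/-- Dominated convergence on the Fourier side. The error of the difference quotient has symbol at
most 2⟨k⟩³, so three derivatives in L² suffice. -/
theorem hasDerivAt_airyL_zero {f : L2} (hf : MemHs 3 f) :
    HasDerivAt (fun t => airyL t f) (multiplier cubeSym f) 0 := by
  have hcm := continuous_cubeSym.measurable
  have hL := hf.memLp_symbol hcm norm_cubeSym_le
  have hm : ∀ r, Measurable (airySym r) := fun r => (isBddSymbol_airySym r).1
  rw [hasDerivAt_iff_tendsto]
  have key := tendsto_multiplier_zero (l := 𝓝 (0 : ℝ))
    (σ := fun r k => (r : ℂ)⁻¹ * (airySym r k - 1 - r * cubeSym k))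
    (B := fun k => 2 * jb k ^ 3) (f := f)
    (fun r => (((hm r).sub_const 1).sub (hcm.const_mul _)).const_mul _)
    (by
      have := hf
      rw [MemHs] at this
      refine (this.const_mul 4).congr (ae_of_all _ fun ξ => ?_)
      simp only
      rw [← jb_sq]; ring)
    (Eventually.of_forall fun r k => by
      rcases eq_or_ne r 0 with rfl | hr
      -- At r = 0 the symbol vanishes, since the inverse of 0 is 0.
      · have := jb_pos k
        simp only [Complex.ofReal_zero, inv_zero, zero_mul, norm_zero]
        positivity
      have h1 : ‖airySym r k - 1‖ ≤ |r| * (1 * jb k ^ 3) := by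
        have h2 := Real.norm_exp_I_mul_ofReal_sub_one_le (x := k ^ 3 * r)
        have e : airySym r k = Complex.exp (Complex.I * ((k ^ 3 * r : ℝ) : ℂ)) := by
          rw [airySym]; congr 1; push_cast; ring
        rw [e]
        refine h2.trans ?_
        rw [Real.norm_eq_abs, abs_mul, abs_pow, mul_comm, one_mul]
        gcongr
        exact abs_le_jb k
      rw [norm_mul, norm_inv, Complex.norm_real, Real.norm_eq_abs]
      have hr' : 0 < |r| := abs_pos.2 hr
      rw [inv_mul_le_iff₀ hr']
      calc _ ≤ ‖airySym r k - 1‖ + ‖(r : ℂ) * cubeSym k‖ := norm_sub_le _ _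
        _ ≤ |r| * (1 * jb k ^ 3) + |r| * (1 * jb k ^ 3) := by
          refine add_le_add h1 ?_
          rw [norm_mul, Complex.norm_real, Real.norm_eq_abs]
          gcongr
          exact norm_cubeSym_le k
        _ = _ := by ring)
    (fun k => by
      have hd : HasDerivAt (fun r : ℝ => airySym r k) (cubeSym k) 0 := by
        have h0 : HasDerivAt (fun r : ℝ => (r : ℂ) * cubeSym k) (1 * cubeSym k) 0 :=
          (Complex.ofRealCLM.hasDerivAt).mul_const _
        have := h0.cexp
        simp_rw [airySym_eq_exp_mul]
        simpa using this
      rw [hasDerivAt_iff_tendsto] at hd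
      rw [tendsto_zero_iff_norm_tendsto_zero]
      refine hd.congr fun r => ?_
      rw [norm_mul, norm_inv, Complex.norm_real, sub_zero]
      congr 2
      simp [airySym])
  refine key.congr fun r => ?_
  have hb : MemLp (fun ξ => (r : ℂ)⁻¹ * (airySym r (freq ξ) - 1 - r * cubeSym (freq ξ)) *
      (𝓕 f : L2) ξ) 2 volume := by
    have h1 := (((isBddSymbol_airySym r).memLp (𝓕 f : L2)).sub (Lp.memLp (𝓕 f : L2))).sub
      (hL.const_mul (r : ℂ))
    refine (h1.const_mul (r : ℂ)⁻¹).ae_eq (ae_of_all _ fun ξ => ?_)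
    simp only [Pi.sub_apply]; ring
  have e : multiplier (fun k => (r : ℂ)⁻¹ * (airySym r k - 1 - r * cubeSym k)) f =
      (r : ℂ)⁻¹ • (airyL r f - f - (r : ℂ) • multiplier cubeSym f) := by
    refine fourier_ext ?_
    filter_upwards [fourier_multiplier
      (σ := fun k => (r : ℂ)⁻¹ * (airySym r k - 1 - r * cubeSym k)) hb, fourier_airyL r f,
      fourier_multiplier hL, fourier_smul_coe (r : ℂ) (multiplier cubeSym f),
      fourier_sub_coe (airyL r f) f, fourier_sub_coe (airyL r f - f)
        ((r : ℂ) • multiplier cubeSym f),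
      fourier_smul_coe (r : ℂ)⁻¹ (airyL r f - f - (r : ℂ) • multiplier cubeSym f)]
      with ξ h1 h2 h3 h4 h5 h6 h7
    rw [h1, h7, h6, h5, h4, h3, h2]; ring
  rw [e, norm_smul, norm_inv, Complex.norm_real, sub_zero, airyL_zero]
  rfl

theorem hasDerivAt_airyL {f : L2} (hf : MemHs 3 f) (t : ℝ) :
    HasDerivAt (fun r => airyL r f) (multiplier cubeSym (airyL t f)) t := by
  have h0 : HasDerivAt (fun r => airyL (r - t) (airyL t f)) (multiplier cubeSym (airyL t f)) t := by
    have := hasDerivAt_airyL_zero (hf.airyL t)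
    rw [← sub_self t] at this
    exact this.comp_sub_const t t
  refine h0.congr_of_eventuallyEq (Eventually.of_forall fun r => ?_)
  simp only
  rw [← airyL_add]; congr 2; ring

theorem tendsto_airyL {ι : Type*} {l : Filter ι} {a : ι → ℝ} {f : ι → L2} {t : ℝ} {u : L2}
    (ha : Tendsto a l (𝓝 t)) (hf : Tendsto f l (𝓝 u)) :
    Tendsto (fun i => airyL (a i) (f i)) l (𝓝 (airyL t u)) :=
  Tendsto.comp (g := fun p : ℝ × L2 => airyL p.1 p.2) (f := fun i => (a i, f i)) (y := 𝓝 (t, u))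
    (continuous_airyL.tendsto (t, u)) (ha.prodMk_nhds hf)

/-- The group is only strongly continuous, so the usual product rule is not available. U(r)y(r) is
split as U(r)y(t) + U(r)(y(r) − y(t)): the first term needs y(t) in H³, the second only joint
continuity of the group. -/
theorem hasDerivAt_airyL_comp {y : ℝ → L2} {y' : L2} {t : ℝ} (hy : HasDerivAt y y' t)
    (hyt : MemHs 3 (y t)) :
    HasDerivAt (fun r => airyL r (y r)) (multiplier cubeSym (airyL t (y t)) + airyL t y') t := by
  have h1 : HasDerivAt (fun r => airyL r (y t)) (multiplier cubeSym (airyL t (y t))) t :=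
    hasDerivAt_airyL hyt t
  have h2 : HasDerivAt (fun r => airyL r (y r - y t)) (airyL t y') t := by
    rw [hasDerivAt_iff_tendsto_slope] at hy ⊢
    have hid : Tendsto (fun r : ℝ => r) (𝓝[≠] t) (𝓝 t) :=
      tendsto_nhdsWithin_of_tendsto_nhds tendsto_id
    refine (tendsto_airyL hid hy).congr fun r => ?_
    rw [slope_def_module, slope_def_module, sub_self, map_zero, sub_zero,
      ContinuousLinearMap.map_smul_of_tower]
  refine (h1.add h2).congr_of_eventuallyEq (Eventually.of_forall fun r => ?_)
  simp only [Pi.add_apply, map_sub]; abel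

theorem hasDerivAt_airyCurve {φ : L2} {h : ℝ → L2} (hh : Continuous h) {t : ℝ}
    (ht : MemHs 3 (airyCurve φ h t)) :
    HasDerivAt (airyCurve φ h) (multiplier cubeSym (airyCurve φ h t) - h t) t := by
  have hy' : HasDerivAt (fun t => φ - ∫ τ in (0 : ℝ)..t, airyL (-τ) (h τ))
      (-airyL (-t) (h t)) t :=
    ((continuous_airyL_neg hh).integral_hasStrictDerivAt 0 t).hasDerivAt.const_sub φ
  have hyt : MemHs 3 (φ - ∫ τ in (0 : ℝ)..t, airyL (-τ) (h τ)) := by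
    have := ht.airyL (-t)
    rwa [airyCurve, ← airyL_add, neg_add_cancel, airyL_zero] at this
  refine (hasDerivAt_airyL_comp hy' hyt).congr_deriv ?_
  rw [map_neg, ← airyL_add, add_neg_cancel, airyL_zero, ← sub_eq_add_neg]
  rfl

/-- The fundamental theorem of calculus for solutions of the inhomogeneous Airy equation. -/
theorem airyCurve_eq_add_integral {φ : L2} {h z : ℝ → L2} (hh : Continuous h) (hz : Continuous z)
    {T : ℝ} (hT : ∀ t ∈ Icc 0 T, MemHs 3 (airyCurve φ h t) ∧
      z t = multiplier cubeSym (airyCurve φ h t) - h t) {t : ℝ} (ht : t ∈ Icc 0 T) :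
    airyCurve φ h t = φ + ∫ τ in (0 : ℝ)..t, z τ := by
  have := intervalIntegral.integral_eq_sub_of_hasDerivAt (f := airyCurve φ h) (f' := z)
    (a := 0) (b := t) (fun r hr => by
      rw [uIcc_of_le ht.1] at hr
      obtain ⟨h1, h2⟩ := hT r ⟨hr.1, hr.2.trans ht.2⟩
      rw [h2]
      exact hasDerivAt_airyCurve hh h1) (hz.intervalIntegrable _ _)
  rw [this]
  simp [airyCurve, airyL_zero]

/-! ### The bilinear smoothing estimate -/

theorem multiplierL_airyL {σ : ℝ → ℂ} (hσ : IsBddSymbol σ) (t : ℝ) (f : L2) :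
    multiplierL σ hσ (airyL t f) = airyL t (multiplierL σ hσ f) :=
  (multiplier_airyL hσ.1 (hσ.memLp _) t).2

variable (s : ℕ) {ε : ℝ} (hε : 0 < ε)

/-- The regularized operator `(1 + ∂ₓ)^s`. -/
def regM : L2 →L[ℂ] L2 := multiplierL (msym s ε) (isRegSymbol_msym s hε).bdd

/-- The regularized product `f · (1 + ∂ₓ)^s ∂ₓ g`. -/
def regB : L2 →L[ℂ] L2 →L[ℂ] L2 := regMul (psym s ε) (isRegSymbol_psym s hε)

/-- The constant 58/100 is just above 1/√3. -/
theorem tnorm_regB_airyL_le (b ψ : L2) (T : ℝ) :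
    tnorm T (fun t => regB s hε b (airyL t ψ)) ≤
      ENNReal.ofReal (58 / 100) * (‖b‖ₑ * ‖regM s hε ψ‖ₑ) := by
  refine ennreal_le_of_sq_le ?_
  rw [tnorm_sq, mul_pow, mul_pow, ← ENNReal.ofReal_pow (by norm_num)]
  refine (lintegral_regMul_airyL_sq_le s hε b ψ T).trans ?_
  gcongr
  · norm_num
  · rfl

theorem continuous_regB {X : Type*} [TopologicalSpace X] {f g : X → L2} (hf : Continuous f)
    (hg : Continuous g) : Continuous fun x => regB s hε (f x) (g x) :=
  ((regB s hε).continuous.comp hf).clm_apply hg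

/-- In the Duhamel integral each τ contributes a free Airy solution on the whole of [0, T], to which
the smoothing estimate with frozen b applies. Integrating over τ costs √T in front of the space-time
norm of the forcing. -/
theorem tnorm_regB_airyCurve_le (b g₀ : L2) {h : ℝ → L2} (hh : Continuous h) {T : ℝ}
    (hT : 0 ≤ T) :
    tnorm T (fun t => regB s hε b (airyCurve g₀ h t)) ≤
      ENNReal.ofReal (58 / 100) * (‖b‖ₑ * (‖regM s hε g₀‖ₑ +
        ENNReal.ofReal (Real.sqrt T) * tnorm T fun t => regM s hε (h t))) := by
  set F : ℝ → ℝ → L2 := fun t τ => regB s hε b (airyL t (airyL (-τ) (h τ))) with hF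
  have hFc : Continuous (Function.uncurry F) := by
    refine continuous_regB s hε continuous_const (continuous_airyL_comp continuous_fst ?_)
    exact continuous_airyL_comp continuous_snd.neg (hh.comp continuous_snd)
  have e : ∀ t, regB s hε b (airyCurve g₀ h t) =
      regB s hε b (airyL t g₀) - ∫ τ in (0 : ℝ)..t, F t τ := fun t => by
    rw [airyCurve_eq g₀ hh, map_sub, ← ContinuousLinearMap.intervalIntegral_comp_comm]
    · simp only [hF, airyL_airyL_neg]
    · exact (continuous_airyL_comp (continuous_const.sub continuous_id) hh).intervalIntegrable _ _
  have c1 : Continuous fun t => regB s hε b (airyL t g₀) :=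
    continuous_regB s hε continuous_const (continuous_airyL_apply g₀)
  have c2 : Continuous fun t => ∫ τ in (0 : ℝ)..t, F t τ := by
    have : (fun t => ∫ τ in (0 : ℝ)..t, F t τ) = fun t => regB s hε b (airyL t g₀) -
        regB s hε b (airyCurve g₀ h t) := by
      ext1 t; rw [e]; abel
    rw [this]
    exact c1.sub (continuous_regB s hε continuous_const (continuous_airyCurve g₀ hh))
  have hvol : tnorm T (fun t => ∫ τ in (0 : ℝ)..t, F t τ) ≤
      ENNReal.ofReal (58 / 100) * (‖b‖ₑ *
        (ENNReal.ofReal (Real.sqrt T) * tnorm T fun t => regM s hε (h t))) := by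
    refine ennreal_le_of_sq_le ((tnorm_integral_sq_le hFc T).trans ?_)
    have hτ : ∀ τ, tnorm T (fun t => F t τ) ^ 2 ≤
        (ENNReal.ofReal (58 / 100) * ‖b‖ₑ) ^ 2 * ‖regM s hε (h τ)‖ₑ ^ 2 := fun τ => by
      rw [← mul_pow, mul_assoc]
      gcongr
      refine (tnorm_regB_airyL_le s hε b (airyL (-τ) (h τ)) T).trans (le_of_eq ?_)
      rw [regM, multiplierL_airyL, enorm_airyL]
    calc _ ≤ ENNReal.ofReal T * ∫⁻ τ in Ioc 0 T,
          (ENNReal.ofReal (58 / 100) * ‖b‖ₑ) ^ 2 * ‖regM s hε (h τ)‖ₑ ^ 2 := by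
            gcongr with τ; exact hτ τ
      _ = _ := by
        have hmeas : Measurable fun τ => ‖regM s hε (h τ)‖ₑ ^ 2 :=
          (((regM s hε).continuous.comp hh).enorm.measurable).pow_const 2
        rw [lintegral_const_mul _ hmeas, ← tnorm_sq, mul_pow, mul_pow, mul_pow, mul_pow,
          ← ENNReal.ofReal_pow (Real.sqrt_nonneg _), Real.sq_sqrt hT]
        ring
  simp_rw [e]
  calc tnorm T (fun t => regB s hε b (airyL t g₀) - ∫ τ in (0 : ℝ)..t, F t τ)
      ≤ tnorm T (fun t => regB s hε b (airyL t g₀)) +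
          tnorm T (fun t => ∫ τ in (0 : ℝ)..t, F t τ) :=
        eLpNorm_sub_le c1.aestronglyMeasurable c2.aestronglyMeasurable (by norm_num)
    _ ≤ _ := add_le_add (tnorm_regB_airyL_le s hε b g₀ T) hvol
    _ = _ := by ring

/-- Smoothing needs a coefficient independent of time. Writing f as f₀ plus the integral of z leaves
the frozen coefficients f₀ and z(τ), and the superposition over τ costs T·Z. -/
theorem tnorm_regB_le {f : ℝ → L2} {f₀ g₀ : L2} {h z : ℝ → L2} (hh : Continuous h)
    (hz : Continuous z) {T : ℝ} (hT : 0 ≤ T)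
    (hf : ∀ t ∈ Icc 0 T, f t = f₀ + ∫ τ in (0 : ℝ)..t, z τ) {Z : ENNReal}
    (hZ : ∀ t ∈ Icc 0 T, ‖z t‖ₑ ≤ Z) :
    tnorm T (fun t => regB s hε (f t) (airyCurve g₀ h t)) ≤
      ENNReal.ofReal (58 / 100) * ((‖f₀‖ₑ + ENNReal.ofReal T * Z) * (‖regM s hε g₀‖ₑ +
        ENNReal.ofReal (Real.sqrt T) * tnorm T fun t => regM s hε (h t))) := by
  set g := airyCurve g₀ h
  have hg : Continuous g := continuous_airyCurve g₀ hh
  set E : ENNReal := ‖regM s hε g₀‖ₑ +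
    ENNReal.ofReal (Real.sqrt T) * tnorm T fun t => regM s hε (h t)
  set F : ℝ → ℝ → L2 := fun t τ => regB s hε (z τ) (g t) with hF
  have hFc : Continuous (Function.uncurry F) :=
    continuous_regB s hε (hz.comp continuous_snd) (hg.comp continuous_fst)
  have hzi : Continuous fun t => ∫ τ in (0 : ℝ)..t, z τ :=
    intervalIntegral.continuous_primitive (fun a b => hz.intervalIntegrable a b) 0
  have eF : ∀ t, ∫ τ in (0 : ℝ)..t, F t τ = regB s hε (∫ τ in (0 : ℝ)..t, z τ) (g t) :=
    fun t => by
      have := ContinuousLinearMap.intervalIntegral_comp_comm ((regB s hε).flip (g t))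
        (hz.intervalIntegrable (μ := volume) 0 t)
      simpa [hF] using this
  have c1 : Continuous fun t => regB s hε f₀ (g t) := continuous_regB s hε continuous_const hg
  have c2 : Continuous fun t => ∫ τ in (0 : ℝ)..t, F t τ := by
    simp_rw [eF]; exact continuous_regB s hε hzi hg
  have hvol : tnorm T (fun t => ∫ τ in (0 : ℝ)..t, F t τ) ≤
      ENNReal.ofReal (58 / 100) * (ENNReal.ofReal T * Z * E) := by
    refine ennreal_le_of_sq_le ((tnorm_integral_sq_le hFc T).trans ?_)
    calc _ ≤ ENNReal.ofReal T * ∫⁻ _ in Ioc 0 T, (ENNReal.ofReal (58 / 100) * (Z * E)) ^ 2 := by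
          refine mul_le_mul' le_rfl (setLIntegral_mono' measurableSet_Ioc fun τ hτ => ?_)
          gcongr
          refine (tnorm_regB_airyCurve_le s hε (z τ) g₀ hh hT).trans ?_
          gcongr
          exact hZ τ (Ioc_subset_Icc_self hτ)
      _ = _ := by
        rw [lintegral_const]
        simp only [MeasurableSet.univ, Measure.restrict_apply, univ_inter, Real.volume_Ioc,
          sub_zero]
        ring
  have heq : tnorm T (fun t => regB s hε (f t) (g t)) =
      tnorm T (fun t => regB s hε f₀ (g t) + ∫ τ in (0 : ℝ)..t, F t τ) := by
    refine eLpNorm_congr_ae ?_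
    filter_upwards [ae_restrict_mem measurableSet_Ioc] with t ht
    rw [hf t (Ioc_subset_Icc_self ht), map_add, eF]; rfl
  rw [heq]
  calc _ ≤ tnorm T (fun t => regB s hε f₀ (g t)) +
          tnorm T (fun t => ∫ τ in (0 : ℝ)..t, F t τ) :=
        eLpNorm_add_le c1.aestronglyMeasurable c2.aestronglyMeasurable (by norm_num)
    _ ≤ _ := add_le_add (tnorm_regB_airyCurve_le s hε f₀ g₀ hh hT) hvol
    _ = _ := by ring

end

noncomputable section

/-! ### The algebra property -/

theorem freq_add_freq_sub (ξ η : ℝ) : freq η + freq (ξ - η) = freq ξ := by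
  simp only [freq]; ring

theorem MemHs.mul_mem {s : ℕ} {f g : L2} (hf : MemHs s f) (hg : MemHs s g) (hs : 1 ≤ s) :
    MemHs s (mul f g) ∧ hsNorm s (mul f g) ≤ algC s * hsNorm s f * hsNorm s g := by
  have h := bilinear_bound hf hg (S := fun ξ => sob s (freq ξ) * (𝓕 (mul f g) : L2) ξ)
    (aesm_symbol_mul (measurable_sob s) _) (r := fun a b => sob s (a + b)) (algC_nonneg s)
    (norm_sob_add_le hs) (by
      filter_upwards [fourier_mul (hf.integrable_fourier hs).1 (hg.integrable_fourier hs).1]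
        with ξ hξ
      rw [hξ, ← integral_const_mul]
      simp_rw [freq_add_freq_sub])
  have hm : MemHs s (mul f g) := memHs_iff.2 h.1
  refine ⟨hm, ?_⟩
  rw [hsNorm_eq_norm hm, multiplier, ← Lp.norm_fourier_eq (𝓕⁻ _ : L2),
    FourierTransform.fourier_fourierInv_eq]
  exact h.2

theorem mul_self_sub_mul_self {s : ℕ} {u v : L2} (hu : MemHs s u) (hv : MemHs s v)
    (hs : 1 ≤ s) : mul u u - mul v v = mul (u - v) u + mul v (u - v) := by
  rw [sub_mul_of_ae (hu.ae_norm_le hs) (hv.ae_norm_le hs), mul_sub_of_ae (hv.ae_norm_le hs)]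
  abel

theorem hsNorm_mul_self_sub_le {s : ℕ} {u v : L2} (hu : MemHs s u) (hv : MemHs s v)
    (hs : 1 ≤ s) {M : ℝ} (huM : hsNorm s u ≤ M) (hvM : hsNorm s v ≤ M) :
    hsNorm s (mul u u - mul v v) ≤ 2 * algC s * M * hsNorm s (u - v) := by
  have hw := hu.sub hv
  have hA := algC_nonneg s
  have hW := hsNorm_nonneg s (u - v)
  rw [mul_self_sub_mul_self hu hv hs]
  calc _ ≤ hsNorm s (mul (u - v) u) + hsNorm s (mul v (u - v)) :=
        hsNorm_add_le (hw.mul_mem hu hs).1 (hv.mul_mem hw hs).1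
    _ ≤ algC s * hsNorm s (u - v) * hsNorm s u + algC s * hsNorm s v * hsNorm s (u - v) :=
        add_le_add (hw.mul_mem hu hs).2 (hv.mul_mem hw hs).2
    _ ≤ algC s * hsNorm s (u - v) * M + algC s * M * hsNorm s (u - v) := by gcongr
    _ = _ := by ring

/-! ### The nonlinearity -/

theorem nonlin_eq {u : L2} {C : ℝ} (hu : ∀ᵐ x, ‖u x‖ ≤ C) :
    nonlin u = (1 / 2 : ℂ) • mul u u + (1 / 3 : ℂ) • mul (mul u u) u := by
  rw [← toL2_coe ((1 / 2 : ℂ) • mul u u + (1 / 3 : ℂ) • mul (mul u u) u), nonlin]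
  refine toL2_congr ?_
  rw [mul_comm' (mul u u) u]
  filter_upwards [coeFn_mul (g := u) hu, coeFn_mul (g := mul u u) hu,
    Lp.coeFn_add ((1 / 2 : ℂ) • mul u u) ((1 / 3 : ℂ) • mul u (mul u u)),
    Lp.coeFn_smul (1 / 2 : ℂ) (mul u u), Lp.coeFn_smul (1 / 3 : ℂ) (mul u (mul u u))]
    with x h1 h2 h3 h4 h5
  rw [h3, Pi.add_apply, h4, h5, Pi.smul_apply, Pi.smul_apply, h2, h1, smul_eq_mul, smul_eq_mul]
  ring

theorem MemHs.nonlin_mem {s : ℕ} {u : L2} (hu : MemHs s u) (hs : 1 ≤ s) : MemHs s (nonlin u) := by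
  rw [nonlin_eq (hu.ae_norm_le hs)]
  have h2 := (hu.mul_mem hu hs).1
  exact (h2.smul _).add (((h2.mul_mem hu hs).1).smul _)

theorem hsNorm_nonlin_sub_le {s : ℕ} {u v : L2} (hu : MemHs s u) (hv : MemHs s v)
    (hs : 1 ≤ s) {M : ℝ} (huM : hsNorm s u ≤ M) (hvM : hsNorm s v ≤ M) :
    hsNorm s (nonlin u - nonlin v) ≤
      (algC s * M + algC s ^ 2 * M ^ 2) * hsNorm s (u - v) := by
  have hw := hu.sub hv
  have hA := algC_nonneg s
  have hW := hsNorm_nonneg s (u - v)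
  have hM : 0 ≤ M := (hsNorm_nonneg s u).trans huM
  have hu2 := hu.mul_mem hu hs
  have hv2 := hv.mul_mem hv hs
  have hd := hu2.1.sub hv2.1
  have hdle := hsNorm_mul_self_sub_le hu hv hs huM hvM
  have b2 := hv2.1.ae_norm_le hs
  have e3 : mul (mul u u) u - mul (mul v v) v =
      mul (mul u u - mul v v) u + mul (mul v v) (u - v) := by
    rw [sub_mul_of_ae (hu2.1.ae_norm_le hs) b2, mul_sub_of_ae b2]; abel
  have h3 : hsNorm s (mul (mul u u) u - mul (mul v v) v) ≤
      3 * algC s ^ 2 * M ^ 2 * hsNorm s (u - v) := by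
    rw [e3]
    calc _ ≤ hsNorm s (mul (mul u u - mul v v) u) + hsNorm s (mul (mul v v) (u - v)) :=
          hsNorm_add_le (hd.mul_mem hu hs).1 (hv2.1.mul_mem hw hs).1
      _ ≤ algC s * hsNorm s (mul u u - mul v v) * hsNorm s u +
          algC s * hsNorm s (mul v v) * hsNorm s (u - v) :=
          add_le_add (hd.mul_mem hu hs).2 (hv2.1.mul_mem hw hs).2
      _ ≤ algC s * (2 * algC s * M * hsNorm s (u - v)) * M +
          algC s * (algC s * M * M) * hsNorm s (u - v) := by
          have h4 : hsNorm s (mul v v) ≤ algC s * M * M := by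
            refine hv2.2.trans ?_
            have := hsNorm_nonneg s v
            gcongr
          have h5 := hsNorm_nonneg s (mul u u - mul v v)
          have h6 := hsNorm_nonneg s u
          gcongr
      _ = _ := by ring
  have e : nonlin u - nonlin v = (1 / 2 : ℂ) • (mul u u - mul v v) +
      (1 / 3 : ℂ) • (mul (mul u u) u - mul (mul v v) v) := by
    rw [nonlin_eq (hu.ae_norm_le hs), nonlin_eq (hv.ae_norm_le hs)]; module
  have hc := (hu2.1.mul_mem hu hs).1.sub (hv2.1.mul_mem hv hs).1
  rw [e]
  refine (hsNorm_add_le (hd.smul _) (hc.smul _)).trans ?_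
  rw [hsNorm_smul _ hd, hsNorm_smul _ hc]
  have n2 : ‖(1 / 2 : ℂ)‖ = 1 / 2 := by norm_num
  have n3 : ‖(1 / 3 : ℂ)‖ = 1 / 3 := by norm_num
  rw [n2, n3]
  nlinarith

theorem measurable_ddxSym : Measurable fun k : ℝ => Complex.I * (k : ℂ) := by fun_prop

theorem norm_ddxSym_le {s : ℕ} (hs : 1 ≤ s) (k : ℝ) :
    ‖Complex.I * (k : ℂ)‖ ≤ 1 * jb k ^ s := by
  rw [norm_mul, Complex.norm_I, Complex.norm_real, Real.norm_eq_abs, one_mul, one_mul]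
  exact (abs_le_jb k).trans (le_self_pow₀ (one_le_jb k) (by omega))

theorem MemHs.norm_ddx_le {s : ℕ} {f : L2} (hf : MemHs s f) (hs : 1 ≤ s) :
    ‖ddx f‖ ≤ hsNorm s f := by
  have := hf.norm_multiplier_le measurable_ddxSym (norm_ddxSym_le hs)
  rwa [one_mul] at this

theorem MemHs.ddx_sub {s : ℕ} {f g : L2} (hf : MemHs s f) (hg : MemHs s g) (hs : 1 ≤ s) :
    ddx (f - g) = ddx f - ddx g :=
  (multiplier_sub (hf.memLp_symbol measurable_ddxSym (norm_ddxSym_le hs))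
    (hg.memLp_symbol measurable_ddxSym (norm_ddxSym_le hs))).2

theorem norm_ddx_nonlin_sub_le {s : ℕ} {u v : L2} (hu : MemHs s u) (hv : MemHs s v)
    (hs : 1 ≤ s) {M : ℝ} (huM : hsNorm s u ≤ M) (hvM : hsNorm s v ≤ M) :
    ‖ddx (nonlin u) - ddx (nonlin v)‖ ≤
      (algC s * M + algC s ^ 2 * M ^ 2) * hsNorm s (u - v) := by
  have h1 := hu.nonlin_mem hs
  have h2 := hv.nonlin_mem hs
  rw [← h1.ddx_sub h2 hs]
  exact ((h1.sub h2).norm_ddx_le hs).trans (hsNorm_nonlin_sub_le hu hv hs huM hvM)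

theorem nonlin_zero : nonlin 0 = 0 := by
  have h : mul (0 : L2) 0 = 0 := by
    have := mul_smul_of_ae (f := (0 : L2)) (g := 0) (C := 0) (0 : ℂ) (by
      filter_upwards [Lp.coeFn_zero ℂ 2 (volume : Measure ℝ)] with x hx
      rw [hx]; simp)
    simpa using this
  rw [nonlin_eq (u := 0) (C := 0)]
  · rw [h, h]; simp
  · filter_upwards [Lp.coeFn_zero ℂ 2 (volume : Measure ℝ)] with x hx
    rw [hx]; simp

theorem ddx_zero : ddx 0 = 0 := by
  have := ((memHs_zero 1).sub (memHs_zero 1)).norm_ddx_le le_rfl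
  rw [sub_zero, hsNorm_zero] at this
  exact norm_le_zero_iff.1 this

/-! ### The commutator -/

variable (s : ℕ) {ε : ℝ} (hε : 0 < ε)

/-- The regularized operator `(1 + ∂ₓ)^s ∂ₓ`. -/
def regP : L2 →L[ℂ] L2 := multiplierL (psym s ε) (isRegSymbol_psym s hε).bdd

theorem regB_apply (f g : L2) : regB s hε f g = mul f (regP s hε g) := regMul_apply _ _ _ _

/-- The defect in the Leibniz rule for the leading order terms. -/
def regR (f g : L2) : L2 := regP s hε (mul f g) - regB s hε f g - regB s hε g f

theorem regM_ddx {r : ℕ} {f : L2} (hf : MemHs r f) (hr : 1 ≤ r) :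
    regM s hε (ddx f) = regP s hε f := by
  refine fourier_ext ?_
  filter_upwards [fourier_multiplier (hf.memLp_symbol measurable_ddxSym (norm_ddxSym_le hr)),
    fourier_multiplier ((isRegSymbol_psym s hε).bdd.memLp (𝓕 f : L2)),
    fourier_multiplier ((isRegSymbol_msym s hε).bdd.memLp (𝓕 (ddx f) : L2))] with ξ h1 h2 h3
  refine h3.trans (Eq.trans ?_ h2.symm)
  rw [ddx, h1, psym]; ring

variable {s}

/-- On the Fourier side the defect is bilinear with symbol p(a+b) − p(a) − p(b). Subtracting both
terms in which P falls on one factor removes the loss of a derivative, uniformly in ε. -/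
theorem norm_regR_le (hs : 3 ≤ s) {f g : L2} (hf : MemHs s f) (hg : MemHs s g) :
    ‖regR s hε f g‖ ≤ comC s * hsNorm s f * hsNorm s g := by
  have hp := isRegSymbol_psym s hε
  have hs1 : 1 ≤ s := by omega
  have If := (hf.integrable_fourier hs1).1
  have Ig := (hg.integrable_fourier hs1).1
  have hPf := fourier_multiplier (hp.bdd.memLp (𝓕 f : L2))
  have hPg := fourier_multiplier (hp.bdd.memLp (𝓕 g : L2))
  have IPf : Integrable (𝓕 (multiplier (psym s ε) f) : L2) volume :=
    (hp.integrable (𝓕 f : L2)).congr hPf.symm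
  have IPg : Integrable (𝓕 (multiplier (psym s ε) g) : L2) volume :=
    (hp.integrable (𝓕 g : L2)).congr hPg.symm
  have hPg' : ∀ ξ, (fun η => (𝓕 (multiplier (psym s ε) g) : L2) (ξ - η)) =ᵐ[volume]
      fun η => psym s ε (freq (ξ - η)) * (𝓕 g : L2) (ξ - η) := fun ξ =>
    (quasiMeasurePreserving_sub_left volume ξ).ae_eq_comp hPg
  have h := bilinear_bound hf hg (S := fun ξ => (𝓕 (regR s hε f g) : L2) ξ)
    (Lp.aestronglyMeasurable _) (r := fun a b => psym s ε (a + b) - psym s ε a - psym s ε b)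
    (comC_nonneg s) (norm_psym_add_sub_le hs hε.le) (by
      filter_upwards [fourier_mul If Ig, fourier_mul If IPg, fourier_mul IPf Ig,
        fourier_multiplier (hp.bdd.memLp (𝓕 (mul f g) : L2)),
        fourier_sub_coe (regP s hε (mul f g) - regB s hε f g) (regB s hε g f),
        fourier_sub_coe (regP s hε (mul f g)) (regB s hε f g)] with ξ h1 h2 h3 h4 h5 h6
      have e1 : (𝓕 (regB s hε f g) : L2) ξ =
          ∫ η, psym s ε (freq (ξ - η)) * ((𝓕 f : L2) η * (𝓕 g : L2) (ξ - η)) := by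
        rw [regB_apply]
        refine h2.trans (integral_congr_ae ?_)
        filter_upwards [hPg' ξ] with η hη
        rw [hη]; ring
      have e2 : (𝓕 (regB s hε g f) : L2) ξ =
          ∫ η, psym s ε (freq η) * ((𝓕 f : L2) η * (𝓕 g : L2) (ξ - η)) := by
        rw [regB_apply, mul_comm']
        refine h3.trans (integral_congr_ae ?_)
        filter_upwards [hPf] with η hη
        rw [hη]; ring
      have e3 : (𝓕 (regP s hε (mul f g)) : L2) ξ =
          ∫ η, psym s ε (freq ξ) * ((𝓕 f : L2) η * (𝓕 g : L2) (ξ - η)) := by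
        rw [integral_const_mul, ← h1]; exact h4
      have I0 := integrable_mul_reflect (Lp.memLp (𝓕 f : L2)) (Lp.memLp (𝓕 g : L2)) ξ
      have i3 : Integrable (fun η => psym s ε (freq ξ) *
          ((𝓕 f : L2) η * (𝓕 g : L2) (ξ - η))) volume := I0.const_mul _
      have i1 : Integrable (fun η => psym s ε (freq (ξ - η)) *
          ((𝓕 f : L2) η * (𝓕 g : L2) (ξ - η))) volume :=
        (integrable_mul_reflect (Lp.memLp (𝓕 f : L2)) (hp.bdd.memLp (𝓕 g : L2)) ξ).congr
          (ae_of_all _ fun η => by simp only; ring)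
      have i2 : Integrable (fun η => psym s ε (freq η) *
          ((𝓕 f : L2) η * (𝓕 g : L2) (ξ - η))) volume :=
        (integrable_mul_reflect (hp.bdd.memLp (𝓕 f : L2)) (Lp.memLp (𝓕 g : L2)) ξ).congr
          (ae_of_all _ fun η => by simp only; ring)
      rw [regR, h5, h6, e1, e2, e3, ← integral_sub i3 i1]
      refine (integral_sub (i3.sub i1) i2).symm.trans ?_
      refine integral_congr_ae (ae_of_all _ fun η => ?_)
      simp only [Pi.sub_apply]
      rw [freq_add_freq_sub ξ η]
      ring)
  have e := h.2
  rwa [toL2_coe, Lp.norm_fourier_eq] at e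

theorem regR_sub_left (hs : 1 ≤ s) {f g : L2} (hf : MemHs s f) (hg : MemHs s g) (k : L2) :
    regR s hε (f - g) k = regR s hε f k - regR s hε g k := by
  simp only [regR, sub_mul_of_ae (hf.ae_norm_le hs) (hg.ae_norm_le hs), map_sub,
    sub_apply]
  abel

theorem regR_comm (f g : L2) : regR s hε f g = regR s hε g f := by
  rw [regR, regR, mul_comm' f g]; abel

theorem regR_sub_right (hs : 1 ≤ s) {f g : L2} (hf : MemHs s f) (hg : MemHs s g) (k : L2) :
    regR s hε k (f - g) = regR s hε k f - regR s hε k g := by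
  rw [regR_comm, regR_sub_left hε hs hf hg, regR_comm, regR_comm hε g]

variable (s)

/-- The lower order part of the nonlinearity. -/
def regRem (u : L2) : L2 := (1 / 2 : ℂ) • regR s hε u u +
  (1 / 3 : ℂ) • (regR s hε (mul u u) u + mul u (regR s hε u u))

variable {s}

/-- Up to defects, P(u²)/2 is uPu and P(u³)/3 is u²Pu. The cubic term is reached by applying the
defect identity to the pair (u², u) and then to (u, u). -/
theorem regM_ddx_nonlin (hs : 1 ≤ s) {u : L2} (hu : MemHs s u) :
    regM s hε (ddx (nonlin u)) =
      regB s hε u u + mul u (regB s hε u u) + regRem s hε u := by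
  have hb := hu.ae_norm_le hs
  rw [regM_ddx s hε (hu.nonlin_mem hs) hs, nonlin_eq hb, map_add, map_smul, map_smul]
  have e1 : regP s hε (mul u u) = (2 : ℂ) • regB s hε u u + regR s hε u u := by
    rw [regR]; module
  have e2 : regP s hε (mul (mul u u) u) = regR s hε (mul u u) u + mul u (regB s hε u u) +
      mul u ((2 : ℂ) • regB s hε u u + regR s hε u u) := by
    rw [← e1, regR, regB_apply s hε u u, ← mul_assoc_of_ae hb hb, ← regB_apply, ← regB_apply]
    abel
  rw [e1, e2, mul_add_of_ae hb, mul_smul_of_ae _ hb, regRem]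
  module

theorem norm_regRem_sub_le (hs : 3 ≤ s) {u v : L2} (hu : MemHs s u) (hv : MemHs s v) {M : ℝ}
    (huM : hsNorm s u ≤ M) (hvM : hsNorm s v ≤ M) :
    ‖regRem s hε u - regRem s hε v‖ ≤
      comC s * (M + (algC s + 71 / 100) * M ^ 2) * hsNorm s (u - v) := by
  have hs1 : 1 ≤ s := by omega
  have hw := hu.sub hv
  have hA := algC_nonneg s
  have hC := comC_nonneg s
  have hW := hsNorm_nonneg s (u - v)
  have hM : 0 ≤ M := (hsNorm_nonneg s u).trans huM
  have hu0 := hsNorm_nonneg s u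
  have hv0 := hsNorm_nonneg s v
  have hu2 := hu.mul_mem hu hs1
  have hv2 := hv.mul_mem hv hs1
  have hd := hu2.1.sub hv2.1
  have bu := hu.ae_norm_le hs1
  have bv := hv.ae_norm_le hs1
  set w := u - v with hwdef
  set W := hsNorm s w with hWdef
  have q1 : regR s hε u u - regR s hε v v = regR s hε w u + regR s hε v w := by
    rw [hwdef, regR_sub_left hε hs1 hu hv, regR_sub_right hε hs1 hu hv]; abel
  have n1 : ‖regR s hε u u - regR s hε v v‖ ≤ 2 * comC s * M * W := by
    rw [q1]
    calc _ ≤ comC s * W * hsNorm s u + comC s * hsNorm s v * W :=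
          norm_add_le_of_le (norm_regR_le hε hs hw hu) (norm_regR_le hε hs hv hw)
      _ ≤ comC s * W * M + comC s * M * W := by gcongr
      _ = _ := by ring
  have q2 : regR s hε (mul u u) u - regR s hε (mul v v) v =
      regR s hε (mul u u - mul v v) u + regR s hε (mul v v) w := by
    rw [hwdef, regR_sub_left hε hs1 hu2.1 hv2.1, regR_sub_right hε hs1 hu hv]; abel
  have n2 : ‖regR s hε (mul u u) u - regR s hε (mul v v) v‖ ≤
      3 * comC s * algC s * M ^ 2 * W := by
    rw [q2]
    have h4 : hsNorm s (mul v v) ≤ algC s * M * M := by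
      refine hv2.2.trans ?_
      gcongr
    have h5 := hsNorm_mul_self_sub_le hu hv hs1 huM hvM
    rw [← hwdef, ← hWdef] at h5
    have h6 := hsNorm_nonneg s (mul u u - mul v v)
    have h7 := hsNorm_nonneg s (mul v v)
    calc _ ≤ comC s * hsNorm s (mul u u - mul v v) * hsNorm s u +
          comC s * hsNorm s (mul v v) * W :=
          norm_add_le_of_le (norm_regR_le hε hs hd hu) (norm_regR_le hε hs hv2.1 hw)
      _ ≤ comC s * (2 * algC s * M * W) * M + comC s * (algC s * M * M) * W := by gcongr
      _ = _ := by ring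
  have q3 : mul u (regR s hε u u) - mul v (regR s hε v v) =
      mul w (regR s hε u u) + mul v (regR s hε u u - regR s hε v v) := by
    rw [hwdef, sub_mul_of_ae bu bv, mul_sub_of_ae bv]; abel
  have n3 : ‖mul u (regR s hε u u) - mul v (regR s hε v v)‖ ≤
      3 * comC s * (71 / 100) * M ^ 2 * W := by
    rw [q3]
    have h8 : ‖regR s hε u u‖ ≤ comC s * M * M :=
      (norm_regR_le hε hs hu hu).trans (by gcongr)
    calc _ ≤ (71 / 100 * W) * ‖regR s hε u u‖ +
          (71 / 100 * hsNorm s v) * ‖regR s hε u u - regR s hε v v‖ :=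
          norm_add_le_of_le (norm_mul_le_of_ae (hw.ae_norm_le hs1)) (norm_mul_le_of_ae bv)
      _ ≤ (71 / 100 * W) * (comC s * M * M) + (71 / 100 * M) * (2 * comC s * M * W) := by gcongr
      _ = _ := by ring
  have e : regRem s hε u - regRem s hε v = (1 / 2 : ℂ) • (regR s hε u u - regR s hε v v) +
      (1 / 3 : ℂ) • ((regR s hε (mul u u) u - regR s hε (mul v v) v) +
        (mul u (regR s hε u u) - mul v (regR s hε v v))) := by
    rw [regRem, regRem]; module
  rw [e]
  refine (norm_add_le _ _).trans ?_
  rw [norm_smul, norm_smul]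
  have c2 : ‖(1 / 2 : ℂ)‖ = 1 / 2 := by norm_num
  have c3 : ‖(1 / 3 : ℂ)‖ = 1 / 3 := by norm_num
  rw [c2, c3]
  have n4 := norm_add_le_of_le n2 n3
  calc _ ≤ 1 / 2 * (2 * comC s * M * W) + 1 / 3 * (3 * comC s * algC s * M ^ 2 * W +
        3 * comC s * (71 / 100) * M ^ 2 * W) := by gcongr
    _ = _ := by ring

/-- The decomposition of the difference of two nonlinearities into terms amenable to local
smoothing and a remainder of lower order. -/
theorem norm_regM_ddx_nonlin_sub_le (hs : 3 ≤ s) {u v : L2} (hu : MemHs s u) (hv : MemHs s v)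
    {M : ℝ} (huM : hsNorm s u ≤ M) (hvM : hsNorm s v ≤ M) :
    ‖regM s hε (ddx (nonlin u) - ddx (nonlin v))‖ ≤
      (1 + 71 / 100 * M) * ‖regB s hε u (u - v)‖ +
      (1 + 142 / 100 * M) * ‖regB s hε (u - v) v‖ +
      comC s * (M + (algC s + 71 / 100) * M ^ 2) * hsNorm s (u - v) := by
  have hs1 : 1 ≤ s := by omega
  have hw := hu.sub hv
  have bu := hu.ae_norm_le hs1
  have bv := hv.ae_norm_le hs1
  have bw := hw.ae_norm_le hs1
  have hrem := norm_regRem_sub_le hε hs hu hv huM hvM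
  set w := u - v with hwdef
  have e1 : regB s hε u u - regB s hε v v = regB s hε u w + regB s hε w v := by
    rw [hwdef]; simp only [map_sub, sub_apply]; abel
  -- The bounded factor v and the rough coefficient w are exchanged, so that every top order term is
  -- a bounded function times either uPw or wPv, the two products to which smoothing applies.
  have e2 : mul w (regB s hε v v) = mul v (regB s hε w v) := by
    rw [regB_apply, regB_apply, ← mul_assoc_of_ae bw bv, ← mul_assoc_of_ae bv bw, mul_comm' w v]
  have e3 : mul u (regB s hε u u) - mul v (regB s hε v v) =
      mul u (regB s hε u w) + mul u (regB s hε w v) + mul v (regB s hε w v) := by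
    rw [← e2, ← mul_add_of_ae bu, ← e1, mul_sub_of_ae bu, hwdef, sub_mul_of_ae bu bv]; abel
  have e : regM s hε (ddx (nonlin u) - ddx (nonlin v)) =
      (regB s hε u w + mul u (regB s hε u w)) +
      (regB s hε w v + mul u (regB s hε w v) + mul v (regB s hε w v)) +
      (regRem s hε u - regRem s hε v) := by
    rw [map_sub, regM_ddx_nonlin hε hs1 hu, regM_ddx_nonlin hε hs1 hv]
    have : ∀ a b c a' b' c' : L2, (a + b + c) - (a' + b' + c') = (a - a') + (b - b') + (c - c') :=
      fun a b c a' b' c' => by abel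
    rw [this, e1, e3]; abel
  rw [e]
  refine norm_add₃_le.trans (add_le_add (add_le_add ?_ ?_) hrem)
  · have h1 := norm_mul_le_of_ae (g := regB s hε u w) bu
    have h2 := norm_nonneg (regB s hε u w)
    refine (norm_add_le _ _).trans ?_
    nlinarith
  · have h1 := norm_mul_le_of_ae (g := regB s hε w v) bu
    have h2 := norm_mul_le_of_ae (g := regB s hε w v) bv
    have h3 := norm_nonneg (regB s hε w v)
    refine norm_add₃_le.trans ?_
    nlinarith

end

noncomputable section

/-! ### Removing the regularization -/

theorem tendsto_norm_multiplier_msym {s : ℕ} {f : L2} (hf : MemHs s f) :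
    Tendsto (fun ε => ‖multiplier (msym s ε) f‖) (𝓝[>] 0) (𝓝 (hsNorm s f)) := by
  have hms : ∀ ε, Measurable fun k => sob s k - msym s ε k := fun ε =>
    (measurable_sob s).sub (continuous_msym s ε).measurable
  have hle : ∀ᶠ ε : ℝ in 𝓝[>] 0, ∀ k, ‖sob s k - msym s ε k‖ ≤ 2 * jb k ^ s := by
    filter_upwards [self_mem_nhdsWithin] with ε hε k
    refine (norm_sub_le _ _).trans ?_
    rw [norm_sob]
    linarith [norm_msym_le s (le_of_lt hε) k]
  have key := tendsto_multiplier_zero (l := 𝓝[>] (0 : ℝ))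
    (σ := fun ε k => sob s k - msym s ε k) (B := fun k => 2 * jb k ^ s) (f := f) hms
    (by
      refine (hf.const_mul 4).congr (ae_of_all _ fun ξ => ?_)
      simp only
      rw [← jb_sq]; ring) hle
    (fun k => by
      have hc : Continuous fun ε => sob s k - msym s ε k := by unfold msym; fun_prop
      have h0 := hc.tendsto 0
      have e : sob s k - msym s 0 k = 0 := by simp [msym]
      rw [e] at h0
      exact h0.mono_left nhdsWithin_le_nhds)
  rw [hsNorm_eq_norm hf, tendsto_iff_norm_sub_tendsto_zero]
  refine squeeze_zero' (Eventually.of_forall fun _ => norm_nonneg _) ?_ key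
  filter_upwards [self_mem_nhdsWithin] with ε hε
  have hm := hf.memLp_symbol (σ := msym s ε) (C := 1) (continuous_msym s ε).measurable
    fun k => by rw [one_mul]; exact norm_msym_le s (le_of_lt hε) k
  have e : multiplier (fun k => sob s k - msym s ε k) f =
      multiplier (sob s) f - multiplier (msym s ε) f := by
    have hd : MemLp (fun ξ => (sob s (freq ξ) - msym s ε (freq ξ)) * (𝓕 f : L2) ξ) 2 volume := by
      refine ((memHs_iff.1 hf).sub hm).ae_eq (ae_of_all _ fun ξ => ?_)
      simp only [Pi.sub_apply]; ring
    refine fourier_ext ?_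
    filter_upwards [fourier_multiplier (σ := fun k => sob s k - msym s ε k) hd,
      fourier_multiplier (memHs_iff.1 hf), fourier_multiplier hm,
      fourier_sub_coe (multiplier (sob s) f) (multiplier (msym s ε) f)] with ξ h1 h2 h3 h4
    rw [h1, h4, h2, h3]; ring
  rw [e, Real.norm_eq_abs, norm_sub_rev]
  exact abs_norm_sub_norm_le _ _

/-- Regularized bounds that are uniform in ε pass to the H^s norm, by dominated convergence as ε
tends to 0. -/
theorem hsNorm_le_of_regM {s : ℕ} {f : L2} (hf : MemHs s f) {C : ℝ}
    (h : ∀ (ε : ℝ) (hε : 0 < ε), ‖regM s hε f‖ ≤ C) : hsNorm s f ≤ C := by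
  refine le_of_tendsto (tendsto_norm_multiplier_msym hf) ?_
  filter_upwards [self_mem_nhdsWithin] with ε hε
  exact h ε hε

theorem norm_regM_le {s : ℕ} {ε : ℝ} (hε : 0 < ε) {f : L2} (hf : MemHs s f) :
    ‖regM s hε f‖ ≤ hsNorm s f := by
  have := hf.norm_multiplier_le (σ := msym s ε) (C := 1) (continuous_msym s ε).measurable
    fun k => by rw [one_mul]; exact norm_msym_le s hε.le k
  rwa [one_mul] at this

/-! ### Solutions -/

/-- `v` is a solution in `H^s` on `[0, T]` with initial value `φ`; `h` and `z` are the continuous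
curves `∂ₓ(½v² + ⅓v³)` and `v_t`. -/
structure IsSolution (s : ℕ) (T : ℝ) (φ : L2) (v h z : ℝ → L2) : Prop where
  memHs_init : MemHs s φ
  memHs : ∀ t ∈ Icc 0 T, MemHs s (v t)
  continuousOn_hsNorm : ContinuousOn (fun t => hsNorm s (v t)) (Icc 0 T)
  continuous_nonlin : Continuous h
  continuous_deriv : Continuous z
  nonlin_eq : ∀ t ∈ Icc 0 T, h t = ddx (nonlin (v t))
  deriv_eq : ∀ t ∈ Icc 0 T, z t = multiplier cubeSym (v t) - h t
  eq_airyCurve : ∀ t ∈ Icc 0 T, v t = airyCurve φ h t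

namespace IsSolution

variable {s : ℕ} {T : ℝ} {φ ψ : L2} {v h z u k y : ℝ → L2}

theorem mono (hv : IsSolution s T φ v h z) {T' : ℝ} (hT : T' ≤ T) :
    IsSolution s T' φ v h z where
  memHs_init := hv.memHs_init
  memHs t ht := hv.memHs t ⟨ht.1, ht.2.trans hT⟩
  continuousOn_hsNorm := hv.continuousOn_hsNorm.mono (Icc_subset_Icc_right hT)
  continuous_nonlin := hv.continuous_nonlin
  continuous_deriv := hv.continuous_deriv
  nonlin_eq t ht := hv.nonlin_eq t ⟨ht.1, ht.2.trans hT⟩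
  deriv_eq t ht := hv.deriv_eq t ⟨ht.1, ht.2.trans hT⟩
  eq_airyCurve t ht := hv.eq_airyCurve t ⟨ht.1, ht.2.trans hT⟩

/-- Comparison with this solution turns every estimate for differences into a bound for a single
solution. -/
theorem zero (s : ℕ) (T : ℝ) : IsSolution s T 0 (fun _ => 0) (fun _ => 0) (fun _ => 0) where
  memHs_init := memHs_zero s
  memHs _ _ := memHs_zero s
  continuousOn_hsNorm := continuousOn_const
  continuous_nonlin := continuous_const
  continuous_deriv := continuous_const
  nonlin_eq _ _ := by rw [nonlin_zero, ddx_zero]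
  deriv_eq _ _ := by
    have := (memHs_zero 3).norm_multiplier_le continuous_cubeSym.measurable norm_cubeSym_le
    rw [hsNorm_zero, mul_zero] at this
    rw [norm_le_zero_iff.1 this, sub_zero]
  eq_airyCurve _ _ := by simp [airyCurve]

theorem apply_zero (hv : IsSolution s T φ v h z) (hT : 0 ≤ T) : v 0 = φ := by
  rw [hv.eq_airyCurve 0 ⟨le_rfl, hT⟩]; simp [airyCurve, airyL_zero]

theorem eq_add_integral (hs : 3 ≤ s) (hv : IsSolution s T φ v h z) {t : ℝ} (ht : t ∈ Icc 0 T) :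
    airyCurve φ h t = φ + ∫ τ in (0 : ℝ)..t, z τ := by
  refine airyCurve_eq_add_integral hv.continuous_nonlin hv.continuous_deriv (fun r hr => ?_) ht
  rw [← hv.eq_airyCurve r hr]
  exact ⟨(hv.memHs r hr).mono hs, hv.deriv_eq r hr⟩

/-- The equation expresses the time derivative through u_xxx, bounded in L² by the H^s norm as s ≥
3, and the nonlinearity, bounded by the algebra property. -/
theorem norm_deriv_sub_le (hs : 3 ≤ s) (hv : IsSolution s T φ v h z)
    (hu : IsSolution s T ψ u k y) {t M : ℝ} (ht : t ∈ Icc 0 T) (hvM : hsNorm s (v t) ≤ M)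
    (huM : hsNorm s (u t) ≤ M) :
    ‖z t - y t‖ ≤ (1 + algC s * M + algC s ^ 2 * M ^ 2) * hsNorm s (v t - u t) := by
  have h1 := hv.memHs t ht
  have h2 := hu.memHs t ht
  have hw := h1.sub h2
  have hc : ∀ x, ‖cubeSym x‖ ≤ 1 * jb x ^ s := fun x => (norm_cubeSym_le x).trans
    (by rw [one_mul, one_mul]; exact pow_le_pow_right₀ (one_le_jb x) hs)
  have hm := continuous_cubeSym.measurable
  have e : z t - y t = multiplier cubeSym (v t - u t) -
      (ddx (nonlin (v t)) - ddx (nonlin (u t))) := by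
    rw [hv.deriv_eq t ht, hu.deriv_eq t ht, hv.nonlin_eq t ht, hu.nonlin_eq t ht,
      (multiplier_sub (h1.memLp_symbol hm hc) (h2.memLp_symbol hm hc)).2]
    abel
  rw [e]
  refine (norm_sub_le _ _).trans ?_
  have n1 := hw.norm_multiplier_le hm hc
  have n2 := norm_ddx_nonlin_sub_le h1 h2 (by omega) hvM huM
  linarith

/-! ### Space-time estimates for differences of solutions -/

theorem tnorm_lt_top {E : Type*} [NormedAddCommGroup E] {F : ℝ → E} (hF : Continuous F) (T : ℝ) :
    tnorm T F ≠ ⊤ := by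
  obtain ⟨C, hC⟩ := isCompact_Icc.exists_bound_of_continuousOn (s := Icc 0 T) hF.continuousOn
  refine (MemLp.of_bound hF.aestronglyMeasurable C ?_).2.ne
  filter_upwards [ae_restrict_mem measurableSet_Ioc] with t ht
  exact hC t (Ioc_subset_Icc_self ht)

/-- The space-time size of the regularized nonlinearity of a difference of solutions. -/
def gain (s : ℕ) {ε : ℝ} (hε : 0 < ε) (T : ℝ) (h k : ℝ → L2) : ℝ :=
  Real.sqrt T * (tnorm T fun t => regM s hε (h t - k t)).toReal

theorem gain_nonneg (s : ℕ) {ε : ℝ} (hε : 0 < ε) (T : ℝ) (h k : ℝ → L2) :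
    0 ≤ gain s hε T h k := mul_nonneg (Real.sqrt_nonneg _) ENNReal.toReal_nonneg

theorem continuous_regM_sub (s : ℕ) {ε : ℝ} (hε : 0 < ε) (hh : Continuous h) (hk : Continuous k) :
    Continuous fun t => regM s hε (h t - k t) := (regM s hε).continuous.comp (hh.sub hk)

theorem ofReal_gain (s : ℕ) {ε : ℝ} (hε : 0 < ε) (T : ℝ) (hh : Continuous h)
    (hk : Continuous k) : ENNReal.ofReal (gain s hε T h k) =
      ENNReal.ofReal (Real.sqrt T) * tnorm T fun t => regM s hε (h t - k t) := by
  rw [gain, ENNReal.ofReal_mul (Real.sqrt_nonneg _),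
    ENNReal.ofReal_toReal (tnorm_lt_top (continuous_regM_sub s hε hh hk) T)]

/-- The regularized operator commutes with the Airy group, so it can be applied inside Duhamel's
formula. Cauchy–Schwarz in time produces the √T contained in `gain`. -/
theorem norm_regM_sub_le {ε : ℝ} (hε : 0 < ε) (hv : IsSolution s T φ v h z)
    (hu : IsSolution s T ψ u k y) {t : ℝ} (ht : t ∈ Icc 0 T) :
    ‖regM s hε (v t - u t)‖ ≤ hsNorm s (φ - ψ) + gain s hε T h k := by
  have hh := hv.continuous_nonlin
  have hk := hu.continuous_nonlin
  have e : regM s hε (v t - u t) =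
      airyCurve (regM s hε (φ - ψ)) (fun τ => regM s hε (h τ - k τ)) t := by
    rw [hv.eq_airyCurve t ht, hu.eq_airyCurve t ht, airyCurve_sub _ _ hh hk]
    exact map_airyCurve (multiplierL_airyL _) _ (hh.sub hk) t
  have h1 := enorm_airyCurve_le (regM s hε (φ - ψ)) (continuous_regM_sub s hε hh hk) ht
  rw [← e, ← ofReal_gain s hε T hh hk, ← ofReal_norm, ← ofReal_norm,
    ← ENNReal.ofReal_add (norm_nonneg _) (gain_nonneg _ _ _ _ _),
    ENNReal.ofReal_le_ofReal_iff (add_nonneg (norm_nonneg _) (gain_nonneg _ _ _ _ _))] at h1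
  refine h1.trans ?_
  gcongr
  exact norm_regM_le hε (hv.memHs_init.sub hu.memHs_init)

/-- The local smoothing estimate for products of solutions. -/
theorem sqrt_mul_tnorm_regB_le {ε : ℝ} (hε : 0 < ε) {f : ℝ → L2} {f₀ : L2} {ζ : ℝ → L2}
    (hζ : Continuous ζ) (hT : 0 ≤ T) (hf : ∀ t ∈ Icc 0 T, f t = f₀ + ∫ τ in (0 : ℝ)..t, ζ τ)
    {Z : ℝ} (hZ0 : 0 ≤ Z) (hZ : ∀ t ∈ Icc 0 T, ‖ζ t‖ ≤ Z) (hh : Continuous h)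
    (hk : Continuous k) (g₀ : L2) :
    tnorm T (fun t => regB s hε (f t) (airyCurve g₀ (fun τ => h τ - k τ) t)) ≤
      ENNReal.ofReal (58 / 100 * ((‖f₀‖ + T * Z) * (‖regM s hε g₀‖ + gain s hε T h k))) := by
  refine (tnorm_regB_le s hε (h := fun τ => h τ - k τ) (hh.sub hk) hζ hT hf
    (Z := ENNReal.ofReal Z) fun t ht => ?_).trans
    (le_of_eq ?_)
  · rw [← ofReal_norm]; exact ENNReal.ofReal_le_ofReal (hZ t ht)
  · have hg := gain_nonneg s hε T h k
    rw [← ofReal_gain s hε T hh hk, ← ofReal_norm, ← ofReal_norm,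
      ← ENNReal.ofReal_mul hT, ← ENNReal.ofReal_add (norm_nonneg _) (mul_nonneg hT hZ0),
      ← ENNReal.ofReal_add (norm_nonneg _) hg, ← ENNReal.ofReal_mul (by positivity),
      ← ENNReal.ofReal_mul (by norm_num)]

theorem tnorm_const_mul_norm {F : ℝ → L2} (a : ℝ) (ha : 0 ≤ a) (T : ℝ) :
    tnorm T (fun t => a * ‖F t‖) = ENNReal.ofReal a * tnorm T F := by
  have : tnorm T (fun t => a * ‖F t‖) = ‖a‖ₑ * tnorm T (fun t => ‖F t‖) :=
    eLpNorm_const_smul (p := 2) (μ := volume.restrict (Ioc 0 T)) a (fun t => ‖F t‖)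
  rw [this, tnorm, eLpNorm_norm, ← ofReal_norm, Real.norm_of_nonneg ha, tnorm]

theorem tnorm_const {a : ℝ} (ha : 0 ≤ a) (hT : 0 ≤ T) :
    tnorm T (fun _ : ℝ => a) = ENNReal.ofReal (a * Real.sqrt T) := by
  have h : tnorm T (fun _ : ℝ => a) ^ 2 = ENNReal.ofReal (a * Real.sqrt T) ^ 2 := by
    rw [tnorm_sq, lintegral_const, ← ofReal_norm, Real.norm_of_nonneg ha,
      ← ENNReal.ofReal_pow ha, ← ENNReal.ofReal_pow (by positivity), mul_pow, Real.sq_sqrt hT,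
      ENNReal.ofReal_mul (by positivity)]
    simp
  exact le_antisymm (ennreal_le_of_sq_le h.le) (ennreal_le_of_sq_le h.ge)

/-- The nonlinear estimate for a difference of solutions. -/
theorem gain_le (hs : 3 ≤ s) {ε : ℝ} (hε : 0 < ε) (hT : 0 ≤ T) (hv : IsSolution s T φ v h z)
    (hu : IsSolution s T ψ u k y) {M W E Z : ℝ} (hM : 0 ≤ M) (hW : 0 ≤ W) (hZ : 0 ≤ Z)
    (hvM : ∀ t ∈ Icc 0 T, hsNorm s (v t) ≤ M) (huM : ∀ t ∈ Icc 0 T, hsNorm s (u t) ≤ M)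
    (hwW : ∀ t ∈ Icc 0 T, hsNorm s (v t - u t) ≤ W)
    (hzZ : ∀ t ∈ Icc 0 T, ‖z t‖ ≤ Z * M) (hzyZ : ∀ t ∈ Icc 0 T, ‖z t - y t‖ ≤ Z * W)
    (hE : hsNorm s ψ + gain s hε T k (fun _ => 0) ≤ E) :
    gain s hε T h k ≤ Real.sqrt T * ((1 + 71 / 100 * M) * (58 / 100 *
        ((hsNorm s φ + T * (Z * M)) * (hsNorm s (φ - ψ) + gain s hε T h k))) +
      (1 + 142 / 100 * M) * (58 / 100 * ((hsNorm s (φ - ψ) + T * (Z * W)) * E)) +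
      comC s * (M + (algC s + 71 / 100) * M ^ 2) * W * Real.sqrt T) := by
  have hh := hv.continuous_nonlin
  have hk := hu.continuous_nonlin
  have hA := algC_nonneg s
  have hC := comC_nonneg s
  have hδ := hsNorm_nonneg s (φ - ψ)
  have hφ0 := hsNorm_nonneg s φ
  have hg0 := gain_nonneg s hε T h k
  have hE0 : 0 ≤ E := (add_nonneg (hsNorm_nonneg s ψ) (gain_nonneg _ _ _ _ _)).trans hE
  set a1 := 1 + 71 / 100 * M with ha1
  set a2 := 1 + 142 / 100 * M with ha2
  set a3 := comC s * (M + (algC s + 71 / 100) * M ^ 2) * W with ha3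
  have a1p : 0 ≤ a1 := by positivity
  have a2p : 0 ≤ a2 := by positivity
  have a3p : 0 ≤ a3 := by positivity
  -- The Duhamel curves are continuous on all of ℝ and agree with the solutions on [0, T].
  set V := airyCurve φ h
  set U := airyCurve ψ k
  set w := airyCurve (φ - ψ) (fun τ => h τ - k τ)
  have hV : Continuous V := continuous_airyCurve φ hh
  have hU : Continuous U := continuous_airyCurve ψ hk
  have hw : Continuous w := continuous_airyCurve _ (hh.sub hk)
  have hwe : ∀ t, V t - U t = w t := fun t => airyCurve_sub φ ψ hh hk t
  have step : tnorm T (fun t => regM s hε (h t - k t)) ≤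
      ENNReal.ofReal a1 * tnorm T (fun t => regB s hε (V t) (w t)) +
      ENNReal.ofReal a2 * tnorm T (fun t => regB s hε (w t) (U t)) +
      ENNReal.ofReal (a3 * Real.sqrt T) := by
    have c1 : Continuous fun t => a1 * ‖regB s hε (V t) (w t)‖ :=
      continuous_const.mul (continuous_regB s hε hV hw).norm
    have c2 : Continuous fun t => a2 * ‖regB s hε (w t) (U t)‖ :=
      continuous_const.mul (continuous_regB s hε hw hU).norm
    calc tnorm T (fun t => regM s hε (h t - k t))
        ≤ tnorm T (fun t => (a1 * ‖regB s hε (V t) (w t)‖ + a2 * ‖regB s hε (w t) (U t)‖) +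
            a3) := by
          refine eLpNorm_mono_ae ?_
          filter_upwards [ae_restrict_mem measurableSet_Ioc] with t ht
          have ht' := Ioc_subset_Icc_self ht
          have hb := norm_regM_ddx_nonlin_sub_le hε hs (hv.memHs t ht') (hu.memHs t ht')
            (hvM t ht') (huM t ht')
          rw [← hv.nonlin_eq t ht', ← hu.nonlin_eq t ht'] at hb
          have hc : comC s * (M + (algC s + 71 / 100) * M ^ 2) * hsNorm s (v t - u t) ≤ a3 := by
            rw [ha3]; gcongr; exact hwW t ht'
          have ew : v t - u t = w t := by
            rw [hv.eq_airyCurve t ht', hu.eq_airyCurve t ht', ← hwe]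
          rw [Real.norm_of_nonneg (by positivity)]
          refine hb.trans (add_le_add ?_ hc)
          rw [ew, hv.eq_airyCurve t ht', hu.eq_airyCurve t ht']
      _ ≤ tnorm T (fun t => a1 * ‖regB s hε (V t) (w t)‖ + a2 * ‖regB s hε (w t) (U t)‖) +
            tnorm T (fun _ => a3) :=
          eLpNorm_add_le (c1.add c2).aestronglyMeasurable aestronglyMeasurable_const (by norm_num)
      _ ≤ (tnorm T (fun t => a1 * ‖regB s hε (V t) (w t)‖) +
            tnorm T (fun t => a2 * ‖regB s hε (w t) (U t)‖)) + tnorm T (fun _ => a3) := by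
          gcongr
          exact eLpNorm_add_le c1.aestronglyMeasurable c2.aestronglyMeasurable (by norm_num)
      _ = _ := by
          rw [tnorm_const_mul_norm a1 a1p, tnorm_const_mul_norm a2 a2p, tnorm_const a3p hT]
  have hzi := hv.continuous_deriv
  have hyi := hu.continuous_deriv
  -- Coefficient V, with time derivative z, and smoothing of the difference w; this puts the gain on
  -- the right-hand side as well.
  have k1 := sqrt_mul_tnorm_regB_le (s := s) hε hzi hT (fun t ht => hv.eq_add_integral hs ht)
    (mul_nonneg hZ hM) hzZ hh hk (φ - ψ)
  -- Roles exchanged: the coefficient is w, with time derivative z − y, and smoothing is applied to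
  -- the solution U alone. Its size is what E bounds.
  have k2 := sqrt_mul_tnorm_regB_le (s := s) (k := fun _ => 0) (f := w) (f₀ := φ - ψ)
    (ζ := fun τ => z τ - y τ) hε
    (hzi.sub hyi) hT
    (fun t ht => by
      have e1 : V t = _ := hv.eq_add_integral hs ht
      have e2 : U t = _ := hu.eq_add_integral hs ht
      rw [← hwe, e1, e2,
        intervalIntegral.integral_sub (hzi.intervalIntegrable _ _) (hyi.intervalIntegrable _ _)]
      abel) (mul_nonneg hZ hW) hzyZ hk continuous_const ψ
  simp only [sub_zero] at k2
  have hφn := hv.memHs_init.norm_le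
  have hδm := hv.memHs_init.sub hu.memHs_init
  have b1 : tnorm T (fun t => regB s hε (V t) (w t)) ≤ ENNReal.ofReal (58 / 100 *
      ((hsNorm s φ + T * (Z * M)) * (hsNorm s (φ - ψ) + gain s hε T h k))) := by
    refine k1.trans (ENNReal.ofReal_le_ofReal ?_)
    have := norm_regM_le hε hδm
    gcongr
  have b2 : tnorm T (fun t => regB s hε (w t) (U t)) ≤ ENNReal.ofReal (58 / 100 *
      ((hsNorm s (φ - ψ) + T * (Z * W)) * E)) := by
    refine k2.trans (ENNReal.ofReal_le_ofReal ?_)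
    have h1 := hδm.norm_le
    have h2 := norm_regM_le hε hu.memHs_init
    have h3 := gain_nonneg s hε T k fun _ => 0
    gcongr
    linarith
  have fin : tnorm T (fun t => regM s hε (h t - k t)) ≤ ENNReal.ofReal
      (a1 * (58 / 100 * ((hsNorm s φ + T * (Z * M)) * (hsNorm s (φ - ψ) + gain s hε T h k))) +
      a2 * (58 / 100 * ((hsNorm s (φ - ψ) + T * (Z * W)) * E)) + a3 * Real.sqrt T) := by
    rw [ENNReal.ofReal_add (by positivity) (by positivity),
      ENNReal.ofReal_add (by positivity) (by positivity), ENNReal.ofReal_mul a1p,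
      ENNReal.ofReal_mul a2p]
    refine step.trans ?_
    gcongr
  have := ENNReal.toReal_mono ENNReal.ofReal_ne_top fin
  rw [ENNReal.toReal_ofReal (by positivity)] at this
  exact mul_le_mul_of_nonneg_left this (Real.sqrt_nonneg T)

end IsSolution

end

noncomputable section

/-! ### Short times -/

/-- One step multiplies the left side by at most (5/4)(49/36) < 2. -/
theorem add_four_mul_pow_le (r : ℕ) : ((r : ℝ) + 4) * (49 / 36) ^ r ≤ 4 * 2 ^ r := by
  induction r with
  | zero => norm_num
  | succ r ih =>
    have h : (0 : ℝ) ≤ (49 / 36) ^ r := by positivity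
    have hr : (0 : ℝ) ≤ r := r.cast_nonneg
    push_cast
    rw [pow_succ, pow_succ]
    nlinarith [mul_nonneg hr h]

/-- The algebra and commutator constants grow at most like s(7/6)^s and their product like
s(49/36)^s, so √s·2^s dominates them. The number 173/100 is just below √3, the least value of √s. -/
theorem constants_le {s : ℕ} (hs : 3 ≤ s) :
    1 ≤ algC s ∧ algC s ^ 2 ≤ 28 / 100 * (Real.sqrt s * 2 ^ s) ∧
      comC s ≤ 12 / 10 * (Real.sqrt s * 2 ^ s) ∧
      comC s * algC s ≤ 23 / 10 * (Real.sqrt s * 2 ^ s) := by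
  obtain ⟨r, rfl⟩ := Nat.exists_eq_add_of_le' hs
  have e1 : r + 3 - 1 = r + 2 := by omega
  have e2 : r + 3 - 3 = r := by omega
  rw [algC, comC, e1, e2]
  have hq : (173 / 100 : ℝ) ≤ Real.sqrt ((r + 3 : ℕ) : ℝ) := by
    refine Real.le_sqrt_of_sq_le ?_
    push_cast
    have : (0 : ℝ) ≤ r := r.cast_nonneg
    norm_num; linarith
  have hb : 173 / 100 * (8 * 2 ^ r) ≤ Real.sqrt ((r + 3 : ℕ) : ℝ) * 2 ^ (r + 3) := by
    have e : (2 : ℝ) ^ (r + 3) = 8 * 2 ^ r := by rw [pow_add]; norm_num; ring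
    rw [e]; gcongr
  set b := Real.sqrt ((r + 3 : ℕ) : ℝ) * 2 ^ (r + 3)
  have h4 := add_four_mul_pow_le r
  have hp1 : (1 : ℝ) ≤ (7 / 6) ^ r := one_le_pow₀ (by norm_num)
  have hpp : ((7 / 6 : ℝ) ^ r) ^ 2 = (49 / 36) ^ r := by
    rw [← pow_mul, mul_comm, pow_mul]; norm_num
  rw [← hpp] at h4
  rw [pow_add (7 / 6 : ℝ) r 2]
  set p := (7 / 6 : ℝ) ^ r
  set P := (2 : ℝ) ^ r
  have hr : (0 : ℝ) ≤ r := r.cast_nonneg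
  have hP : p ^ 2 ≤ P := by nlinarith [mul_nonneg hr (sq_nonneg p)]
  have hpq : p ≤ p ^ 2 := by nlinarith
  have hrp : ((r : ℝ) + 4) * p ≤ 4 * P := le_trans (by gcongr) h4
  push_cast
  refine ⟨by nlinarith, by nlinarith, by nlinarith, ?_⟩
  have e : (8 * ((r : ℝ) + 3 + 1) * p + 1) / 2 * (17 / 12 * (p * (7 / 6) ^ 2)) =
      17 / 12 * (7 / 6) ^ 2 * (4 * ((r + 4) * p ^ 2) + p / 2) := by ring
  rw [e]
  linarith

/-- The smallness conditions on the length `T` of the time interval, in terms of a bound `ρ` for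
the data, under which the difference estimate closes. -/
structure IsShort (s : ℕ) (T ρ : ℝ) : Prop where
  one_le : 1 ≤ ρ
  nonneg : 0 ≤ T
  mul_deriv_le : T * (1 + algC s * (3 / 2 * ρ) + algC s ^ 2 * (3 / 2 * ρ) ^ 2) ≤ 1 / 45
  sqrt_mul_le : Real.sqrt T * ρ ^ 2 ≤ 1 / 62
  comC_mul_le : comC s * (3 / 2 * ρ + (algC s + 71 / 100) * (3 / 2 * ρ) ^ 2) * T ≤ 9 / 62

theorem IsShort.mono {s : ℕ} {T T' ρ : ℝ} (h : IsShort s T ρ) (h0 : 0 ≤ T') (hT : T' ≤ T) :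
    IsShort s T' ρ := by
  have hρ : 0 ≤ ρ := zero_le_one.trans h.one_le
  have hA := algC_nonneg s
  have hC := comC_nonneg s
  refine ⟨h.one_le, h0, le_trans ?_ h.mul_deriv_le, le_trans ?_ h.sqrt_mul_le,
    le_trans ?_ h.comC_mul_le⟩
  · gcongr
  · gcongr
  · gcongr

theorem isShort_of_alpha_le {s : ℕ} (hs : 3 ≤ s) {T R : ℝ} (hT : 0 < T) (hR : 0 ≤ R)
    (h : alpha s T * T ^ (1 / 2 : ℝ) * (3 + T) ^ (3 / 2 : ℝ) * (12 * R ^ 2 + 16 * R + 6) ≤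
      1 / 2) : IsShort s T (R + 1) := by
  obtain ⟨hA, hA2, hC, hCA⟩ := constants_le hs
  have hC0 := comC_nonneg s
  rw [alpha, ← Real.sqrt_eq_rpow] at h
  set β := Real.sqrt s * 2 ^ s
  set y := Real.sqrt T with hy
  have hy0 : 0 ≤ y := Real.sqrt_nonneg T
  have hyT : y * y = T := Real.mul_self_sqrt hT.le
  have hβ : 0 ≤ β := by positivity
  -- 31/6 is just below 3^{3/2}; with the 6 of the next inequality it makes 31, which is the origin
  -- of 1/62.
  have h3 : (31 / 6 : ℝ) ≤ (3 + T) ^ (3 / 2 : ℝ) := by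
    have : ((31 / 6 : ℝ) ^ 2) ^ (1 / 2 : ℝ) ≤ ((3 + T) ^ (3 : ℝ)) ^ (1 / 2 : ℝ) := by
      refine Real.rpow_le_rpow (by positivity) ?_ (by norm_num)
      rw [show (3 : ℝ) = ((3 : ℕ) : ℝ) by norm_num, Real.rpow_natCast]
      push_cast
      calc (31 / 6 : ℝ) ^ 2 ≤ 3 ^ 3 := by norm_num
        _ ≤ (3 + T) ^ 3 := by gcongr; linarith
    rw [← Real.sqrt_eq_rpow, Real.sqrt_sq (by norm_num), ← Real.rpow_mul (by positivity)] at this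
    norm_num at this ⊢
    exact this
  have hq : (31 / 6 : ℝ) * (6 * (R + 1) ^ 2) ≤
      (3 + T) ^ (3 / 2 : ℝ) * (12 * R ^ 2 + 16 * R + 6) := by
    gcongr
    nlinarith
  -- α·√T equals βT + √T, so the hypothesis bounds both βTρ² and √T·ρ² by 1/62.
  have hm : (β * T + y) * (31 / 6 * (6 * (R + 1) ^ 2)) ≤ 1 / 2 := by
    refine le_trans (mul_le_mul_of_nonneg_left hq (by positivity)) (le_trans (le_of_eq ?_) h)
    rw [← hyT]; ring
  set ρ := R + 1 with hρ
  have hρ1 : 1 ≤ ρ := by linarith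
  have hx0 : 0 ≤ β * T * ρ ^ 2 := by positivity
  have hyρ : 0 ≤ y * ρ ^ 2 := by positivity
  have hx : β * T * ρ ^ 2 ≤ 1 / 62 := by linarith
  have hyρ' : y * ρ ^ 2 ≤ 1 / 62 := by linarith
  have hρρ : ρ ≤ ρ ^ 2 := by nlinarith
  have hρ2 : 1 ≤ ρ ^ 2 := by nlinarith
  have hAA : algC s ≤ algC s ^ 2 := by nlinarith
  have hTρ : 0 ≤ T * ρ ^ 2 := by positivity
  refine ⟨hρ1, hT.le, ?_, hyρ', ?_⟩
  · calc T * (1 + algC s * (3 / 2 * ρ) + algC s ^ 2 * (3 / 2 * ρ) ^ 2)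
        ≤ T * (algC s ^ 2 * ρ ^ 2 + algC s ^ 2 * (3 / 2 * ρ ^ 2) +
            algC s ^ 2 * (3 / 2 * ρ) ^ 2) := by
          gcongr
          nlinarith
      _ = 19 / 4 * (algC s ^ 2 * (T * ρ ^ 2)) := by ring
      _ ≤ 19 / 4 * (28 / 100 * β * (T * ρ ^ 2)) := by gcongr
      _ ≤ 1 / 45 := by nlinarith
  · calc comC s * (3 / 2 * ρ + (algC s + 71 / 100) * (3 / 2 * ρ) ^ 2) * T
        ≤ comC s * (3 / 2 * ρ ^ 2 + (algC s + 71 / 100) * (3 / 2 * ρ) ^ 2) * T := by gcongr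
      _ = (1239 / 400 * comC s + 9 / 4 * (comC s * algC s)) * (T * ρ ^ 2) := by ring
      _ ≤ (1239 / 400 * (12 / 10 * β) + 9 / 4 * (23 / 10 * β)) * (T * ρ ^ 2) := by gcongr
      _ ≤ 9 / 62 := by nlinarith

/-! ### Closing the estimates on a short interval -/

namespace IsSolution

variable {s : ℕ} {T ρ : ℝ} {φ ψ : L2} {v h z u k y : ℝ → L2}

theorem norm_deriv_le (hs : 3 ≤ s) (hv : IsSolution s T φ v h z) {t M : ℝ} (hM : 0 ≤ M)
    (ht : t ∈ Icc 0 T) (hvM : hsNorm s (v t) ≤ M) :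
    ‖z t‖ ≤ (1 + algC s * M + algC s ^ 2 * M ^ 2) * M := by
  have hA := algC_nonneg s
  have := norm_deriv_sub_le hs hv (zero s T) ht hvM (by rw [hsNorm_zero]; exact hM)
  rw [sub_zero, sub_zero] at this
  refine this.trans ?_
  gcongr

theorem gain_zero (s : ℕ) {ε : ℝ} (hε : 0 < ε) (T : ℝ) :
    gain s hε T (fun _ => 0) (fun _ => 0) = 0 := by
  simp [gain, tnorm]

theorem gain_le_of_isShort (hs : 3 ≤ s) (hT : IsShort s T ρ) {ε : ℝ} (hε : 0 < ε)
    (hv : IsSolution s T φ v h z) (hu : IsSolution s T ψ u k y) {W : ℝ} (hW : 0 ≤ W)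
    (hφ : hsNorm s φ ≤ ρ) (hvM : ∀ t ∈ Icc 0 T, hsNorm s (v t) ≤ 3 / 2 * ρ)
    (huM : ∀ t ∈ Icc 0 T, hsNorm s (u t) ≤ 3 / 2 * ρ)
    (hwW : ∀ t ∈ Icc 0 T, hsNorm s (v t - u t) ≤ W)
    (hE : hsNorm s ψ + gain s hε T k (fun _ => 0) ≤ 7 / 5 * ρ) :
    gain s hε T h k ≤ 7 / 100 * hsNorm s (φ - ψ) + 15 / 100 * W := by
  have hρ : 0 ≤ ρ := zero_le_one.trans hT.one_le
  have hM : 0 ≤ 3 / 2 * ρ := by positivity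
  have hA := algC_nonneg s
  set Z := 1 + algC s * (3 / 2 * ρ) + algC s ^ 2 * (3 / 2 * ρ) ^ 2 with hZ
  have hZ0 : 0 ≤ Z := by positivity
  have key := gain_le hs hε hT.nonneg hv hu hM hW hZ0 hvM huM hwW
    (fun t ht => norm_deriv_le hs hv hM ht (hvM t ht))
    (fun t ht => (norm_deriv_sub_le hs hv hu ht (hvM t ht) (huM t ht)).trans
      (by gcongr; exact hwW t ht)) hE
  have hδ := hsNorm_nonneg s (φ - ψ)
  have hg := gain_nonneg s hε T h k
  set δ := hsNorm s (φ - ψ)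
  set g := gain s hε T h k
  have hTZ : T * Z ≤ 1 / 45 := hT.mul_deriv_le
  have hy := hT.sqrt_mul_le
  have hc := hT.comC_mul_le
  have hr0 := Real.sqrt_nonneg T
  have hrr : Real.sqrt T * Real.sqrt T = T := Real.mul_self_sqrt hT.nonneg
  set r := Real.sqrt T
  have hρ1 := hT.one_le
  -- Since ρ ≥ 1, constants are absorbed into multiples of ρ: 2.065 = 1 + 0.71·3/2, 3.13 = 1 +
  -- 1.42·3/2 and 31/30 = 1 + (3/2)/45.
  have b1 : (1 + 71 / 100 * (3 / 2 * ρ)) * (58 / 100 *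
      ((hsNorm s φ + T * (Z * (3 / 2 * ρ))) * (δ + g))) ≤
      (2065 / 1000 * ρ) * (58 / 100 * ((31 / 30 * ρ) * (δ + g))) := by
    have h1 : hsNorm s φ + T * (Z * (3 / 2 * ρ)) ≤ 31 / 30 * ρ := by nlinarith
    have h2 : 1 + 71 / 100 * (3 / 2 * ρ) ≤ 2065 / 1000 * ρ := by linarith
    have h3 := mul_nonneg hT.nonneg (mul_nonneg hZ0 hM)
    have h4 := hsNorm_nonneg s φ
    have h5 : 0 ≤ δ + g := by linarith
    have h6 : 0 ≤ hsNorm s φ + T * (Z * (3 / 2 * ρ)) := by linarith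
    exact mul_le_mul h2 (by gcongr) (mul_nonneg (by norm_num) (mul_nonneg h6 h5)) (by positivity)
  have b2 : (1 + 142 / 100 * (3 / 2 * ρ)) * (58 / 100 * ((δ + T * (Z * W)) * (7 / 5 * ρ))) ≤
      (313 / 100 * ρ) * (58 / 100 * ((δ + 1 / 45 * W) * (7 / 5 * ρ))) := by
    have h1 : T * (Z * W) ≤ 1 / 45 * W := by nlinarith
    have h2 : 1 + 142 / 100 * (3 / 2 * ρ) ≤ 313 / 100 * ρ := by linarith
    have h3 := mul_nonneg hT.nonneg (mul_nonneg hZ0 hW)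
    have h4 : 0 ≤ δ + T * (Z * W) := by linarith
    exact mul_le_mul h2 (by gcongr)
      (mul_nonneg (by norm_num) (mul_nonneg h4 (by positivity))) (by positivity)
  have b3 : r * (comC s * (3 / 2 * ρ + (algC s + 71 / 100) * (3 / 2 * ρ) ^ 2) * W * r) ≤
      9 / 62 * W := by
    have : r * (comC s * (3 / 2 * ρ + (algC s + 71 / 100) * (3 / 2 * ρ) ^ 2) * W * r) =
      comC s * (3 / 2 * ρ + (algC s + 71 / 100) * (3 / 2 * ρ) ^ 2) * T * W := by
      rw [← hrr]; ring
    rw [this]; gcongr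
  have c1 := mul_le_mul_of_nonneg_left b1 hr0
  have c2 := mul_le_mul_of_nonneg_left b2 hr0
  have d1 : r * ((2065 / 1000 * ρ) * (58 / 100 * ((31 / 30 * ρ) * (δ + g)))) ≤
      124 / 100 * (1 / 62 * (δ + g)) := by
    calc _ = 2065 / 1000 * (58 / 100) * (31 / 30) * (r * ρ ^ 2 * (δ + g)) := by ring
      _ ≤ 124 / 100 * (1 / 62 * (δ + g)) := by gcongr; norm_num
  have d2 : r * ((313 / 100 * ρ) * (58 / 100 * ((δ + 1 / 45 * W) * (7 / 5 * ρ)))) ≤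
      255 / 100 * (1 / 62 * (δ + 1 / 45 * W)) := by
    calc _ = 313 / 100 * (58 / 100) * (7 / 5) * (r * ρ ^ 2 * (δ + 1 / 45 * W)) := by ring
      _ ≤ 255 / 100 * (1 / 62 * (δ + 1 / 45 * W)) := by gcongr; norm_num
  rw [mul_add, mul_add] at key
  -- The gain occurs on the right with coefficient 0.02 and is absorbed, being a finite real number.
  linarith

/-- The supremum W, finite by the assumed bounds, satisfies W ≤ 1.07δ + 0.15W, and 1.07/0.85 < 1.26.
-/
theorem hsNorm_sub_le_of_isShort (hs : 3 ≤ s) (hT : IsShort s T ρ)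
    (hv : IsSolution s T φ v h z) (hu : IsSolution s T ψ u k y)
    (hφ : hsNorm s φ ≤ ρ) (hvM : ∀ t ∈ Icc 0 T, hsNorm s (v t) ≤ 3 / 2 * ρ)
    (huM : ∀ t ∈ Icc 0 T, hsNorm s (u t) ≤ 3 / 2 * ρ)
    (hE : ∀ (ε : ℝ) (hε : 0 < ε), hsNorm s ψ + gain s hε T k (fun _ => 0) ≤ 7 / 5 * ρ)
    {t : ℝ} (ht : t ∈ Icc 0 T) :
    hsNorm s (v t - u t) ≤ 126 / 100 * hsNorm s (φ - ψ) := by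
  set S := (fun t => hsNorm s (v t - u t)) '' Icc 0 T with hS
  have hbdd : BddAbove S := by
    refine ⟨3 / 2 * ρ + 3 / 2 * ρ, ?_⟩
    rintro _ ⟨r, hr, rfl⟩
    exact (hsNorm_sub_le (hv.memHs r hr) (hu.memHs r hr)).trans
      (add_le_add (hvM r hr) (huM r hr))
  have hle : ∀ r ∈ Icc 0 T, hsNorm s (v r - u r) ≤ sSup S := fun r hr =>
    le_csSup hbdd ⟨r, hr, rfl⟩
  have hW : 0 ≤ sSup S := (hsNorm_nonneg _ _).trans (hle t ht)
  have hsup : sSup S ≤ 107 / 100 * hsNorm s (φ - ψ) + 15 / 100 * sSup S := by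
    refine csSup_le ⟨_, t, ht, rfl⟩ ?_
    rintro _ ⟨r, hr, rfl⟩
    refine hsNorm_le_of_regM ((hv.memHs r hr).sub (hu.memHs r hr)) fun ε hε => ?_
    have h1 := norm_regM_sub_le hε hv hu hr
    have h2 := gain_le_of_isShort hs hT hε hv hu hW hφ hvM huM hle (hE ε hε)
    linarith
  have := hle t ht
  have := hsNorm_nonneg s (φ - ψ)
  linarith

/-- Comparison with the zero solution improves the assumed factor 3/2 to 1.26; this strict
improvement drives the continuity argument. -/
theorem hsNorm_le_mul_of_isShort (hs : 3 ≤ s) (hT : IsShort s T ρ)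
    (hv : IsSolution s T φ v h z) (hφ : hsNorm s φ ≤ ρ)
    (hvM : ∀ t ∈ Icc 0 T, hsNorm s (v t) ≤ 3 / 2 * ρ) {t : ℝ} (ht : t ∈ Icc 0 T) :
    hsNorm s (v t) ≤ 126 / 100 * ρ := by
  have hρ := hT.one_le
  have h0 : hsNorm s (0 : L2) ≤ 3 / 2 * ρ := by rw [hsNorm_zero]; positivity
  have := hsNorm_sub_le_of_isShort hs hT hv (zero s T) hφ hvM (fun _ _ => h0)
    (fun ε hε => by rw [gain_zero, hsNorm_zero]; linarith) ht
  rw [sub_zero, sub_zero] at this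
  linarith

/-- A continuity argument. -/
theorem _root_.CKdV.le_of_continuousOn_of_bootstrap {f : ℝ → ℝ} {T c : ℝ}
    (hf : ContinuousOn f (Icc 0 T))
    (h : ∀ T' ∈ Icc 0 T, (∀ t ∈ Ico 0 T', f t ≤ c) → f T' < c) : ∀ t ∈ Icc 0 T, f t ≤ c := by
  by_contra! hcon
  obtain ⟨t₁, ht₁, hct₁⟩ := hcon
  have hcl : IsCompact (Icc 0 T ∩ f ⁻¹' Ici c) :=
    isCompact_Icc.of_isClosed_subset (hf.preimage_isClosed_of_isClosed isClosed_Icc isClosed_Ici)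
      inter_subset_left
  -- t₀ is the first time at which the threshold c is reached.
  obtain ⟨t₀, ⟨ht₀, hct₀⟩, hmin⟩ := hcl.exists_isLeast ⟨t₁, ht₁, hct₁.le⟩
  refine absurd (h t₀ ht₀ fun t ht => ?_) (not_lt.2 hct₀)
  by_contra! hlt
  exact absurd (hmin ⟨⟨ht.1, ht.2.le.trans ht₀.2⟩, hlt.le⟩) (not_le.2 ht.2)

/-- The a priori bound for a solution. -/
theorem hsNorm_le_of_isShort (hs : 3 ≤ s) (hT : IsShort s T ρ)
    (hv : IsSolution s T φ v h z) (hφ : hsNorm s φ ≤ ρ) :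
    ∀ t ∈ Icc 0 T, hsNorm s (v t) ≤ 3 / 2 * ρ := by
  have hρ := hT.one_le
  refine le_of_continuousOn_of_bootstrap hv.continuousOn_hsNorm fun T' hT' hb => ?_
  rcases hT'.1.eq_or_lt with rfl | hpos
  · rw [hv.apply_zero hT.nonneg]; linarith
  -- By continuity the bound before T' persists at T'.
  have hcl : Icc 0 T' ⊆ closure (Ico 0 T') := by rw [closure_Ico hpos.ne]
  have hcT := hv.continuousOn_hsNorm.mono (Icc_subset_Icc_right hT'.2)
  have hb' : ∀ t ∈ Icc 0 T', hsNorm s (v t) ≤ 3 / 2 * ρ := fun t ht =>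
    ContinuousWithinAt.closure_le (hcl ht)
      ((hcT t ht).mono Ico_subset_Icc_self) continuousWithinAt_const hb
  have := hsNorm_le_mul_of_isShort hs (hT.mono hT'.1 hT'.2) (hv.mono hT'.2) hφ hb'
    (t := T') ⟨hT'.1, le_rfl⟩
  linarith

/-- Continuous dependence on the initial value. -/
theorem hsNorm_sub_le_mul (hs : 3 ≤ s) (hT : IsShort s T ρ)
    (hv : IsSolution s T φ v h z) (hu : IsSolution s T ψ u k y) (hφ : hsNorm s φ ≤ ρ)
    (hψ : hsNorm s ψ ≤ ρ) {t : ℝ} (ht : t ∈ Icc 0 T) :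
    hsNorm s (v t - u t) ≤ 126 / 100 * hsNorm s (φ - ψ) := by
  have hρ := hT.one_le
  have huM := hsNorm_le_of_isShort hs hT hu hψ
  refine hsNorm_sub_le_of_isShort hs hT hv hu hφ (hsNorm_le_of_isShort hs hT hv hφ) huM
    (fun ε hε => ?_) ht
  have h0 : hsNorm s (0 : L2) ≤ 3 / 2 * ρ := by rw [hsNorm_zero]; positivity
  -- Comparing u with zero gives a gain of at most (0.07 + 0.15·3/2)ρ, so the required 7/5·ρ is met
  -- with room to spare.
  have := gain_le_of_isShort hs hT hε hu (zero s T) (W := 3 / 2 * ρ) (by positivity) hψ huM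
    (fun _ _ => h0) (fun r hr => by rw [sub_zero]; exact huM r hr)
    (by rw [gain_zero, hsNorm_zero]; linarith)
  rw [sub_zero] at this
  linarith

end IsSolution

/-! ### Fixed points of the Duhamel map -/

theorem continuousOn_hsNorm_of_memCHs {s : ℕ} {T : ℝ} {v : ℝ → L2} (hv : MemCHs s T v) :
    ContinuousOn (fun t => hsNorm s (v t)) (Icc 0 T) := by
  intro t ht
  rw [ContinuousWithinAt, tendsto_iff_norm_sub_tendsto_zero]
  refine squeeze_zero' (Eventually.of_forall fun _ => norm_nonneg _) ?_ (hv.2 t ht)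
  filter_upwards [self_mem_nhdsWithin] with r hr
  have m1 := hv.1 r hr
  have m2 := hv.1 t ht
  have h1 := hsNorm_add_le (m1.sub m2) m2
  have h2 := hsNorm_sub_le m1 (m1.sub m2)
  rw [sub_add_cancel] at h1
  rw [sub_sub_cancel] at h2
  rw [Real.norm_eq_abs, abs_le]
  constructor <;> linarith

theorem continuousOn_of_norm_sub_le {s : ℕ} {T : ℝ} {v F : ℝ → L2} (hv : MemCHs s T v) (C : ℝ)
    (h : ∀ r ∈ Icc 0 T, ∀ t ∈ Icc 0 T, ‖F r - F t‖ ≤ C * hsNorm s (v r - v t)) :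
    ContinuousOn F (Icc 0 T) := by
  intro t ht
  rw [ContinuousWithinAt, tendsto_iff_norm_sub_tendsto_zero]
  have hlim := (hv.2 t ht).const_mul C
  rw [mul_zero] at hlim
  refine squeeze_zero' (Eventually.of_forall fun _ => norm_nonneg _) ?_ hlim
  filter_upwards [self_mem_nhdsWithin] with r hr
  exact h r hr t ht

/-- The differentiated nonlinearity and v_xxx are L²-continuous on [0, T] because they are
Lipschitz, respectively linear, in the H^s norm. Both curves are extended by constants to be
continuous on ℝ, which is harmless since the Duhamel integral up to t ≤ T sees only [0, t]. -/
theorem MemCHs.exists_isSolution {s : ℕ} (hs : 3 ≤ s) {T : ℝ} (hT : 0 ≤ T) {φ : L2}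
    (hφ : MemHs s φ) {v : ℝ → L2} (hv : MemCHs s T v)
    (hfix : ∀ t ∈ Icc 0 T, v t = duhamel v φ t) : ∃ h z, IsSolution s T φ v h z := by
  have hs1 : 1 ≤ s := by omega
  have hn := continuousOn_hsNorm_of_memCHs hv
  obtain ⟨M, hM⟩ := isCompact_Icc.exists_bound_of_continuousOn hn
  have hM' : ∀ t ∈ Icc 0 T, hsNorm s (v t) ≤ M := fun t ht => (le_abs_self _).trans (hM t ht)
  have hc : ∀ x, ‖cubeSym x‖ ≤ 1 * jb x ^ s := fun x => (norm_cubeSym_le x).trans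
    (by rw [one_mul, one_mul]; exact pow_le_pow_right₀ (one_le_jb x) hs)
  have hm := continuous_cubeSym.measurable
  have c1 : ContinuousOn (fun t => ddx (nonlin (v t))) (Icc 0 T) :=
    continuousOn_of_norm_sub_le hv _ fun r hr t ht =>
      norm_ddx_nonlin_sub_le (hv.1 r hr) (hv.1 t ht) hs1 (hM' r hr) (hM' t ht)
  have c2 : ContinuousOn (fun t => multiplier cubeSym (v t)) (Icc 0 T) :=
    continuousOn_of_norm_sub_le hv 1 fun r hr t ht => by
      rw [← (multiplier_sub ((hv.1 r hr).memLp_symbol hm hc)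
        ((hv.1 t ht).memLp_symbol hm hc)).2]
      exact ((hv.1 r hr).sub (hv.1 t ht)).norm_multiplier_le hm hc
  have e1 : ∀ t ∈ Icc 0 T, IccExtend hT ((Icc 0 T).domRestrict fun t => ddx (nonlin (v t))) t =
      ddx (nonlin (v t)) := fun t ht => IccExtend_of_mem hT _ ht
  have k1 : Continuous (IccExtend hT ((Icc 0 T).domRestrict fun t => ddx (nonlin (v t)))) :=
    (continuousOn_iff_continuous_domRestrict.1 c1).Icc_extend'
  refine ⟨_, IccExtend hT ((Icc 0 T).domRestrict
    fun t => multiplier cubeSym (v t) - ddx (nonlin (v t))), hφ, hv.1, hn, k1,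
    (continuousOn_iff_continuous_domRestrict.1 (c2.sub c1)).Icc_extend', e1, fun t ht => ?_,
    fun t ht => ?_⟩
  · rw [e1 t ht, IccExtend_of_mem hT _ ht]; rfl
  · rw [hfix t ht, airyCurve_eq φ k1, duhamel, airyL_apply]
    congr 1
    refine intervalIntegral.integral_congr fun τ hτ => ?_
    rw [uIcc_of_le ht.1] at hτ
    rw [e1 τ ⟨hτ.1, hτ.2.trans ht.2⟩, airyL_apply]

end

end CKdV

/-! ### The theorem -/

theorem proposition2p3 (s : ℕ) (hs : 3 ≤ s) (T : ℝ) (hT : 0 < T)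
    (φ φn : CKdV.L2) (hφ : CKdV.MemHs s φ) (hφn : CKdV.MemHs s φn)
    (hle : CKdV.hsNorm s φn ≤ CKdV.hsNorm s φ + 1)
    (v vn : ℝ → CKdV.L2) (hv : CKdV.MemCHs s T v) (hvn : CKdV.MemCHs s T vn)
    (hfix : ∀ t ∈ Set.Icc 0 T, v t = CKdV.duhamel v φ t)
    (hfixn : ∀ t ∈ Set.Icc 0 T, vn t = CKdV.duhamel vn φn t)
    (hsmall : CKdV.alpha s T * T ^ (1 / 2 : ℝ) * (3 + T) ^ (3 / 2 : ℝ) *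
      (12 * CKdV.hsNorm s φ ^ 2 + 16 * CKdV.hsNorm s φ + 6) ≤ 1 / 2) :
    ∀ t ∈ Set.Icc 0 T,
      CKdV.hsNorm s (v t - vn t) ≤
        2 * (3 + T) ^ (1 / 2 : ℝ) * CKdV.hsNorm s (φ - φn) := by
  intro t ht
  obtain ⟨h, z, hsol⟩ := hv.exists_isSolution hs hT.le hφ hfix
  obtain ⟨k, y, hsoln⟩ := hvn.exists_isSolution hs hT.le hφn hfixn
  have hshort := CKdV.isShort_of_alpha_le hs hT (CKdV.hsNorm_nonneg s φ) hsmall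
  -- The constant obtained is 1.26, smaller than 2 ≤ 2(3+T)^{1/2}.
  refine (CKdV.IsSolution.hsNorm_sub_le_mul hs hshort hsol hsoln (by linarith) hle ht).trans ?_
  have h1 : (1 : ℝ) ≤ (3 + T) ^ (1 / 2 : ℝ) := Real.one_le_rpow (by linarith) (by norm_num)
  have h2 := CKdV.hsNorm_nonneg s (φ - φn)
  gcongr
  linarith
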